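/- Let $s\ge 1$ be an integer and $c>0$ a real number. **Limit family.** Let $(\mathcal A,\varphi)$ be a tracial $*$-probability space, i.e. $\mathcal A$ is a unital complex $*$-algebra and $\varphi:\mathcal A\to\mathbb C$ is a unital, tracial, positive linear functional. A permutation $\tau$ of $[n]=\{1,\dots,n\}$ is non-crossing if $\#(\tau)+\#(\tau^{-1}\gamma_n)=n+1$, where $\#$ counts cycles (fixed points included) and $\gamma_n=(1,2,\dots,n)$; the non-crossing cumulants $k_n:\mathcal A^n\to\mathbb C$ $(n\ge1)$ are defined recursively by $\varphi(A_1\cdots A_n)=\sum_{\tau}\prod_{C}k_{p}(A_{a_1},\dots,A_{a_p})$, where $\tau$ runs over the non-crossing permutations of $[n]$ and $C=(a_1,\dots,a_p)$, $a_1=\min_i a_i$, over the cycles of $\tau$. Let $(U_r,G_r,W_r)_{r=1}^s$ be elements of $\mathcal A$ such that * each $U_r$ is a Haar unitary: $U_r^*U_r=U_rU_r^*=1$ and $\varphi(U_r^n)=0$ for $n\in\mathbb Z\setminus\{0\}$; * each $G_r$ is standard circular: the only non-zero cumulants with entries $G_r,G_r^*$ are $k_2(G_r,G_r^*)=k_2(G_r^*,G_r)=1$;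 * each $W_r$ is free Poisson of parameter $c$: $W_r^*=W_r$ and $k_n(W_r,\dots,W_r)=c$ for all $n\ge1$; * the family of the $2s$ elements $U_1,\dots,U_s,G_1,\dots,G_s$ is $*$-free, and so is the family of the $2s$ elements $U_1,\dots,U_s,W_1,\dots,W_s$. **Random matrices.** Let $(\Omega,\mathcal F,P)$ be a probability space and let $(f_{r;i,j})_{1\le r\le s;\,i,j\ge1}$ be complex random variables whose real and imaginary parts together form an independent family of real Gaussian variables of mean $0$ and variance $1/2$. Put $G_r^{(M,N)}=[f_{r;i,j}]_{1\le i\le M,\,1\le j\le N}$, $G_r^{(N)}=N^{-1/2}G_r^{(N,N)}$ and $W_r^{(M,N)}=N^{-1}(G_r^{(M,N)})^*G_r^{(M,N)}$. For every $N\ge1$ let $U_1^{(N)},\dots,U_s^{(N)}$ be uniformly distributed random $N\times N$ permutation matrices on $\Omega$, such that the $2s$ random matrices $U_1^{(N)},\dots,U_s^{(N)},G_1^{(N)},\dots,G_s^{(N)}$ are independent for every $N\ge1$, and the $2s$ random matrices $U_1^{(N)},\dots,U_s^{(N)},W_1^{(M,N)},\dots,W_s^{(M,N)}$ are independent for all $M,N\ge1$.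 **Theorem.** As $M,N\to\infty$ with $M/N\to c$, the families $(U_r^{(N)},G_r^{(N)})_{r=1}^s$ converge in $*$-distribution almost surely to $(U_r,G_r)_{r=1}^s$, and the families $(U_r^{(N)},W_r^{(M,N)})_{r=1}^s$ converge in $*$-distribution almost surely to $(U_r,W_r)_{r=1}^s$. That is: let $\alpha$ be a monomial in the $U_r,G_r$ and their adjoints, or a monomial in the $U_r,W_r$ and their adjoints, and let $\alpha^{(M,N)}$ be the random $N\times N$ matrix obtained from $\alpha$ by replacing $U_r,G_r,W_r$ by $U_r^{(N)},G_r^{(N)},W_r^{(M,N)}$. Then for all non-decreasing sequences of integers $(M_q)_{q\ge1}$, $(N_q)_{q\ge1}$ tending to infinity with $\lim_{q\to\infty}M_q/N_q=c$, $$\lim_{q\to\infty}\frac1{N_q}\operatorname{Tr}\alpha^{(M_q,N_q)}=\varphi(\alpha)\qquad\text{almost surely.}$$ -/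

import Mathlib

open MeasureTheory ProbabilityTheory Filter Topology

namespace RandPerm

/-! ### Cycles of permutations and non-crossing permutations -/

/-- The minima of the cycles of `τ`: one representative for each cycle of `τ`
(a fixed point is a cycle of length one). -/
def leaders {n : ℕ} (τ : Equiv.Perm (Fin n)) : Finset (Fin n) :=
  Finset.univ.filter fun a => ∀ b, τ.SameCycle a b → a ≤ b

/-- The number `#(τ)` of cycles of `τ`, fixed points included. -/
def numCycles {n : ℕ} (τ : Equiv.Perm (Fin n)) : ℕ := (leaders τ).card

/-- The non-crossing permutations of `Fin n`: `#(τ) + #(τ⁻¹γ) = n + 1` for the long cycle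
`γ = (0, 1, …, n - 1)`. -/
def NC (n : ℕ) : Finset (Equiv.Perm (Fin n)) :=
  Finset.univ.filter fun τ => numCycles τ + numCycles (τ⁻¹ * finRotate n) = n + 1

/-- The length of the cycle of `τ` through `a`. -/
noncomputable def cycleLength {n : ℕ} (τ : Equiv.Perm (Fin n)) (a : Fin n) : ℕ :=
  Function.minimalPeriod τ a

theorem cycleLength_lt {n : ℕ} {τ : Equiv.Perm (Fin n)} (hτ : τ ∈ NC n)
    (hne : τ ≠ finRotate n) (a : Fin n) : cycleLength τ a < n := by
  have hle : cycleLength τ a ≤ n := by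
    simpa [cycleLength] using Function.minimalPeriod_le_card (f := τ) (x := a)
  refine lt_of_le_of_ne hle fun heq => hne ?_
  -- a cycle of length `n` visits every point
  have hall : ∀ b, τ.SameCycle a b := by
    have hinj : Function.Injective fun i : Fin n => (τ ^ (i : ℕ)) a := by
      intro i j hij
      have hi : (i : ℕ) < Function.minimalPeriod τ a := by
        have := i.2
        unfold cycleLength at heq
        omega
      have hj : (j : ℕ) < Function.minimalPeriod τ a := by
        have := j.2
        unfold cycleLength at heq
        omega
      have h' : τ^[(i : ℕ)] a = τ^[(j : ℕ)] a := by
        simpa only [Equiv.Perm.iterate_eq_pow] using hij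
      exact Fin.ext ((Function.iterate_eq_iterate_iff_of_lt_minimalPeriod hi hj).1 h')
    intro b
    obtain ⟨i, hi⟩ := (Finite.injective_iff_surjective.1 hinj) b
    exact ⟨(i : ℕ), by simpa using hi⟩
  have h1 : numCycles τ ≤ 1 := by
    refine Finset.card_le_one.2 fun x hx y hy => ?_
    have hxy : τ.SameCycle x y := (hall x).symm.trans (hall y)
    exact le_antisymm ((Finset.mem_filter.1 hx).2 y hxy) ((Finset.mem_filter.1 hy).2 x hxy.symm)
  have h2 : n ≤ numCycles (τ⁻¹ * finRotate n) := by
    have := (Finset.mem_filter.1 hτ).2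
    omega
  have h3 : leaders (τ⁻¹ * finRotate n) = Finset.univ :=
    Finset.eq_univ_of_card _
      (le_antisymm (Finset.card_le_univ _) (by simpa [numCycles] using h2))
  have h4 : ∀ x, x ∈ leaders (τ⁻¹ * finRotate n) := fun x => h3 ▸ Finset.mem_univ x
  ext x : 1
  have hs : (τ⁻¹ * finRotate n).SameCycle x ((τ⁻¹ * finRotate n) x) := ⟨1, by simp⟩
  have hx : x = τ⁻¹ (finRotate n x) :=
    le_antisymm ((Finset.mem_filter.1 (h4 x)).2 _ hs) ((Finset.mem_filter.1 (h4 _)).2 _ hs.symm)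
  exact (Equiv.Perm.eq_inv_iff_eq.1 hx)

/-! ### Non-commutative probability -/

section NonCommutative

variable {𝒜 : Type*} [Ring 𝒜] [StarRing 𝒜] [Algebra ℂ 𝒜] [StarModule ℂ 𝒜]

/-- `φ` is a unital tracial positive linear functional on the `*`-algebra `𝒜`. -/
structure IsTracialState (φ : 𝒜 →ₗ[ℂ] ℂ) : Prop where
  map_one : φ 1 = 1
  tracial : ∀ a b, φ (a * b) = φ (b * a)
  positive : ∀ a, ∃ t : ℝ, 0 ≤ t ∧ φ (star a * a) = t

/-- Freeness of a family of unital subalgebras. -/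
def IsFreeFamily (φ : 𝒜 →ₗ[ℂ] ℂ) {J : Type*} (B : J → Subalgebra ℂ 𝒜) : Prop :=
  ∀ (n : ℕ) (j : Fin (n + 1) → J) (A : Fin (n + 1) → 𝒜),
    (∀ i : Fin n, j i.castSucc ≠ j i.succ) → (∀ i, A i ∈ B (j i)) → (∀ i, φ (A i) = 0) →
      φ (List.ofFn A).prod = 0

/-- `*`-freeness of a family of elements: the unital `*`-subalgebras generated by the single
elements are free. -/
def IsStarFree (φ : 𝒜 →ₗ[ℂ] ℂ) {J : Type*} (x : J → 𝒜) : Prop :=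
  IsFreeFamily φ fun j => (StarAlgebra.adjoin ℂ {x j}).toSubalgebra

/-- The non-crossing cumulants `k_n(A_1, …, A_n)`, defined recursively by
`φ(A_1 ⋯ A_n) = ∑_{τ ∈ NC_n} ∏_{C ∈ τ} k_{|C|}(A_C)`, where a cycle
`C = (a, τ a, τ² a, …)` is written starting from its least element `a`; the term of the long
cycle is `k_n(A_1, …, A_n)` itself. -/
noncomputable def cumulant (φ : 𝒜 →ₗ[ℂ] ℂ) (n : ℕ) (A : Fin n → 𝒜) : ℂ :=
  φ (List.ofFn A).prod -
    ∑ τ : {τ : Equiv.Perm (Fin n) // τ ∈ NC n ∧ τ ≠ finRotate n},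
      ∏ a ∈ leaders τ.1, cumulant φ (cycleLength τ.1 a) fun i => A ((τ.1 ^ (i : ℕ)) a)
termination_by n
decreasing_by exact cycleLength_lt τ.2.1 τ.2.2 a

/-- A Haar unitary; for a unitary the negative powers are the powers of the adjoint. -/
def IsHaarUnitary (φ : 𝒜 →ₗ[ℂ] ℂ) (u : 𝒜) : Prop :=
  star u * u = 1 ∧ u * star u = 1 ∧
    ∀ n : ℕ, n ≠ 0 → φ (u ^ n) = 0 ∧ φ (star u ^ n) = 0

/-- A standard circular element: among all cumulants
`k_n(g^{ε_1}, …, g^{ε_n})`, `n ≥ 1`, `ε_i ∈ {1, *}`, the only non-zero ones are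
`k_2(g, g*) = k_2(g*, g) = 1`. -/
def IsStandardCircular (φ : 𝒜 →ₗ[ℂ] ℂ) (g : 𝒜) : Prop :=
  ∀ (n : ℕ) (ε : Fin n → Bool), 1 ≤ n →
    cumulant φ n (fun i => if ε i then star g else g) =
      if n = 2 ∧ ∃ i j, ε i ≠ ε j then 1 else 0

/-- A free Poisson element of parameter `c`. -/
def IsFreePoisson (φ : 𝒜 →ₗ[ℂ] ℂ) (c : ℝ) (w : 𝒜) : Prop :=
  star w = w ∧ ∀ n : ℕ, 1 ≤ n → cumulant φ n (fun _ => w) = c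

end NonCommutative

/-! ### Monomials -/

/-- The value of the monomial `α` in the variables `x i` and their adjoints; the letter
`(i, false)` stands for `x i` and `(i, true)` for its adjoint. -/
def evalMonomial {I B : Type*} [Monoid B] [Star B] (x : I → B) (α : List (I × Bool)) : B :=
  (α.map fun p => if p.2 then star (x p.1) else x p.1).prod

/-! ### Random matrices -/

section RandomMatrices

noncomputable instance instMeasurableSpaceMatrix {m n : Type*} : MeasurableSpace (Matrix m n ℂ) :=
  inferInstanceAs (MeasurableSpace (m → n → ℂ))

variable {Ω : Type*} [MeasurableSpace Ω]

/-- An independent family of complex standard Gaussian random variables: the real and imaginary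
parts of all members together form an independent family of real Gaussian variables of mean `0`
and variance `1/2`. -/
structure IsComplexGaussianFamily (P : Measure Ω) {Λ : Type*} (f : Λ → Ω → ℂ) : Prop where
  measurable : ∀ l, Measurable (f l)
  law_re : ∀ l, P.map (fun ω => (f l ω).re) = gaussianReal 0 (1 / 2)
  law_im : ∀ l, P.map (fun ω => (f l ω).im) = gaussianReal 0 (1 / 2)
  indep : iIndepFun
    (Sum.elim (fun l ω => (f l ω).re) (fun l ω => (f l ω).im) : Λ ⊕ Λ → Ω → ℝ) P

/-- The normalized trace. -/
noncomputable def ntr {N : ℕ} (A : Matrix (Fin N) (Fin N) ℂ) : ℂ := (1 / (N : ℂ)) * A.trace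

/-- The matrix of a permutation: the `(i, j)` entry is `1` if `σ j = i` and `0` otherwise. -/
def permMat {N : ℕ} (σ : Equiv.Perm (Fin N)) : Matrix (Fin N) (Fin N) ℂ :=
  Matrix.of fun i j => if σ j = i then 1 else 0

/-- `U` is a uniformly distributed random `N × N` permutation matrix. -/
structure IsUniformPermMatrix (P : Measure Ω) {N : ℕ} (U : Ω → Matrix (Fin N) (Fin N) ℂ) :
    Prop where
  measurable : Measurable U
  isPerm : ∀ ω, ∃ σ : Equiv.Perm (Fin N), U ω = permMat σ
  uniform : ∀ σ : Equiv.Perm (Fin N), P.real (U ⁻¹' {permMat σ}) = 1 / (N.factorial : ℝ)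

variable {s : ℕ}

/-- The random `M × N` matrix `[f_{r;i,j}]`. -/
def gaussRect (f : Fin s × ℕ × ℕ → Ω → ℂ) (M N : ℕ) (r : Fin s) (ω : Ω) :
    Matrix (Fin M) (Fin N) ℂ :=
  Matrix.of fun i j => f (r, i, j) ω

/-- The square complex Gaussian matrix `G_r^{(N)} = N^{-1/2} [f_{r;i,j}]`. -/
noncomputable def gaussSquare (f : Fin s × ℕ × ℕ → Ω → ℂ) (N : ℕ) (r : Fin s) (ω : Ω) :
    Matrix (Fin N) (Fin N) ℂ :=
  (1 / (Real.sqrt N : ℂ)) • gaussRect f N N r ω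

/-- The complex Wishart matrix `W_r^{(M,N)} = N^{-1} [f_{r;i,j}]^* [f_{r;i,j}]`. -/
noncomputable def wishart (f : Fin s × ℕ × ℕ → Ω → ℂ) (M N : ℕ) (r : Fin s) (ω : Ω) :
    Matrix (Fin N) (Fin N) ℂ :=
  (1 / (N : ℂ)) • ((gaussRect f M N r ω).conjTranspose * gaussRect f M N r ω)

/-- Almost sure convergence in `*`-distribution of the families `X^{(M,N)}` of random matrices to
the family `x` in `(𝒜, φ)` as `M, N → ∞` with `M / N → c`. The sequences are non-decreasing
and unbounded, which includes the strictly increasing ones. -/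
def ConvergesStarDistrAS {𝒜 : Type*} [Ring 𝒜] [StarRing 𝒜] [Algebra ℂ 𝒜] (P : Measure Ω)
    (c : ℝ) (φ : 𝒜 →ₗ[ℂ] ℂ) {I : Type*}
    (X : (M N : ℕ) → I → Ω → Matrix (Fin N) (Fin N) ℂ) (x : I → 𝒜) : Prop :=
  ∀ (α : List (I × Bool)) (M N : ℕ → ℕ), Monotone M → Monotone N →
    Tendsto M atTop atTop → Tendsto N atTop atTop →
    Tendsto (fun q => (M q : ℝ) / (N q : ℝ)) atTop (𝓝 c) →
      ∀ᵐ ω ∂P, Tendsto (fun q => ntr (evalMonomial (fun i => X (M q) (N q) i ω) α)) atTop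
        (𝓝 (φ (evalMonomial x α)))

end RandomMatrices

end RandPerm

namespace RandPerm

/-! ### Cycle counts as dimensions of spaces of invariant functions -/

/-! The proof compares the mean of a product of normalized traces with the limit state through loop
(Schwinger–Dyson) equations, and obtains almost sure convergence from a variance bound of order
`N⁻²`.

Random matrices. Freeze the permutations, so that a product of traces is a polynomial in independent
Gaussians. Integrating by parts one entry of a Gaussian letter removes that letter
(`schwingerDyson_trProd`). When the derivative hits the same word, the trace splits into two. When
it hits another trace, the two merge at the cost of a factor `N⁻²`. In the Wishart case it also hits
the other half of the letter itself, which yields the coefficient `M/N`. These equations are linear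
with coefficients independent of the permutations, so they survive averaging over them.

Limit. For one circular or free Poisson element the moments are sums over non-crossing permutations.
Sorting these by the image of the first point (`sum_geodesic_finRotate_succ`) gives the equation
without the `N⁻²` term. It extends to words in the whole free family (`schwingerDyson_of_free`):
both sides are linear, words are spanned by centered alternating products, and on these nearly every
term vanishes by freeness.

Words in permutations only. The trace counts fixed points. A word trivial in the free group gives
exactly 1, in agreement with Haar unitaries (`map_haar_word`). For a non-trivial word the number of
fixed points has bounded second moment (`exists_sum_fixCount_sq_le`): after cyclic reduction, a
closed path with `v` vertices uses at least `v` distinct labelled edges, each costing about `1/N`,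
while there are about `N^v` choices of vertices.

Conclusion. Induction on the number of Gaussian letters (`TraceSystem.tendsto`,
`TraceSystem.isBigO`) shows that means of products of traces converge to products of limits and
factorize up to `O(N⁻²)`. Factorization for `α` and its adjoint bounds the variance of the trace of
`α` by a multiple of `N⁻²`. Along monotone sequences the pair `(M, N)` is determined by `M + N`, so
the variances of distinct terms are summable even if indices repeat. -/

/-- The space of functions that are invariant under the permutation `τ`. -/
def invariants {α : Type*} (τ : Equiv.Perm α) : Submodule ℚ (α → ℚ) where
  carrier := {f | ∀ a, f (τ a) = f a}
  add_mem' hf hg a := by simp [hf a, hg a]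
  zero_mem' _ := rfl
  smul_mem' c f hf a := by simp [hf a]

theorem mem_invariants {α : Type*} {τ : Equiv.Perm α} {f : α → ℚ} :
    f ∈ invariants τ ↔ ∀ a, f (τ a) = f a := Iff.rfl

/-- The number of cycles of a permutation of a finite type. -/
noncomputable def cyc {α : Type*} (τ : Equiv.Perm α) : ℕ := Module.finrank ℚ (invariants τ)

theorem invariants_sameCycle {α : Type*} {τ : Equiv.Perm α} {f : α → ℚ}
    (hf : f ∈ invariants τ) {a b : α} (h : τ.SameCycle a b) : f a = f b := by
  obtain ⟨i, rfl⟩ := h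
  induction i using Int.induction_on with
  | zero => simp
  | succ i ih => rw [ih, add_comm, zpow_add, zpow_one, Equiv.Perm.mul_apply, hf]
  | pred i ih =>
    rw [ih, ← hf ((τ ^ (-(i : ℤ) - 1)) a), ← Equiv.Perm.mul_apply, ← zpow_one_add]
    congr 3
    ring

theorem exists_leader {n : ℕ} (τ : Equiv.Perm (Fin n)) (b : Fin n) :
    ∃ a ∈ leaders τ, τ.SameCycle a b := by
  classical
  have hne : (Finset.univ.filter fun a => τ.SameCycle a b).Nonempty :=
    ⟨b, by simpa using Equiv.Perm.SameCycle.refl τ b⟩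
  obtain ⟨a, ha, hmin⟩ := Finset.exists_min_image _ id hne
  simp only [Finset.mem_filter, Finset.mem_univ, true_and, id] at ha hmin
  refine ⟨a, ?_, ha⟩
  simp only [leaders, Finset.mem_filter, Finset.mem_univ, true_and]
  exact fun x hx => hmin x (hx.symm.trans ha)

/-- An invariant function is constant on cycles, so restriction to the leaders is a linear
isomorphism. Counting cycles as a dimension makes the genus inequality below an instance of the
dimension formula for subspaces. -/
theorem numCycles_eq_cyc {n : ℕ} (τ : Equiv.Perm (Fin n)) : numCycles τ = cyc τ := by
  choose ld hld hsame using exists_leader τ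
  have huniq : ∀ a b, a ∈ leaders τ → b ∈ leaders τ → τ.SameCycle a b → a = b := by
    intro a b ha hb hab
    exact le_antisymm ((Finset.mem_filter.1 ha).2 b hab) ((Finset.mem_filter.1 hb).2 a hab.symm)
  let e : invariants τ →ₗ[ℚ] (leaders τ → ℚ) :=
    { toFun := fun f a => f.1 a
      map_add' := fun _ _ => rfl
      map_smul' := fun _ _ => rfl }
  have he : Function.Bijective e := by
    constructor
    · intro f g hfg
      ext b
      have h := congrFun hfg ⟨ld b, hld b⟩
      rw [← invariants_sameCycle f.2 (hsame b), ← invariants_sameCycle g.2 (hsame b)]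
      exact h
    · intro g
      refine ⟨⟨fun b => g ⟨ld b, hld b⟩, fun b => ?_⟩, ?_⟩
      · have : ld (τ b) = ld b := huniq _ _ (hld _) (hld _)
          ((hsame (τ b)).trans (Equiv.Perm.SameCycle.symm
            ((hsame b).trans ⟨1, by simp⟩)))
        simp [this]
      · funext a
        have : ld a = a := huniq _ _ (hld _) a.2 (hsame a)
        simp [e, this]
  rw [cyc, (LinearEquiv.ofBijective e he).finrank_eq, Module.finrank_fintype_fun_eq_card]
  simp [numCycles]

theorem cyc_congr {α β : Type*} (e : α ≃ β) {τ : Equiv.Perm α} {τ' : Equiv.Perm β}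
    (h : ∀ a, e (τ a) = τ' (e a)) : cyc τ = cyc τ' := by
  refine LinearEquiv.finrank_eq
    { toFun := fun f => ⟨fun b => f.1 (e.symm b), fun b => ?_⟩
      invFun := fun f => ⟨fun a => f.1 (e a), fun a => ?_⟩
      map_add' := fun _ _ => rfl
      map_smul' := fun _ _ => rfl
      left_inv := fun f => by ext a; simp
      right_inv := fun f => by ext a; simp }
  · have := f.2 (e.symm b)
    simp only
    rw [← this]
    refine congrArg f.1 ?_
    rw [Equiv.symm_apply_eq, h, Equiv.apply_symm_apply]
  · simp only [h]
    exact f.2 _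

theorem cyc_sumCongr {α β : Type*} [Finite α] [Finite β] (σ : Equiv.Perm α) (τ : Equiv.Perm β) :
    cyc (Equiv.Perm.sumCongr σ τ) = cyc σ + cyc τ := by
  rw [cyc, cyc, cyc, ← Module.finrank_prod]
  refine LinearEquiv.finrank_eq
    { toFun := fun f => (⟨fun a => f.1 (.inl a), fun a => f.2 (.inl a)⟩,
        ⟨fun a => f.1 (.inr a), fun a => f.2 (.inr a)⟩)
      invFun := fun f => ⟨Sum.elim f.1.1 f.2.1, ?_⟩
      map_add' := fun _ _ => rfl
      map_smul' := fun _ _ => rfl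
      left_inv := fun f => by ext (a | a) <;> simp
      right_inv := fun f => by ext a <;> simp }
  rintro (a | a)
  · simpa using f.1.2 a
  · simpa using f.2.2 a

/-- A permutation of `Fin (n + 1)` which maps `0` to `p`, and induces `σ` on the other points when
`0` is dropped from its cycle. -/
abbrev insertZero {n : ℕ} (p : Fin (n + 1)) (σ : Equiv.Perm (Fin n)) : Equiv.Perm (Fin (n + 1)) :=
  Equiv.Perm.decomposeFin.symm (p, σ)

theorem cyc_insertZero_zero {n : ℕ} (σ : Equiv.Perm (Fin n)) :
    cyc (insertZero 0 σ) = cyc σ + 1 := by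
  have h1 : Module.finrank ℚ (invariants σ × ℚ) = cyc σ + 1 := by
    rw [Module.finrank_prod, Module.finrank_self, cyc]
  rw [← h1]
  refine LinearEquiv.finrank_eq
    { toFun := fun f => (⟨fun a => f.1 a.succ, fun a => ?_⟩, f.1 0)
      invFun := fun f => ⟨Fin.cons f.2 f.1.1, ?_⟩
      map_add' := fun _ _ => rfl
      map_smul' := fun _ _ => rfl
      left_inv := fun f => by
        ext a
        refine Fin.cases ?_ (fun a => ?_) a <;> simp
      right_inv := fun f => by ext a <;> simp }
  · simpa using f.2 a.succ
  · intro a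
    refine Fin.cases ?_ (fun a => ?_) a
    · simp
    · simpa using f.1.2 a

/-- Here `0` joins the cycle of `j.succ`, so the value of an invariant function at `0` is forced and
the dimension does not change. -/
theorem cyc_insertZero_succ {n : ℕ} (j : Fin n) (σ : Equiv.Perm (Fin n)) :
    cyc (insertZero j.succ σ) = cyc σ := by
  refine LinearEquiv.finrank_eq
    { toFun := fun f => ⟨fun a => f.1 a.succ, fun a => ?_⟩
      invFun := fun f => ⟨Fin.cons (f.1 j) f.1, ?_⟩
      map_add' := fun _ _ => rfl
      map_smul' := fun _ _ => rfl
      left_inv := fun f => by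
        ext a
        refine Fin.cases ?_ (fun a => ?_) a
        · simpa using f.2 0
        · simp
      right_inv := fun f => by ext a; simp }
  · have h0 : f.1 j.succ = f.1 0 := by simpa using f.2 0
    have h := f.2 a.succ
    rw [Equiv.Perm.decomposeFin_symm_apply_succ] at h
    by_cases ha : σ a = j
    · rw [ha, Equiv.swap_apply_right] at h
      simp only
      rw [ha, h0, h]
    · rwa [Equiv.swap_apply_of_ne_of_ne (Fin.succ_ne_zero _)
        (fun hh => ha (Fin.succ_injective _ hh))] at h
  · intro a
    refine Fin.cases ?_ (fun a => ?_) a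
    · simp
    · rw [Equiv.Perm.decomposeFin_symm_apply_succ]
      by_cases ha : σ a = j
      · rw [ha, Equiv.swap_apply_right]
        simpa [ha] using f.2 a
      · rw [Equiv.swap_apply_of_ne_of_ne (Fin.succ_ne_zero _)
          (fun hh => ha (Fin.succ_injective _ hh))]
        simpa using f.2 a

theorem invariants_inf_le {α : Type*} (τ δ : Equiv.Perm α) :
    invariants τ ⊓ invariants (τ⁻¹ * δ) ≤ invariants δ := by
  rintro f ⟨h1, h2⟩ a
  rw [← h2 a, ← h1 ((τ⁻¹ * δ) a)]
  simp

/-- The genus inequality: the sum of the two invariant spaces has dimension at most `card α`, and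
their intersection lies in the invariants of `δ`. -/
theorem cyc_add_cyc_le {α : Type*} [Fintype α] (τ δ : Equiv.Perm α) :
    cyc τ + cyc (τ⁻¹ * δ) ≤ Fintype.card α + cyc δ := by
  have h1 := Submodule.finrank_sup_add_finrank_inf_eq (invariants τ) (invariants (τ⁻¹ * δ))
  have h2 : Module.finrank ℚ ↥(invariants τ ⊔ invariants (τ⁻¹ * δ)) ≤ Fintype.card α := by
    simpa using Submodule.finrank_le (invariants τ ⊔ invariants (τ⁻¹ * δ))
  have h3 := Submodule.finrank_mono (invariants_inf_le τ δ)
  unfold cyc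
  omega

/-- In the equality case the intersection is all of `invariants δ`. Hence each cycle of `τ` is
contained in a cycle of `δ`. -/
theorem invariants_le_of_card_le {α : Type*} [Fintype α] {τ δ : Equiv.Perm α}
    (h : Fintype.card α + cyc δ ≤ cyc τ + cyc (τ⁻¹ * δ)) : invariants δ ≤ invariants τ := by
  have h1 := Submodule.finrank_sup_add_finrank_inf_eq (invariants τ) (invariants (τ⁻¹ * δ))
  have h2 : Module.finrank ℚ ↥(invariants τ ⊔ invariants (τ⁻¹ * δ)) ≤ Fintype.card α := by
    simpa using Submodule.finrank_le (invariants τ ⊔ invariants (τ⁻¹ * δ))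
  unfold cyc at h
  have h4 := Submodule.eq_of_le_of_finrank_le (invariants_inf_le τ δ) (by omega)
  rw [← h4]
  exact inf_le_left

/-! ### Decomposition of non-crossing permutations -/

theorem cyc_fin_zero (τ : Equiv.Perm (Fin 0)) : cyc τ = 0 :=
  Module.finrank_zero_of_subsingleton

theorem cyc_finRotate_succ (n : ℕ) : cyc (finRotate (n + 1)) = 1 := by
  induction n with
  | zero =>
    have : finRotate (0 + 1) = insertZero 0 (1 : Equiv.Perm (Fin 0)) := by
      ext a
      omega
    rw [this, cyc_insertZero_zero, cyc_fin_zero]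
  | succ n ih =>
    rw [finRotate_succ_eq_decomposeFin]
    exact (cyc_insertZero_succ 0 _).trans ih

/-- The permutations of `α` on a geodesic from the identity to `δ`. -/
noncomputable def geodesic {α : Type*} [Fintype α] [DecidableEq α] (δ : Equiv.Perm α) :
    Finset (Equiv.Perm α) :=
  Finset.univ.filter fun τ => cyc τ + cyc (τ⁻¹ * δ) = Fintype.card α + cyc δ

theorem mem_geodesic {α : Type*} [Fintype α] [DecidableEq α] {δ τ : Equiv.Perm α} :
    τ ∈ geodesic δ ↔ cyc τ + cyc (τ⁻¹ * δ) = Fintype.card α + cyc δ := by simp [geodesic]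

/-- The two notions agree only for positive size: `NC 0` is empty, whereas `geodesic (finRotate 0)`
is `{1}`, because `finRotate 0` has no cycle. The latter gives the recursions below the right
initial value. -/
theorem geodesic_finRotate (n : ℕ) : geodesic (finRotate (n + 1)) = NC (n + 1) := by
  ext τ
  simp [mem_geodesic, NC, numCycles_eq_cyc, cyc_finRotate_succ]

theorem insertZero_zero_mul {n : ℕ} (σ δ : Equiv.Perm (Fin n)) (p : Fin (n + 1)) :
    insertZero 0 σ * insertZero p δ = insertZero (insertZero 0 σ p) (σ * δ) := by
  ext a : 1
  refine Fin.cases ?_ (fun a => ?_) a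
  · simp
  · have hinj : Function.Injective (insertZero 0 σ) := (insertZero 0 σ).injective
    have := hinj.map_swap (x := 0) (y := p) (z := (δ a).succ)
    simp [this]

theorem insertZero_eq_swap_mul {n : ℕ} (p : Fin (n + 1)) (σ : Equiv.Perm (Fin n)) :
    insertZero p σ = Equiv.swap 0 p * insertZero 0 σ := by
  ext a : 1
  refine Fin.cases ?_ (fun a => ?_) a <;> simp

theorem insertZero_inv {n : ℕ} (σ : Equiv.Perm (Fin n)) :
    (insertZero 0 σ)⁻¹ = insertZero 0 σ⁻¹ := by
  rw [inv_eq_iff_mul_eq_one, insertZero_zero_mul]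
  simp [Equiv.Perm.one_def]

theorem cyc_insertZero {n : ℕ} (p : Fin (n + 1)) (σ : Equiv.Perm (Fin n)) :
    cyc (insertZero p σ) = cyc σ + if p = 0 then 1 else 0 := by
  refine Fin.cases ?_ (fun j => ?_) p
  · simp [cyc_insertZero_zero]
  · simp [cyc_insertZero_succ]

theorem insertZero_apply_eq_zero {n : ℕ} (σ : Equiv.Perm (Fin n)) (p : Fin (n + 1)) :
    insertZero 0 σ p = 0 ↔ p = 0 := by
  refine Fin.cases ?_ (fun j => ?_) p <;> simp

/-- Dropping `0` from the cycles turns a geodesic condition on `Fin (n + 1)` into one on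
`Fin n`. -/
theorem cyc_insertZero_add_cyc {n : ℕ} (k p : Fin (n + 1)) (σ δ : Equiv.Perm (Fin n))
    (ε : Equiv.Perm (Fin (n + 1))) (hε : Equiv.swap 0 k * ε = insertZero p δ) :
    cyc (insertZero k σ) + cyc ((insertZero k σ)⁻¹ * ε) =
      cyc σ + cyc (σ⁻¹ * δ) + (if k = 0 then 1 else 0) + (if p = 0 then 1 else 0) := by
  -- The transposition inside `insertZero k σ` is moved onto `ε`, so both factors become insertions
  -- of `0`.
  rw [insertZero_eq_swap_mul k σ, mul_inv_rev, Equiv.swap_inv, mul_assoc, hε, insertZero_inv,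
    insertZero_zero_mul, ← insertZero_eq_swap_mul, cyc_insertZero, cyc_insertZero]
  simp only [insertZero_apply_eq_zero]
  omega

/-- The permutation of `Fin (j + m)` which acts as `σ` on the first `j` points and as `τ` on the
last `m` points. -/
def joinPerm {j m : ℕ} (σ : Equiv.Perm (Fin j)) (τ : Equiv.Perm (Fin m)) :
    Equiv.Perm (Fin (j + m)) :=
  finSumFinEquiv.permCongr (Equiv.Perm.sumCongr σ τ)

@[simp] theorem joinPerm_castAdd {j m : ℕ} (σ : Equiv.Perm (Fin j)) (τ : Equiv.Perm (Fin m))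
    (i : Fin j) : joinPerm σ τ (Fin.castAdd m i) = Fin.castAdd m (σ i) := by
  simp [joinPerm, Equiv.permCongr_apply]

@[simp] theorem joinPerm_natAdd {j m : ℕ} (σ : Equiv.Perm (Fin j)) (τ : Equiv.Perm (Fin m))
    (i : Fin m) : joinPerm σ τ (Fin.natAdd j i) = Fin.natAdd j (τ i) := by
  simp [joinPerm, Equiv.permCongr_apply]

theorem joinPerm_mul {j m : ℕ} (σ σ' : Equiv.Perm (Fin j)) (τ τ' : Equiv.Perm (Fin m)) :
    joinPerm σ τ * joinPerm σ' τ' = joinPerm (σ * σ') (τ * τ') := by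
  ext x : 1
  refine Fin.addCases (fun i => ?_) (fun i => ?_) x <;> simp

theorem joinPerm_inv {j m : ℕ} (σ : Equiv.Perm (Fin j)) (τ : Equiv.Perm (Fin m)) :
    (joinPerm σ τ)⁻¹ = joinPerm σ⁻¹ τ⁻¹ := by
  rw [inv_eq_iff_mul_eq_one, joinPerm_mul]
  ext x : 1
  refine Fin.addCases (fun i => ?_) (fun i => ?_) x <;> simp

theorem cyc_joinPerm {j m : ℕ} (σ : Equiv.Perm (Fin j)) (τ : Equiv.Perm (Fin m)) :
    cyc (joinPerm σ τ) = cyc σ + cyc τ := by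
  rw [← cyc_sumCongr]
  exact (cyc_congr finSumFinEquiv (by simp [joinPerm, Equiv.permCongr_apply])).symm

theorem joinPerm_injective {j m : ℕ} :
    Function.Injective fun x : Equiv.Perm (Fin j) × Equiv.Perm (Fin m) => joinPerm x.1 x.2 := by
  rintro ⟨σ, τ⟩ ⟨σ', τ'⟩ h
  simp only at h
  refine Prod.ext (Equiv.ext fun i => ?_) (Equiv.ext fun i => ?_)
  · simpa using DFunLike.congr_fun h (Fin.castAdd m i)
  · simpa using DFunLike.congr_fun h (Fin.natAdd j i)

/-- The geodesic defect is additive over the two blocks and each summand is nonnegative by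
`cyc_add_cyc_le`, so it vanishes only if both do. -/
theorem joinPerm_mem_geodesic {j m : ℕ} {σ γ : Equiv.Perm (Fin j)} {τ δ : Equiv.Perm (Fin m)} :
    joinPerm σ τ ∈ geodesic (joinPerm γ δ) ↔ σ ∈ geodesic γ ∧ τ ∈ geodesic δ := by
  have h1 := cyc_add_cyc_le σ γ
  have h2 := cyc_add_cyc_le τ δ
  simp only [mem_geodesic, joinPerm_inv, joinPerm_mul, cyc_joinPerm, Fintype.card_fin] at *
  omega

theorem exists_joinPerm {j m : ℕ} {γ : Equiv.Perm (Fin j)} {δ : Equiv.Perm (Fin m)}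
    {σ : Equiv.Perm (Fin (j + m))} (h : σ ∈ geodesic (joinPerm γ δ)) :
    ∃ σ₁ σ₂, σ = joinPerm σ₁ σ₂ := by
  -- The indicator of the first block is invariant under `joinPerm γ δ`, hence under `σ`, which
  -- therefore preserves the block.
  let f : Fin (j + m) → ℚ := Fin.addCases (fun _ => 1) (fun _ => 0)
  have hf : f ∈ invariants (joinPerm γ δ) := by
    intro x
    refine Fin.addCases (fun i => ?_) (fun i => ?_) x <;> simp [f]
  have hf' : f ∈ invariants σ := invariants_le_of_card_le (mem_geodesic.1 h).ge hf
  have hmaps : Set.MapsTo (finSumFinEquiv.symm.permCongr σ)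
      (Set.range (Sum.inl : Fin j → Fin j ⊕ Fin m)) (Set.range Sum.inl) := by
    rintro _ ⟨i, rfl⟩
    have h1 : f (σ (Fin.castAdd m i)) = 1 := by rw [hf' _]; simp [f]
    simp only [Equiv.permCongr_apply, Equiv.symm_symm, finSumFinEquiv_apply_left]
    generalize σ (Fin.castAdd m i) = y at h1
    revert h1
    refine Fin.addCases (fun i => ?_) (fun i => ?_) y
    · intro _
      exact ⟨i, by simp⟩
    · simp [f]
  obtain ⟨⟨σ₁, σ₂⟩, h12⟩ := Equiv.Perm.mem_sumCongrHom_range_of_perm_mapsTo_inl hmaps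
  refine ⟨σ₁, σ₂, ?_⟩
  have h3 : Equiv.Perm.sumCongr σ₁ σ₂ = finSumFinEquiv.symm.permCongr σ := h12
  rw [joinPerm, h3]
  ext x : 1
  simp [Equiv.permCongr_apply]

theorem sum_geodesic_joinPerm {R : Type*} [AddCommMonoid R] {j m : ℕ} (γ : Equiv.Perm (Fin j))
    (δ : Equiv.Perm (Fin m)) (h : Equiv.Perm (Fin (j + m)) → R) :
    ∑ σ ∈ geodesic (joinPerm γ δ), h σ =
      ∑ x ∈ geodesic γ ×ˢ geodesic δ, h (joinPerm x.1 x.2) := by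
  symm
  refine Finset.sum_bij (fun x _ => joinPerm x.1 x.2) ?_ ?_ ?_ ?_
  · rintro ⟨σ, τ⟩ hx
    exact joinPerm_mem_geodesic.2 (Finset.mem_product.1 hx)
  · intro a _ b _ hab
    exact joinPerm_injective hab
  · intro σ hσ
    obtain ⟨σ₁, σ₂, rfl⟩ := exists_joinPerm hσ
    exact ⟨(σ₁, σ₂), Finset.mem_product.2 (joinPerm_mem_geodesic.1 hσ), rfl⟩
  · intros; rfl

theorem val_swap_apply {n : ℕ} (a b x : Fin n) : (Equiv.swap a b x : ℕ) =
    (if (x : ℕ) = a then (b : ℕ) else if (x : ℕ) = b then (a : ℕ) else (x : ℕ) : ℕ) := by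
  rw [Equiv.swap_apply_def]
  simp only [Fin.ext_iff]
  split_ifs <;> rfl

theorem val_finRotate_apply {n : ℕ} (x : Fin (n + 1)) : (finRotate (n + 1) x : ℕ) =
    (if (x : ℕ) = n then 0 else (x : ℕ) + 1 : ℕ) := by
  rw [coe_finRotate]
  simp [Fin.ext_iff]

/-- Multiplication by a transposition of two points of the long cycle cuts it into `(0, …, j)` and
`(j+1, …, n)`. After dropping `0`, the first piece is the rotation of `j` points; for `j = 0` the
point `0` is left fixed, which explains the case distinction. -/
theorem swap_mul_finRotate (j m : ℕ) :
    Equiv.swap 0 (Fin.natAdd j (0 : Fin (m + 1))).succ * finRotate (j + (m + 1) + 1) =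
      insertZero (if j = 0 then 0 else 1) (joinPerm (finRotate j) (finRotate (m + 1))) := by
  have hp : ((if j = 0 then 0 else 1 : Fin (j + (m + 1) + 1)) : ℕ) = (if j = 0 then 0 else 1 : ℕ) := by
    split_ifs
    · rfl
    · simp
  ext x
  refine Fin.cases ?_ (fun x => ?_) x
  · rw [Equiv.Perm.decomposeFin_symm_apply_zero, Equiv.Perm.mul_apply, val_swap_apply,
      val_finRotate_apply, hp]
    simp only [Fin.val_zero, Fin.val_succ, Fin.val_natAdd]
    split_ifs <;> first | contradiction | omega
  · rw [Equiv.Perm.decomposeFin_symm_apply_succ, Equiv.Perm.mul_apply, val_swap_apply,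
      val_finRotate_apply, val_swap_apply, hp]
    refine Fin.addCases (fun i => ?_) (fun i => ?_) x
    · obtain ⟨j, rfl⟩ : ∃ j', j = j' + 1 := ⟨j - 1, by have := i.2; omega⟩
      have hi := i.2
      simp only [joinPerm_castAdd, Fin.val_zero, Fin.val_succ, Fin.val_natAdd, Fin.val_castAdd,
        val_finRotate_apply]
      split_ifs <;> first | contradiction | omega
    · have hi := i.2
      simp only [joinPerm_natAdd, Fin.val_zero, Fin.val_succ, Fin.val_natAdd, val_finRotate_apply]
      split_ifs <;> first | contradiction | omega

theorem insertZero_zero_mem_geodesic {n : ℕ} {σ : Equiv.Perm (Fin n)} :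
    insertZero 0 σ ∈ geodesic (finRotate (n + 1)) ↔ σ ∈ geodesic (finRotate n) := by
  have h := cyc_insertZero_add_cyc 0 1 σ (finRotate n) (finRotate (n + 1))
    (by rw [Equiv.swap_self, finRotate_succ_eq_decomposeFin]; rfl)
  rw [mem_geodesic, mem_geodesic, h, cyc_finRotate_succ, Fintype.card_fin, Fintype.card_fin]
  -- For `n = 0` the element `1 : Fin 1` equals `0`, and the missing cycle of `finRotate 0`
  -- compensates for it.
  rcases n with _ | n
  · simp [cyc_fin_zero]
  · rw [cyc_finRotate_succ]
    simp

theorem insertZero_succ_mem_geodesic {j m : ℕ} {σ : Equiv.Perm (Fin (j + (m + 1)))} :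
    insertZero (Fin.natAdd j (0 : Fin (m + 1))).succ σ ∈ geodesic (finRotate (j + (m + 1) + 1)) ↔
      σ ∈ geodesic (joinPerm (finRotate j) (finRotate (m + 1))) := by
  have h := cyc_insertZero_add_cyc _ _ σ _ _ (swap_mul_finRotate j m)
  rw [mem_geodesic, mem_geodesic, h, cyc_finRotate_succ, Fintype.card_fin, Fintype.card_fin,
    cyc_joinPerm, cyc_finRotate_succ]
  rcases j with _ | j
  · simp [cyc_fin_zero]
  · rw [cyc_finRotate_succ]
    simp [Fin.ext_iff]

/-- Sum over non-crossing permutations: either `0` is a fixed point, or it is mapped to some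
`j + 1`, and the points `1, …, j` are separated from the points `j + 1, …, n`. -/
theorem sum_geodesic_finRotate_succ {R : Type*} [AddCommMonoid R] {n : ℕ}
    (h : Equiv.Perm (Fin (n + 1)) → R) :
    ∑ τ ∈ geodesic (finRotate (n + 1)), h τ = ∑ σ ∈ geodesic (finRotate n), h (insertZero 0 σ) +
      ∑ j : Fin n, ∑ σ : Equiv.Perm (Fin n),
        if insertZero j.succ σ ∈ geodesic (finRotate (n + 1)) then h (insertZero j.succ σ)
          else 0 := by
  have h1 : ∑ τ ∈ geodesic (finRotate (n + 1)), h τ = ∑ x : Fin (n + 1) × Equiv.Perm (Fin n),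
      if insertZero x.1 x.2 ∈ geodesic (finRotate (n + 1)) then h (insertZero x.1 x.2) else 0 := by
    rw [← Equiv.sum_comp Equiv.Perm.decomposeFin fun x : Fin (n + 1) × Equiv.Perm (Fin n) =>
      if insertZero x.1 x.2 ∈ geodesic (finRotate (n + 1)) then h (insertZero x.1 x.2) else 0]
    simp only [insertZero, Prod.mk.eta, Equiv.symm_apply_apply]
    rw [Finset.sum_ite_mem, Finset.univ_inter]
  rw [h1, Fintype.sum_prod_type, Fin.sum_univ_succ]
  simp only [insertZero_zero_mem_geodesic]
  rw [Finset.sum_ite_mem, Finset.univ_inter]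

theorem sum_insertZero_succ {R : Type*} [AddCommMonoid R] {j m : ℕ}
    (h : Equiv.Perm (Fin (j + (m + 1) + 1)) → R) :
    (∑ σ : Equiv.Perm (Fin (j + (m + 1))),
      if insertZero (Fin.natAdd j (0 : Fin (m + 1))).succ σ ∈
          geodesic (finRotate (j + (m + 1) + 1))
        then h (insertZero (Fin.natAdd j (0 : Fin (m + 1))).succ σ) else 0) =
      ∑ x ∈ geodesic (finRotate j) ×ˢ geodesic (finRotate (m + 1)),
        h (insertZero (Fin.natAdd j (0 : Fin (m + 1))).succ (joinPerm x.1 x.2)) := by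
  simp only [insertZero_succ_mem_geodesic]
  rw [Finset.sum_ite_mem, Finset.univ_inter, sum_geodesic_joinPerm]

/-! ### Moments of free Poisson elements -/

/-- The generating polynomial of the cycle counts of the non-crossing permutations. -/
noncomputable def narayana (c : ℂ) (n : ℕ) : ℂ := ∑ τ ∈ geodesic (finRotate n), c ^ cyc τ

theorem narayana_zero (c : ℂ) : narayana c 0 = 1 := by
  have : geodesic (finRotate 0) = {1} := by
    ext τ
    simp [mem_geodesic, cyc_fin_zero, Subsingleton.elim τ 1]
  rw [narayana, this, Finset.sum_singleton, cyc_fin_zero, pow_zero]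

/-- Sorted by the image of `0`: a fixed point `0` contributes a cycle, hence a factor `c`. If `0` is
sent to `j + 1`, it joins a cycle of the second block without creating one, and the blocks of sizes
`j` and `n - j` are independent. -/
theorem narayana_succ (c : ℂ) (n : ℕ) : narayana c (n + 1) =
    c * narayana c n + ∑ j : Fin n, narayana c (n - j) * narayana c j := by
  rw [narayana, sum_geodesic_finRotate_succ]
  congr 1
  · simp_rw [cyc_insertZero_zero, pow_succ', ← Finset.mul_sum]
    rfl
  · refine Finset.sum_congr rfl fun j _ => ?_
    obtain ⟨j, hj⟩ := j
    obtain ⟨m, rfl⟩ : ∃ m, n = j + (m + 1) := ⟨n - j - 1, by omega⟩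
    have hj' : (⟨j, hj⟩ : Fin (j + (m + 1))) = Fin.natAdd j (0 : Fin (m + 1)) := by
      ext; simp
    rw [hj', sum_insertZero_succ (fun τ => c ^ cyc τ), Finset.sum_product, mul_comm, narayana, Finset.sum_mul]
    refine Finset.sum_congr rfl fun σ _ => ?_
    have h1 : j + (m + 1) - (Fin.natAdd j (0 : Fin (m + 1)) : ℕ) = m + 1 := by simp
    rw [h1, narayana, Finset.mul_sum]
    refine Finset.sum_congr rfl fun τ _ => ?_
    rw [cyc_insertZero_succ, cyc_joinPerm, pow_add]
    rfl

/-! ### Splittings of words -/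

/-- All pairs `(A₁, A₂)` with `A = A₁ ++ x :: A₂` where the letter `x` satisfies `m`. -/
def splits {β : Type*} (m : β → Bool) : List β → List (List β × List β)
  | [] => []
  | x :: A => (if m x then [([], A)] else []) ++ (splits m A).map fun p => (x :: p.1, p.2)

theorem sum_splits {β R : Type*} [AddCommMonoid R] (m : β → Bool) (A : List β)
    (h : List β × List β → R) : ((splits m A).map h).sum =
      ∑ i : Fin A.length, if m A[i] then h (A.take i, A.drop (i + 1)) else 0 := by
  induction A generalizing h with
  | nil => simp [splits]
  | cons x A ih =>
    rw [splits, List.map_append, List.sum_append, List.map_map, ih]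
    refine Eq.trans ?_ (Fin.sum_univ_succ (n := A.length) _).symm
    congr 1
    by_cases hx : m x <;> simp [hx]

theorem splits_map {β γ : Type*} (f : β → γ) (m : γ → Bool) (A : List β) :
    splits m (A.map f) = (splits (fun x => m (f x)) A).map fun p => (p.1.map f, p.2.map f) := by
  induction A with
  | nil => rfl
  | cons x A ih =>
    simp only [List.map_cons, splits, ih, List.map_append, List.map_map]
    congr 1
    by_cases hx : m (f x) <;> simp [hx]

/-! ### Moments of circular elements -/

/-- The pairings `τ` whose blocks join positions with different values of `ε`. -/
def IsPairing {n : ℕ} (ε : Fin n → Bool) (τ : Equiv.Perm (Fin n)) : Prop :=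
  ∀ a, τ (τ a) = a ∧ ε (τ a) ≠ ε a

open Classical in
/-- The number of non-crossing pairings joining positions with different values of `ε`. -/
noncomputable def pairCount {n : ℕ} (ε : Fin n → Bool) : ℂ :=
  ∑ τ ∈ geodesic (finRotate n), if IsPairing ε τ then 1 else 0

theorem pairCount_zero (ε : Fin 0 → Bool) : pairCount ε = 1 := by
  have : geodesic (finRotate 0) = {1} := by
    ext τ
    simp [mem_geodesic, cyc_fin_zero, Subsingleton.elim τ 1]
  have h : IsPairing ε 1 := fun a => a.elim0
  rw [pairCount, this, Finset.sum_singleton, if_pos h]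

theorem pairCount_congr {n n' : ℕ} (h : n = n') {ε : Fin n → Bool} {ε' : Fin n' → Bool}
    (hε : ∀ i : Fin n, ε i = ε' ⟨i, h ▸ i.2⟩) : pairCount ε = pairCount ε' := by
  subst h
  congr 1
  funext i
  exact hε i

/-- If `0` is paired with `j + 1`, dropping `0` leaves `j + 1` fixed. This is why the second block
has the form `insertZero 0 τ`. -/
theorem isPairing_insertZero {j m : ℕ} (ε : Fin (j + (m + 1) + 1) → Bool)
    (σ : Equiv.Perm (Fin j)) (τ : Equiv.Perm (Fin m)) :
    IsPairing ε (insertZero (Fin.natAdd j (0 : Fin (m + 1))).succ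
      (joinPerm σ (insertZero 0 τ))) ↔ ε (Fin.natAdd j (0 : Fin (m + 1))).succ ≠ ε 0 ∧
      IsPairing (fun i => ε (Fin.castAdd (m + 1) i).succ) σ ∧
      IsPairing (fun i => ε (Fin.natAdd j i.succ).succ) τ := by
  set k := Fin.natAdd j (0 : Fin (m + 1))
  set π := insertZero k.succ (joinPerm σ (insertZero 0 τ)) with hπ
  have h0 : π 0 = k.succ := by simp [hπ]
  have hk : π k.succ = 0 := by
    rw [hπ, Equiv.Perm.decomposeFin_symm_apply_succ]
    simp [k]
  have h1 : ∀ i, π (Fin.castAdd (m + 1) i).succ = (Fin.castAdd (m + 1) (σ i)).succ := by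
    intro i
    have h2 := (σ i).2
    rw [hπ, Equiv.Perm.decomposeFin_symm_apply_succ, joinPerm_castAdd,
      Equiv.swap_apply_of_ne_of_ne (Fin.succ_ne_zero _)]
    simp [k, Fin.ext_iff]
    omega
  have h2 : ∀ i, π (Fin.natAdd j i.succ).succ = (Fin.natAdd j (τ i).succ).succ := by
    intro i
    rw [hπ, Equiv.Perm.decomposeFin_symm_apply_succ, joinPerm_natAdd,
      Equiv.swap_apply_of_ne_of_ne (Fin.succ_ne_zero _)]
    · simp
    · simp [k, Fin.ext_iff]
  constructor
  · intro h
    refine ⟨by simpa [h0] using (h 0).2, fun i => ?_, fun i => ?_⟩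
    · have := h (Fin.castAdd (m + 1) i).succ
      simpa [h1] using this
    · have := h (Fin.natAdd j i.succ).succ
      rw [h2, h2] at this
      simpa using this
  · rintro ⟨h3, h4, h5⟩ a
    refine Fin.cases ?_ (fun a => Fin.addCases (fun i => ?_) (fun i => ?_) a) a
    · simpa [h0, hk] using h3
    · simpa [h1] using h4 i
    · refine Fin.cases ?_ (fun i => ?_) i
      · rw [hk, h0]
        exact ⟨rfl, h3.symm⟩
      · rw [h2, h2]
        simpa using h5 i

theorem not_isPairing_of_fixed {n : ℕ} {ε : Fin n → Bool} {τ : Equiv.Perm (Fin n)} {a : Fin n}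
    (h : τ a = a) : ¬ IsPairing ε τ := fun hp => (hp a).2 (by rw [h])

open Classical in
theorem sum_isPairing_insertZero_succ {n j m : ℕ} (hn : n = j + (m + 1)) (ε : Fin (n + 1) → Bool)
    (k : Fin n) (hk : (k : ℕ) = j) :
    (∑ σ : Equiv.Perm (Fin n), if insertZero k.succ σ ∈ geodesic (finRotate (n + 1)) then
      (if IsPairing ε (insertZero k.succ σ) then (1 : ℂ) else 0) else 0) =
      if ε k.succ ≠ ε 0 then pairCount (fun i : Fin j => ε ⟨i + 1, by omega⟩) *
        pairCount (fun i : Fin m => ε ⟨j + 1 + i + 1, by omega⟩) else 0 := by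
  subst hn
  obtain rfl : k = Fin.natAdd j (0 : Fin (m + 1)) := Fin.ext (by simpa using hk)
  rw [sum_insertZero_succ (fun τ => if IsPairing ε τ then (1 : ℂ) else 0), Finset.sum_product]
  -- The second block is decomposed once more by the image of its first point; in a pairing that
  -- point must be fixed, since its partner is `0`.
  simp only [sum_geodesic_finRotate_succ]
  have hz : ∀ (σ : Equiv.Perm (Fin j)) (i : Fin m) (τ : Equiv.Perm (Fin m)),
      ¬ IsPairing ε (insertZero (Fin.natAdd j (0 : Fin (m + 1))).succ
        (joinPerm σ (insertZero i.succ τ))) := by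
    intro σ i τ h
    have h1 := (h 0).1
    rw [Equiv.Perm.decomposeFin_symm_apply_zero, Equiv.Perm.decomposeFin_symm_apply_succ,
      joinPerm_natAdd, Equiv.Perm.decomposeFin_symm_apply_zero, Equiv.swap_apply_of_ne_of_ne
        (Fin.succ_ne_zero _) (by simp [Fin.ext_iff])] at h1
    exact Fin.succ_ne_zero _ h1
  simp only [hz, if_false, ite_self, Finset.sum_const_zero, add_zero, isPairing_insertZero]
  by_cases hε : ε (Fin.natAdd j (0 : Fin (m + 1))).succ ≠ ε 0
  · rw [if_pos hε, pairCount, pairCount, Finset.sum_mul_sum]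
    refine Finset.sum_congr rfl fun σ _ => Finset.sum_congr rfl fun τ _ => ?_
    have e1 : (fun i : Fin j => ε (Fin.castAdd (m + 1) i).succ) =
      fun i : Fin j => ε ⟨i + 1, by omega⟩ := rfl
    have e2 : (fun i : Fin m => ε (Fin.natAdd j i.succ).succ) =
      fun i : Fin m => ε ⟨j + 1 + i + 1, by omega⟩ := by
      funext i
      congr 1
      ext
      simp
      omega
    rw [e1, e2]
    by_cases h1 : IsPairing (fun i : Fin j => ε ⟨i + 1, by omega⟩) σ <;>
    by_cases h2 : IsPairing (fun i : Fin m => ε ⟨j + 1 + i + 1, by omega⟩) τ <;>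
    simp [h1, h2, hε]
  · rw [if_neg hε]
    simp [hε]

/-- The partner of the first letter carries the opposite label and, by non-crossing, separates the
remaining letters into two independently paired words. -/
theorem pairCount_cons (x : Bool) (A : List Bool) :
    pairCount (fun i : Fin (A.length + 1) => (x :: A)[i]) = ((splits (fun y => y != x) A).map
      fun p => pairCount (fun i : Fin p.1.length => p.1[i]) *
        pairCount (fun i : Fin p.2.length => p.2[i])).sum := by
  classical
  rw [sum_splits, pairCount, sum_geodesic_finRotate_succ, Finset.sum_eq_zero, zero_add]
  · refine Finset.sum_congr rfl fun k _ => ?_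
    have hk := k.2
    rw [sum_isPairing_insertZero_succ (j := k) (m := A.length - k - 1) (by omega) _ _ rfl]
    simp only [Fin.getElem_fin, Fin.val_succ, List.getElem_cons_succ, Fin.val_zero,
      List.getElem_cons_zero, bne_iff_ne]
    refine if_congr Iff.rfl ?_ rfl
    congr 1
    · exact pairCount_congr (by simp) fun i => by simp
    · refine pairCount_congr (by simp; omega) fun i => ?_
      simp [add_comm, add_left_comm]
  · intro σ _
    exact if_neg (not_isPairing_of_fixed (a := 0) (by simp))

/-! ### Moments in terms of cumulants -/

section Cumulants

variable {𝒜 : Type*} [Ring 𝒜] [Algebra ℂ 𝒜]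

theorem cumulant_congr (φ : 𝒜 →ₗ[ℂ] ℂ) {n n' : ℕ} (h : n = n') {A : Fin n → 𝒜} {B : Fin n' → 𝒜}
    (hAB : ∀ i : Fin n, A i = B ⟨i, h ▸ i.2⟩) : cumulant φ n A = cumulant φ n' B := by
  subst h
  congr 1
  funext i
  exact hAB i

theorem finRotate_pow_zero {n : ℕ} (i : ℕ) (hi : i < n + 1) :
    ((finRotate (n + 1)) ^ i) 0 = ⟨i, hi⟩ := by
  induction i with
  | zero => rfl
  | succ i ih =>
    rw [pow_succ', Equiv.Perm.mul_apply, ih (by omega)]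
    ext
    rw [val_finRotate_apply]
    simp
    omega

theorem leaders_finRotate (n : ℕ) : leaders (finRotate (n + 1)) = {0} := by
  have hs : ∀ b : Fin (n + 1), (finRotate (n + 1)).SameCycle 0 b := fun b =>
    ⟨(b : ℕ), by rw [zpow_natCast, finRotate_pow_zero _ b.2]⟩
  ext a
  simp only [leaders, Finset.mem_filter, Finset.mem_univ, true_and, Finset.mem_singleton]
  constructor
  · intro h
    exact le_antisymm (h 0 (hs a).symm) (Fin.zero_le _)
  · rintro rfl b _
    exact Fin.zero_le _

theorem cycleLength_finRotate (n : ℕ) : cycleLength (finRotate (n + 1)) 0 = n + 1 := by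
  rw [cycleLength]
  apply le_antisymm
  · simpa using Function.minimalPeriod_le_card (f := finRotate (n + 1)) (x := 0)
  · by_contra hlt
    push Not at hlt
    have hpos : 0 < Function.minimalPeriod (finRotate (n + 1)) (0 : Fin (n + 1)) :=
      Function.minimalPeriod_pos_of_mem_periodicPts
        ((finRotate (n + 1)).injective.mem_periodicPts 0)
    have h1 := Function.iterate_minimalPeriod (f := finRotate (n + 1)) (x := (0 : Fin (n + 1)))
    rw [Equiv.Perm.iterate_eq_pow, finRotate_pow_zero _ hlt, Fin.ext_iff] at h1
    simp only [Fin.val_zero] at h1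
    omega

theorem finRotate_mem_NC (n : ℕ) : finRotate (n + 1) ∈ NC (n + 1) := by
  rw [← geodesic_finRotate, mem_geodesic, inv_mul_cancel, add_comm]
  congr 1
  have h : invariants (1 : Equiv.Perm (Fin (n + 1))) = ⊤ := by
    ext f
    simp [mem_invariants]
  rw [cyc, h, finrank_top, Module.finrank_fintype_fun_eq_card]

/-- The moment–cumulant formula. -/
theorem map_prod_eq_sum_cumulant (φ : 𝒜 →ₗ[ℂ] ℂ) {n : ℕ} (A : Fin (n + 1) → 𝒜) :
    φ (List.ofFn A).prod = ∑ τ ∈ NC (n + 1), ∏ a ∈ leaders τ,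
      cumulant φ (cycleLength τ a) fun i => A ((τ ^ (i : ℕ)) a) := by
  classical
  rw [← Finset.add_sum_erase _ _ (finRotate_mem_NC n), leaders_finRotate, Finset.prod_singleton]
  have h1 : (cumulant φ (cycleLength (finRotate (n + 1)) 0) fun i =>
      A (((finRotate (n + 1)) ^ (i : ℕ)) 0)) = cumulant φ (n + 1) A :=
    cumulant_congr φ (cycleLength_finRotate n) fun i => by
      rw [finRotate_pow_zero _ (by have := cycleLength_finRotate n; omega)]
  have h2 : ∑ τ ∈ (NC (n + 1)).erase (finRotate (n + 1)), ∏ a ∈ leaders τ,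
      (cumulant φ (cycleLength τ a) fun i => A ((τ ^ (i : ℕ)) a)) =
      ∑ τ : {τ : Equiv.Perm (Fin (n + 1)) // τ ∈ NC (n + 1) ∧ τ ≠ finRotate (n + 1)},
      ∏ a ∈ leaders τ.1, cumulant φ (cycleLength τ.1 a) fun i => A ((τ.1 ^ (i : ℕ)) a) := by
    refine Finset.sum_subtype _ (fun τ => ?_) _
    rw [Finset.mem_erase, and_comm]
  rw [h1, h2, cumulant, sub_add_cancel]

theorem cycleLength_pos {n : ℕ} (τ : Equiv.Perm (Fin n)) (a : Fin n) : 1 ≤ cycleLength τ a :=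
  Function.minimalPeriod_pos_of_mem_periodicPts (τ.injective.mem_periodicPts a)

/-- Every cycle contributes the same cumulant `c`, so a permutation has weight `c ^ cyc τ`. -/
theorem IsFreePoisson.map_pow [StarRing 𝒜] {φ : 𝒜 →ₗ[ℂ] ℂ} {c : ℝ} {w : 𝒜} (hφ : φ 1 = 1)
    (hw : IsFreePoisson φ c w) (n : ℕ) : φ (w ^ n) = narayana c n := by
  rcases n with _ | n
  · simp [hφ, narayana_zero]
  · have h := map_prod_eq_sum_cumulant φ fun _ : Fin (n + 1) => w
    rw [List.ofFn_const, List.prod_replicate] at h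
    rw [h, narayana, geodesic_finRotate]
    refine Finset.sum_congr rfl fun τ _ => ?_
    rw [Finset.prod_congr rfl fun a _ => hw.2 _ (cycleLength_pos τ a), Finset.prod_const,
      ← numCycles_eq_cyc, numCycles]

/-- The right-hand side is the condition under which every cumulant in the moment–cumulant formula
of a circular element is nonzero. -/
theorem isPairing_iff {n : ℕ} (ε : Fin n → Bool) (τ : Equiv.Perm (Fin n)) :
    IsPairing ε τ ↔ ∀ a ∈ leaders τ, cycleLength τ a = 2 ∧
      ∃ i j : Fin (cycleLength τ a), ε ((τ ^ (i : ℕ)) a) ≠ ε ((τ ^ (j : ℕ)) a) := by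
  constructor
  · intro h a _
    have h2 : cycleLength τ a = 2 := by
      refine Function.minimalPeriod_eq_prime (f := τ) (x := a) (p := 2) (h a).1 fun h1 => ?_
      exact (h a).2 (by rw [show τ a = a from h1])
    refine ⟨h2, ⟨1, by omega⟩, ⟨0, by omega⟩, ?_⟩
    simpa using (h a).2
  · intro h b
    obtain ⟨a, ha, i, rfl⟩ := exists_leader τ b
    obtain ⟨h1, i₁, i₂, h2⟩ := h a ha
    have hp : τ (τ a) = a := by
      have := Function.iterate_minimalPeriod (f := τ) (x := a)
      rwa [show Function.minimalPeriod τ a = 2 from h1] at this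
    have hne : ε (τ a) ≠ ε a := by
      have e : ∀ i : Fin (cycleLength τ a), (τ ^ (i : ℕ)) a = a ∨ (τ ^ (i : ℕ)) a = τ a := by
        intro i
        have hi : (i : ℕ) = 0 ∨ (i : ℕ) = 1 := by omega
        rcases hi with hi | hi <;> simp [hi]
      intro h3
      rcases e i₁ with e1 | e1 <;> rcases e i₂ with e2 | e2 <;> rw [e1, e2] at h2 <;>
        simp_all
    have hsq : τ ^ (2 : ℤ) = τ * τ := zpow_two τ
    rcases Int.even_or_odd' i with ⟨k, rfl | rfl⟩
    · have : (τ ^ (2 * k)) a = a := by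
        rw [zpow_mul]
        exact Equiv.Perm.zpow_apply_eq_self_of_apply_eq_self (by simpa [hsq] using hp) k
      rw [this]
      exact ⟨hp, hne⟩
    · have : (τ ^ (2 * k + 1)) a = τ a := by
        rw [add_comm, zpow_add, zpow_one, Equiv.Perm.mul_apply, zpow_mul]
        congr 1
        exact Equiv.Perm.zpow_apply_eq_self_of_apply_eq_self (by simpa [hsq] using hp) k
      rw [this, hp]
      exact ⟨rfl, hne.symm⟩

theorem IsStandardCircular.map_prod [StarRing 𝒜] {φ : 𝒜 →ₗ[ℂ] ℂ} {g : 𝒜} (hφ : φ 1 = 1)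
    (hg : IsStandardCircular φ g) (A : List Bool) :
    φ (A.map fun b => if b then star g else g).prod = pairCount fun i : Fin A.length => A[i] := by
  classical
  rcases A with _ | ⟨x, A⟩
  · rw [pairCount_zero]
    simpa using hφ
  · have h := map_prod_eq_sum_cumulant φ
      fun i : Fin (A.length + 1) => if (x :: A)[i] then star g else g
    have h1 : List.ofFn (fun i : Fin (A.length + 1) => if (x :: A)[i] then star g else g) =
        (x :: A).map fun b => if b then star g else g := by
      refine List.ext_getElem (by simp) fun i h1 h2 => ?_
      rw [List.getElem_ofFn, List.getElem_map]
      rfl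
    rw [h1] at h
    rw [h, pairCount]
    change _ = ∑ τ ∈ geodesic (finRotate (A.length + 1)), _
    rw [geodesic_finRotate]
    refine Finset.sum_congr rfl fun τ _ => ?_
    rw [Finset.prod_congr rfl fun a _ => hg _ (fun i => (x :: A)[(τ ^ (i : ℕ)) a])
      (cycleLength_pos τ a), Finset.prod_ite_zero]
    simp only [Finset.prod_const_one]
    exact if_congr (isPairing_iff _ τ).symm rfl rfl

end Cumulants

/-! ### Schwinger–Dyson equations in free families -/

section Free

open scoped TensorProduct

variable {𝒜 : Type*} [Ring 𝒜] [Algebra ℂ 𝒜] {J : Type*}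

/-- A centered alternating list with respect to the subalgebras `B j`. -/
def IsAlternating (φ : 𝒜 →ₗ[ℂ] ℂ) (B : J → Subalgebra ℂ 𝒜) (l : List (J × 𝒜)) : Prop :=
  l.IsChain (fun p q => p.1 ≠ q.1) ∧ ∀ p ∈ l, p.2 ∈ B p.1 ∧ φ p.2 = 0

theorem IsFreeFamily.map_prod {φ : 𝒜 →ₗ[ℂ] ℂ} {B : J → Subalgebra ℂ 𝒜} (hB : IsFreeFamily φ B)
    {l : List (J × 𝒜)} (hl : IsAlternating φ B l) (hne : l ≠ []) :
    φ (l.map Prod.snd).prod = 0 := by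
  rcases l with _ | ⟨p, l⟩
  · exact absurd rfl hne
  · have h := hB l.length (fun i => ((p :: l).get i).1) (fun i => ((p :: l).get i).2) ?_ ?_ ?_
    · have h1 : List.ofFn (fun i : Fin (l.length + 1) => ((p :: l).get i).2) =
          (p :: l).map Prod.snd := by
        refine List.ext_getElem (by simp) fun i h1 h2 => ?_
        rw [List.getElem_ofFn, List.getElem_map]
        rfl
      rwa [h1] at h
    · intro i
      have := List.isChain_iff_getElem.1 hl.1 i (by simp)
      simpa using this
    · exact fun i => (hl.2 _ (List.get_mem (p :: l) i)).1
    · exact fun i => (hl.2 _ (List.get_mem (p :: l) i)).2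

/-- Write `a` as its centered part plus the scalar `φ a`: both contributions vanish by freeness.
Thus the first factor of an alternating product need not be centered. -/
theorem IsFreeFamily.map_mul_prod {φ : 𝒜 →ₗ[ℂ] ℂ} (hφ : φ 1 = 1) {B : J → Subalgebra ℂ 𝒜}
    (hB : IsFreeFamily φ B) {p : J × 𝒜} {l : List (J × 𝒜)} (hl : IsAlternating φ B (p :: l))
    {j : J} (hj : j ≠ p.1) {a : 𝒜} (ha : a ∈ B j) :
    φ (a * ((p :: l).map Prod.snd).prod) = 0 := by
  have h1 : IsAlternating φ B ((j, a - algebraMap ℂ 𝒜 (φ a)) :: p :: l) := by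
    refine ⟨List.IsChain.cons_cons hj hl.1, fun q hq => ?_⟩
    rcases List.mem_cons.1 hq with rfl | hq
    · refine ⟨sub_mem ha (Subalgebra.algebraMap_mem _ _), ?_⟩
      simp [Algebra.algebraMap_eq_smul_one, hφ]
    · exact hl.2 q hq
  have h2 := hB.map_prod h1 (by simp)
  have h3 := hB.map_prod hl (by simp)
  rw [List.map_cons, List.prod_cons, sub_mul, map_sub, Algebra.algebraMap_eq_smul_one,
    smul_mul_assoc, one_mul, map_smul, h3, smul_zero, sub_zero] at h2
  exact h2

variable (val : J × Bool → 𝒜)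

/-- Evaluation of non-commutative polynomials. -/
noncomputable def evalFree : FreeAlgebra ℂ (J × Bool) →ₐ[ℂ] 𝒜 := FreeAlgebra.lift ℂ val

/-- The word `A` as a non-commutative monomial. -/
noncomputable def wordFree (A : List (J × Bool)) : FreeAlgebra ℂ (J × Bool) :=
  (A.map (FreeAlgebra.ι ℂ)).prod

theorem evalFree_wordFree (A : List (J × Bool)) :
    evalFree val (wordFree A) = (A.map val).prod := by
  simp only [wordFree, map_list_prod, List.map_map]
  congr 2
  funext x
  simp [evalFree]

/-- Upper triangular matrices whose corner is the free difference quotient with respect to the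
letters selected by `m`. -/
noncomputable def triangular (m : J × Bool → Bool) :
    FreeAlgebra ℂ (J × Bool) →ₐ[ℂ] Matrix (Fin 2) (Fin 2) (𝒜 ⊗[ℂ] 𝒜) :=
  FreeAlgebra.lift ℂ fun x => !![val x ⊗ₜ 1, if m x then 1 else 0; 0, 1 ⊗ₜ val x]

/-- The diagonal carries the left and right embeddings into the tensor square, so the product of
triangular matrices is the Leibniz rule for the corner. -/
theorem triangular_apply (m : J × Bool → Bool) (p : FreeAlgebra ℂ (J × Bool)) :
    triangular val m p 0 0 = evalFree val p ⊗ₜ 1 ∧ triangular val m p 1 0 = 0 ∧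
      triangular val m p 1 1 = 1 ⊗ₜ evalFree val p := by
  induction p using FreeAlgebra.induction with
  | grade0 r =>
    simp [Algebra.algebraMap_eq_smul_one, TensorProduct.smul_tmul, TensorProduct.tmul_smul,
      Algebra.TensorProduct.one_def]
  | grade1 x => simp [triangular, evalFree]
  | mul p q hp hq =>
    simp only [map_mul, Matrix.mul_apply, Fin.sum_univ_two, hp, hq]
    simp
  | add p q hp hq =>
    simp only [map_add, Matrix.add_apply, hp, hq]
    simp [TensorProduct.add_tmul, TensorProduct.tmul_add]

/-- The free difference quotient with respect to the letters selected by `m`. -/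
noncomputable def freeDiff (m : J × Bool → Bool) :
    FreeAlgebra ℂ (J × Bool) →ₗ[ℂ] 𝒜 ⊗[ℂ] 𝒜 where
  toFun p := triangular val m p 0 1
  map_add' p q := by simp
  map_smul' c p := by simp

theorem freeDiff_one (m : J × Bool → Bool) : freeDiff val m 1 = 0 := by
  simp [freeDiff]

theorem freeDiff_mul (m : J × Bool → Bool) (p q : FreeAlgebra ℂ (J × Bool)) :
    freeDiff val m (p * q) = freeDiff val m p * (1 ⊗ₜ evalFree val q) +
      (evalFree val p ⊗ₜ 1) * freeDiff val m q := by
  simp only [freeDiff, LinearMap.coe_mk, AddHom.coe_mk, map_mul, Matrix.mul_apply,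
    Fin.sum_univ_two, triangular_apply]
  exact add_comm _ _

theorem freeDiff_wordFree (m : J × Bool → Bool) (A : List (J × Bool)) :
    freeDiff val m (wordFree A) = ((splits m A).map fun p =>
      (p.1.map val).prod ⊗ₜ[ℂ] (p.2.map val).prod).sum := by
  induction A with
  | nil => simp [wordFree, splits, freeDiff_one]
  | cons x A ih =>
    have h1 : freeDiff val m (FreeAlgebra.ι ℂ x) = if m x then 1 else 0 := by
      simp [freeDiff, triangular]
    have h2 : evalFree val (FreeAlgebra.ι ℂ x) = val x := by simp [evalFree]
    have h3 : wordFree (x :: A) = FreeAlgebra.ι ℂ x * wordFree A := by simp [wordFree]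
    rw [h3, freeDiff_mul, ih, h1, h2, evalFree_wordFree, splits, List.map_append, List.sum_append,
      ← List.sum_map_mul_left, List.map_map]
    congr 1
    · by_cases hx : m x <;> simp [hx]
    · congr 1
      simp [Function.comp_def]

/-- The non-commutative polynomials in the letters with index `j`. -/
def letterSpan (j : J) : Submodule ℂ (FreeAlgebra ℂ (J × Bool)) :=
  Submodule.span ℂ (Set.range fun L : List Bool => wordFree (L.map (Prod.mk j)))

theorem one_mem_letterSpan (j : J) : 1 ∈ letterSpan j :=
  Submodule.subset_span ⟨[], by simp [wordFree]⟩

theorem algebraMap_mem_letterSpan (j : J) (c : ℂ) : algebraMap ℂ _ c ∈ letterSpan j := by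
  rw [Algebra.algebraMap_eq_smul_one]
  exact Submodule.smul_mem _ _ (one_mem_letterSpan j)

theorem ι_mul_mem_letterSpan (x : J × Bool) {p : FreeAlgebra ℂ (J × Bool)}
    (hp : p ∈ letterSpan x.1) : FreeAlgebra.ι ℂ x * p ∈ letterSpan x.1 := by
  induction hp using Submodule.span_induction with
  | mem p hp =>
    obtain ⟨L, rfl⟩ := hp
    exact Submodule.subset_span ⟨x.2 :: L, by simp [wordFree]⟩
  | zero => simp
  | add p q _ _ hp hq => rw [mul_add]; exact add_mem hp hq
  | smul c p _ hp => rw [mul_smul_comm]; exact Submodule.smul_mem _ _ hp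

variable {val} {B : J → Subalgebra ℂ 𝒜}

theorem evalFree_mem (hval : ∀ x, val x ∈ B x.1) {j : J} {p : FreeAlgebra ℂ (J × Bool)} (hp : p ∈ letterSpan j) :
    evalFree val p ∈ B j := by
  induction hp using Submodule.span_induction with
  | mem p hp =>
    obtain ⟨L, rfl⟩ := hp
    rw [evalFree_wordFree, List.map_map]
    refine list_prod_mem fun a ha => ?_
    obtain ⟨b, _, rfl⟩ := List.mem_map.1 ha
    exact hval (j, b)
  | zero => simp
  | add p q _ _ hp hq => rw [map_add]; exact add_mem hp hq
  | smul c p _ hp => rw [map_smul]; exact Subalgebra.smul_mem _ hp c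

theorem freeDiff_mem (hval : ∀ x, val x ∈ B x.1) (m : J × Bool → Bool) {j : J}
    {p : FreeAlgebra ℂ (J × Bool)} (hp : p ∈ letterSpan j) :
    freeDiff val m p ∈ Submodule.span ℂ {T : 𝒜 ⊗[ℂ] 𝒜 | ∃ a ∈ B j, ∃ b ∈ B j, T = a ⊗ₜ b} := by
  induction hp using Submodule.span_induction with
  | mem p hp =>
    obtain ⟨L, rfl⟩ := hp
    rw [freeDiff_wordFree, splits_map, List.map_map]
    refine list_sum_mem fun T hT => ?_
    obtain ⟨q, _, rfl⟩ := List.mem_map.1 hT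
    have h : ∀ L : List Bool, ((L.map (Prod.mk j)).map val).prod ∈ B j := by
      intro L
      rw [List.map_map]
      refine list_prod_mem fun a ha => ?_
      obtain ⟨b, _, rfl⟩ := List.mem_map.1 ha
      exact hval (j, b)
    exact Submodule.subset_span ⟨_, h q.1, _, h q.2, rfl⟩
  | zero => simp
  | add p q _ _ hp hq => rw [map_add]; exact add_mem hp hq
  | smul c p _ hp => rw [map_smul]; exact Submodule.smul_mem _ _ hp

theorem freeDiff_eq_zero {m : J × Bool → Bool} {j : J} (hm : ∀ b, m (j, b) = false)
    {p : FreeAlgebra ℂ (J × Bool)} (hp : p ∈ letterSpan j) : freeDiff val m p = 0 := by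
  induction hp using Submodule.span_induction with
  | mem p hp =>
    obtain ⟨L, rfl⟩ := hp
    rw [freeDiff_wordFree, splits_map]
    simp only [hm]
    have : ∀ L : List Bool, splits (fun _ => false) L = [] := by
      intro L
      induction L with
      | nil => rfl
      | cons x L ih => simp [splits, ih]
    simp [this]
  | zero => simp
  | add p q _ _ hp hq => rw [map_add, hp, hq, add_zero]
  | smul c p _ hp => rw [map_smul, hp, smul_zero]

/-- The functional `φ ⊗ φ`. -/
noncomputable def tensorState (φ : 𝒜 →ₗ[ℂ] ℂ) : 𝒜 ⊗[ℂ] 𝒜 →ₗ[ℂ] ℂ :=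
  LinearMap.mul' ℂ ℂ ∘ₗ TensorProduct.map φ φ

@[simp] theorem tensorState_tmul (φ : 𝒜 →ₗ[ℂ] ℂ) (a b : 𝒜) :
    tensorState φ (a ⊗ₜ b) = φ a * φ b := by simp [tensorState]

/-- Centered alternating lists of non-commutative polynomials. -/
def IsAlternatingFree (val : J × Bool → 𝒜) (φ : 𝒜 →ₗ[ℂ] ℂ)
    (l : List (J × FreeAlgebra ℂ (J × Bool))) : Prop :=
  l.IsChain (fun p q => p.1 ≠ q.1) ∧ ∀ p ∈ l, p.2 ∈ letterSpan p.1 ∧ φ (evalFree val p.2) = 0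

theorem IsAlternatingFree.map (hval : ∀ x, val x ∈ B x.1) {φ : 𝒜 →ₗ[ℂ] ℂ}
    {l : List (J × FreeAlgebra ℂ (J × Bool))} (hl : IsAlternatingFree val φ l) :
    IsAlternating φ B (l.map fun p => (p.1, evalFree val p.2)) := by
  refine ⟨?_, fun p hp => ?_⟩
  · rw [List.isChain_map]
    exact hl.1
  · obtain ⟨q, hq, rfl⟩ := List.mem_map.1 hp
    exact ⟨evalFree_mem hval (hl.2 q hq).1, (hl.2 q hq).2⟩

theorem map_mul_evalFree_prod {φ : 𝒜 →ₗ[ℂ] ℂ} (hφ : φ 1 = 1) (hB : IsFreeFamily φ B)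
    (hval : ∀ x, val x ∈ B x.1) {p : J × FreeAlgebra ℂ (J × Bool)}
    {l : List (J × FreeAlgebra ℂ (J × Bool))} (hl : IsAlternatingFree val φ (p :: l))
    {j : J} (hj : j ≠ p.1) {a : 𝒜} (ha : a ∈ B j) :
    φ (a * evalFree val ((p :: l).map Prod.snd).prod) = 0 := by
  have := hB.map_mul_prod hφ (IsAlternatingFree.map hval hl) hj ha
  rw [map_list_prod, List.map_map]
  simpa [List.map_map, Function.comp_def] using this

theorem IsAlternatingFree.tail {φ : 𝒜 →ₗ[ℂ] ℂ} {p : J × FreeAlgebra ℂ (J × Bool)}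
    {l : List (J × FreeAlgebra ℂ (J × Bool))} (hl : IsAlternatingFree val φ (p :: l)) :
    IsAlternatingFree val φ l := ⟨hl.1.tail, fun q hq => hl.2 q (List.mem_cons_of_mem _ hq)⟩

/-- A letter multiplied on the left of an alternating product either merges with its first block or
starts a new one. Centering that block costs a scalar multiple of the remaining product, which is
again alternating. -/
theorem mem_span_alternating [DecidableEq J] {φ : 𝒜 →ₗ[ℂ] ℂ} (hφ : φ 1 = 1)
    (A : List (J × Bool)) : wordFree A ∈
      Submodule.span ℂ {p | ∃ l, IsAlternatingFree val φ l ∧ p = (l.map Prod.snd).prod} := by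
  set S := Submodule.span ℂ {p | ∃ l, IsAlternatingFree val φ l ∧ p = (l.map Prod.snd).prod}
  have hcons : ∀ (j : J) (p : FreeAlgebra ℂ (J × Bool)) l, p ∈ letterSpan j →
      IsAlternatingFree val φ l → (∀ q ∈ l.head?, j ≠ q.1) → p * (l.map Prod.snd).prod ∈ S := by
    intro j p l hp hl hj
    have h1 : IsAlternatingFree val φ ((j, p - algebraMap ℂ _ (φ (evalFree val p))) :: l) := by
      refine ⟨List.isChain_cons.2 ⟨hj, hl.1⟩, fun q hq => ?_⟩
      rcases List.mem_cons.1 hq with rfl | hq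
      · refine ⟨sub_mem hp (algebraMap_mem_letterSpan _ _), ?_⟩
        simp [Algebra.algebraMap_eq_smul_one, hφ]
      · exact hl.2 q hq
    have h2 : p * (l.map Prod.snd).prod =
        (((j, p - algebraMap ℂ _ (φ (evalFree val p))) :: l).map Prod.snd).prod +
          φ (evalFree val p) • (l.map Prod.snd).prod := by
      simp [sub_mul, Algebra.algebraMap_eq_smul_one]
    rw [h2]
    exact add_mem (Submodule.subset_span ⟨_, h1, rfl⟩)
      (Submodule.smul_mem _ _ (Submodule.subset_span ⟨_, hl, rfl⟩))
  have hmul : ∀ (x : J × Bool) (p : FreeAlgebra ℂ (J × Bool)), p ∈ S →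
      FreeAlgebra.ι ℂ x * p ∈ S := by
    intro x p hp
    induction hp using Submodule.span_induction with
    | mem p hp =>
      obtain ⟨l, hl, rfl⟩ := hp
      have hx : FreeAlgebra.ι ℂ x ∈ letterSpan x.1 := by
        simpa using ι_mul_mem_letterSpan x (one_mem_letterSpan x.1)
      rcases l with _ | ⟨q, l⟩
      · exact hcons x.1 _ [] hx hl (by simp)
      · by_cases hq : x.1 = q.1
        · rw [List.map_cons, List.prod_cons, ← mul_assoc]
          refine hcons x.1 _ l (ι_mul_mem_letterSpan x ?_) hl.tail ?_
          · rw [hq]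
            exact (hl.2 q (by simp)).1
          · rw [hq]
            exact (List.isChain_cons.1 hl.1).1
        · exact hcons x.1 _ (q :: l) hx hl (by simpa using hq)
    | zero => simp
    | add p q _ _ hp hq => rw [mul_add]; exact add_mem hp hq
    | smul c p _ hp => rw [mul_smul_comm]; exact Submodule.smul_mem _ _ hp
  induction A with
  | nil => exact Submodule.subset_span ⟨[], ⟨by simp, by simp⟩, by simp [wordFree]⟩
  | cons x A ih =>
    have : wordFree (x :: A) = FreeAlgebra.ι ℂ x * wordFree A := by simp [wordFree]
    rw [this]
    exact hmul x _ ih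

/-- The induction runs over the block hit by the derivative, with `l₁` the blocks already passed.
Such a block is cut into two pieces from `B j₀`, and at least one of the two resulting factors
contains an alternating product multiplied by a single element of `B j₀`, so it vanishes. Length at
least two is needed for such a product to remain. -/
theorem tensorState_freeDiff_alternating {φ : 𝒜 →ₗ[ℂ] ℂ} (hφ : φ 1 = 1)
    (htr : ∀ a b, φ (a * b) = φ (b * a)) (hB : IsFreeFamily φ B) (hval : ∀ x, val x ∈ B x.1)
    {m : J × Bool → Bool} {j₀ : J} (hm : ∀ j b, j ≠ j₀ → m (j, b) = false)
    {t : 𝒜} (ht : t ∈ B j₀) (l₁ l : List (J × FreeAlgebra ℂ (J × Bool)))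
    (hl : IsAlternatingFree val φ (l₁ ++ l)) (hlen : 2 ≤ (l₁ ++ l).length) :
    tensorState φ (((t * evalFree val (l₁.map Prod.snd).prod) ⊗ₜ 1) *
      freeDiff val m (l.map Prod.snd).prod) = 0 := by
  induction l generalizing l₁ with
  | nil => simp [freeDiff_one]
  | cons q l ih =>
    have hih := ih (l₁ ++ [q]) (by simpa using hl) (by simpa using hlen)
    rw [List.map_cons, List.prod_cons, freeDiff_mul, mul_add, map_add, ← mul_assoc,
      ← mul_assoc (((t * evalFree val (l₁.map Prod.snd).prod) ⊗ₜ[ℂ] (1 : 𝒜)))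
        (evalFree val q.2 ⊗ₜ 1)]
    have h2 : (t * evalFree val (l₁.map Prod.snd).prod) ⊗ₜ[ℂ] (1 : 𝒜) *
        (evalFree val q.2 ⊗ₜ 1) =
        (t * evalFree val ((l₁ ++ [q]).map Prod.snd).prod) ⊗ₜ[ℂ] (1 : 𝒜) := by
      simp [mul_assoc]
    rw [h2, hih, add_zero]
    have hq := hl.2 q (by simp)
    by_cases hj : q.1 = j₀
    swap
    · rw [freeDiff_eq_zero (fun b => hm _ b hj) hq.1]
      simp
    have hlq : IsAlternatingFree val φ (q :: l) :=
      ⟨hl.1.right_of_append, fun p hp => hl.2 p (by simp only [List.mem_append]; exact Or.inr hp)⟩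
    set P := t * evalFree val (l₁.map Prod.snd).prod
    set Q := evalFree val (l.map Prod.snd).prod
    -- If blocks follow `q`, the right factor vanishes. If `q` is last, the trace property brings
    -- `a` in front of `t` in the left factor; when the first block also belongs to `j₀` it is
    -- absorbed, and another block remains because `q` and its neighbour have different indices.
    have key : ∀ a ∈ B j₀, ∀ b ∈ B j₀, φ (P * a) * φ (b * Q) = 0 := by
      intro a ha b hb
      rcases l with _ | ⟨q', l⟩
      · apply mul_eq_zero_of_left
        rcases l₁ with _ | ⟨p, l₁⟩
        · simp at hlen
        · rw [htr, ← mul_assoc]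
          have hat : a * t ∈ B j₀ := mul_mem ha ht
          have hlp : IsAlternatingFree val φ (p :: l₁) :=
            ⟨hl.1.left_of_append, fun p' hp => hl.2 p'
              (by simp only [List.mem_append]; exact Or.inl hp)⟩
          by_cases hp : j₀ = p.1
          · rcases l₁ with _ | ⟨p', l₁⟩
            · have h3 := hl.1
              simp [hj, hp] at h3
            · rw [List.map_cons, List.prod_cons, map_mul (evalFree val), ← mul_assoc]
              refine map_mul_evalFree_prod hφ hB hval hlp.tail (j := j₀) ?_ (mul_mem hat ?_)
              · rw [hp]
                exact (List.isChain_cons_cons.1 hlp.1).1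
              · rw [hp]
                exact evalFree_mem hval (hlp.2 p (by simp)).1
          · exact map_mul_evalFree_prod hφ hB hval hlp hp hat
      · apply mul_eq_zero_of_right
        refine map_mul_evalFree_prod hφ hB hval hlq.tail ?_ hb
        rw [← hj]
        exact (List.isChain_cons_cons.1 hlq.1).1
    have hmem := freeDiff_mem hval m hq.1
    rw [hj] at hmem
    generalize freeDiff val m q.2 = T at hmem
    induction hmem using Submodule.span_induction with
    | mem T hT =>
      obtain ⟨a, ha, b, hb, rfl⟩ := hT
      simpa using key a ha b hb
    | zero => simp
    | add T T' _ _ h h' => rw [mul_add, add_mul, map_add, h, h', add_zero]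
    | smul c T _ h => rw [mul_smul_comm, smul_mul_assoc, map_smul, h, smul_zero]

/-- A Schwinger–Dyson equation for the words in the letters of one member of a free family extends
to the words in all letters. -/
theorem schwingerDyson_of_free [DecidableEq J] {φ : 𝒜 →ₗ[ℂ] ℂ} (hφ : φ 1 = 1)
    (htr : ∀ a b, φ (a * b) = φ (b * a)) (hB : IsFreeFamily φ B) (hval : ∀ x, val x ∈ B x.1)
    {m : J × Bool → Bool} {j₀ : J} (hm : ∀ j b, j ≠ j₀ → m (j, b) = false)
    {v t : 𝒜} (hv : v ∈ B j₀) (ht : t ∈ B j₀) (κ : ℂ)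
    (hSD : ∀ L : List Bool, φ (v * (L.map fun b => val (j₀, b)).prod) =
      κ * φ (L.map fun b => val (j₀, b)).prod + ((splits (fun b => m (j₀, b)) L).map fun p =>
        φ (t * (p.1.map fun b => val (j₀, b)).prod) *
          φ (p.2.map fun b => val (j₀, b)).prod).sum)
    (A : List (J × Bool)) :
    φ (v * (A.map val).prod) = κ * φ (A.map val).prod + ((splits m A).map fun p =>
      φ (t * (p.1.map val).prod) * φ (p.2.map val).prod).sum := by
  -- `Ψ` is the defect of the equation. By linearity it suffices that it vanishes on alternating
  -- products: `hSD` covers a single block of index `j₀`, and freeness covers the others.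
  let Ψ : FreeAlgebra ℂ (J × Bool) →ₗ[ℂ] ℂ :=
    φ ∘ₗ LinearMap.mulLeft ℂ v ∘ₗ (evalFree val).toLinearMap -
      (κ • (φ ∘ₗ (evalFree val).toLinearMap) +
        tensorState φ ∘ₗ LinearMap.mulLeft ℂ (t ⊗ₜ 1) ∘ₗ freeDiff val m)
  have hΨ : ∀ p, Ψ p = φ (v * evalFree val p) - (κ * φ (evalFree val p) +
      tensorState φ ((t ⊗ₜ 1) * freeDiff val m p)) := fun p => rfl
  have hword : ∀ A : List (J × Bool), Ψ (wordFree A) = φ (v * (A.map val).prod) -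
      (κ * φ (A.map val).prod + ((splits m A).map fun p =>
        φ (t * (p.1.map val).prod) * φ (p.2.map val).prod).sum) := by
    intro A
    rw [hΨ, evalFree_wordFree, freeDiff_wordFree, ← List.sum_map_mul_left, map_list_sum,
      List.map_map]
    simp [Function.comp_def]
  have hsingle : ∀ p ∈ letterSpan j₀, Ψ p = 0 := by
    intro p hp
    induction hp using Submodule.span_induction with
    | mem p hp =>
      obtain ⟨L, rfl⟩ := hp
      rw [hword, splits_map, List.map_map, List.map_map, sub_eq_zero]
      have := hSD L
      simpa [Function.comp_def] using this
    | zero => simp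
    | add p q _ _ hp hq => rw [map_add, hp, hq, add_zero]
    | smul c p _ hp => rw [map_smul, hp, smul_zero]
  have halt : ∀ l, IsAlternatingFree val φ l → Ψ (l.map Prod.snd).prod = 0 := by
    intro l hl
    rcases l with _ | ⟨q, l⟩
    · exact hsingle _ (by simpa using one_mem_letterSpan j₀)
    have hq := hl.2 q (by simp)
    by_cases hlen : l = []
    · subst hlen
      by_cases hj : q.1 = j₀
      · exact hsingle _ (by simpa [hj] using hq.1)
      · have h1 := map_mul_evalFree_prod hφ hB hval hl (Ne.symm hj) hv
        rw [hΨ, h1]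
        simp [freeDiff_eq_zero (fun b => hm _ b hj) hq.1, hq.2]
    · have h1 := tensorState_freeDiff_alternating hφ htr hB hval hm ht [] (q :: l) hl (by
        have := List.length_pos_iff.2 hlen
        simp
        omega)
      have h2 : φ (evalFree val ((q :: l).map Prod.snd).prod) = 0 := by
        have := hB.map_prod (IsAlternatingFree.map hval hl) (by simp)
        rw [map_list_prod, List.map_map]
        simpa [List.map_map, Function.comp_def] using this
      have h3 : φ (v * evalFree val ((q :: l).map Prod.snd).prod) = 0 := by
        by_cases hj : j₀ = q.1
        · rcases l with _ | ⟨q', l⟩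
          · exact absurd rfl hlen
          · rw [List.map_cons, List.prod_cons, map_mul (evalFree val), ← mul_assoc]
            refine map_mul_evalFree_prod hφ hB hval hl.tail (j := j₀) ?_ (mul_mem hv ?_)
            · rw [hj]
              exact (List.isChain_cons_cons.1 hl.1).1
            · rw [hj]
              exact evalFree_mem hval hq.1
        · exact map_mul_evalFree_prod hφ hB hval hl hj hv
      rw [hΨ, h2, h3]
      simpa using h1
  have hall : Ψ (wordFree A) = 0 := by
    have h1 := mem_span_alternating (val := val) hφ A
    have h2 : Submodule.span ℂ {p | ∃ l, IsAlternatingFree val φ l ∧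
        p = (l.map Prod.snd).prod} ≤ LinearMap.ker Ψ := by
      rw [Submodule.span_le]
      rintro _ ⟨l, hl, rfl⟩
      exact halt l hl
    exact h2 h1
  rw [hword, sub_eq_zero] at hall
  exact hall

variable [StarRing 𝒜] [StarModule ℂ 𝒜]

theorem letter_mem_adjoin (x : J → 𝒜) (p : J × Bool) : (if p.2 then star (x p.1) else x p.1) ∈
    (StarAlgebra.adjoin ℂ {x p.1}).toSubalgebra := by
  have h : x p.1 ∈ StarAlgebra.adjoin ℂ {x p.1} :=
    StarAlgebra.subset_adjoin ℂ _ (Set.mem_singleton _)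
  split_ifs
  · exact star_mem (S := StarSubalgebra ℂ 𝒜) h
  · exact h

/-- Schwinger–Dyson equation for a circular member of a `*`-free family. -/
theorem IsStandardCircular.schwingerDyson [DecidableEq J] {φ : 𝒜 →ₗ[ℂ] ℂ}
    (hφ : IsTracialState φ) {x : J → 𝒜} (hx : IsStarFree φ x) {j : J}
    (hg : IsStandardCircular φ (x j)) (ε : Bool) (A : List (J × Bool)) :
    φ (evalMonomial x ((j, ε) :: A)) = ((splits (fun y => decide (y = (j, !ε))) A).map fun p =>
      φ (evalMonomial x p.1) * φ (evalMonomial x p.2)).sum := by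
  have h := schwingerDyson_of_free (v := if ε then star (x j) else x j) (t := 1) hφ.map_one
    hφ.tracial hx (letter_mem_adjoin x) (m := fun y => decide (y = (j, !ε))) (j₀ := j)
    (fun i b hij => by simp [hij]) (letter_mem_adjoin x (j, ε)) (one_mem _) 0 ?_ A
  · simpa [evalMonomial] using h
  · intro L
    have h1 := hg.map_prod hφ.map_one (ε :: L)
    rw [List.map_cons, List.prod_cons] at h1
    refine h1.trans ((pairCount_cons ε L).trans ?_)
    have hm : (fun b => decide ((j, b) = (j, !ε))) = fun b => b != ε := by
      funext b
      cases b <;> cases ε <;> simp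
    simp only [hm, zero_mul, zero_add, one_mul]
    simp only [hg.map_prod hφ.map_one]

/-- Schwinger–Dyson equation for a free Poisson member of a `*`-free family. -/
theorem IsFreePoisson.schwingerDyson [DecidableEq J] {φ : 𝒜 →ₗ[ℂ] ℂ}
    (hφ : IsTracialState φ) {c : ℝ} {x : J → 𝒜} (hx : IsStarFree φ x) {j : J}
    (hw : IsFreePoisson φ c (x j)) (ε : Bool) (A : List (J × Bool)) :
    φ (evalMonomial x ((j, ε) :: A)) = c * φ (evalMonomial x A) +
      ((splits (fun y => decide (y.1 = j)) A).map fun p =>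
        φ (evalMonomial x ((j, ε) :: p.1)) * φ (evalMonomial x p.2)).sum := by
  have hv : ∀ b : Bool, (if b then star (x j) else x j) = x j := by
    intro b
    rw [hw.1, ite_self]
  have h := schwingerDyson_of_free (v := if ε then star (x j) else x j)
    (t := if ε then star (x j) else x j) hφ.map_one
    hφ.tracial hx (letter_mem_adjoin x) (m := fun y => decide (y.1 = j)) (j₀ := j)
    (fun i b hij => by simp [hij]) (letter_mem_adjoin x (j, ε)) (letter_mem_adjoin x (j, ε)) c ?_ A
  · simpa [evalMonomial] using h
  · intro L
    simp only [hv, decide_true]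
    rw [sum_splits]
    simp only [List.map_const', List.prod_replicate, ← pow_succ', hw.map_pow hφ.map_one,
      List.length_take, List.length_drop]
    -- A cut at position `i` leaves `i + 1` letters on the left, counting the prefixed one, and `n -
    -- 1 - i` on the right; the recursion indexes by the right size, hence the reversal.
    rw [narayana_succ, ← Equiv.sum_comp Fin.revPerm]
    congr 1
    refine Finset.sum_congr rfl fun i _ => ?_
    have hi := i.2
    simp only [if_true, Fin.revPerm_apply, Fin.val_rev]
    congr 2
    omega

/-- The `*`-moments of a free family of Haar unitaries. -/
theorem map_haar_word {I : Type*} [DecidableEq I] {φ : 𝒜 →ₗ[ℂ] ℂ} (hφ : φ 1 = 1) {u : I → 𝒜}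
    (hu : ∀ i, IsHaarUnitary φ (u i)) (hfree : IsStarFree φ u) (L : List (I × Bool)) :
    φ (L.map fun p => if p.2 then u p.1 else star (u p.1)).prod =
      if FreeGroup.mk L = 1 then 1 else 0 := by
  let U : I → 𝒜ˣ := fun i => ⟨u i, star (u i), (hu i).2.1, (hu i).1⟩
  have hlift : ∀ L : List (I × Bool), (L.map fun p => if p.2 then u p.1 else star (u p.1)).prod =
      ((FreeGroup.lift U (FreeGroup.mk L) : 𝒜ˣ) : 𝒜) := by
    intro L
    rw [FreeGroup.lift_mk, ← Units.coeHom_apply, map_list_prod, List.map_map]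
    congr 2
    funext p
    rcases p with ⟨i, _ | _⟩ <;> simp [U]
  -- Runs of letters with the same index in a reduced word have a constant exponent, so they collect
  -- to positive powers of a Haar unitary or of its adjoint. These powers are centered, and
  -- consecutive runs have different indices.
  have hred : ∀ (x : I × Bool) (L : List (I × Bool)), FreeGroup.IsReduced (x :: L) →
      ∃ k l, IsAlternating φ (fun j => (StarAlgebra.adjoin ℂ {u j}).toSubalgebra)
        ((x.1, (if x.2 then u x.1 else star (u x.1)) ^ (k + 1)) :: l) ∧
        ((x :: L).map fun p => if p.2 then u p.1 else star (u p.1)).prod =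
          (if x.2 then u x.1 else star (u x.1)) ^ (k + 1) * (l.map Prod.snd).prod := by
    intro x L
    have hmem : ∀ (x : I × Bool) (k : ℕ),
        (if x.2 then u x.1 else star (u x.1)) ^ (k + 1) ∈
          (StarAlgebra.adjoin ℂ {u x.1}).toSubalgebra ∧
        φ ((if x.2 then u x.1 else star (u x.1)) ^ (k + 1)) = 0 := by
      intro x k
      constructor
      · have := letter_mem_adjoin u (x.1, !x.2)
        refine pow_mem ?_ _
        rcases x with ⟨i, _ | _⟩ <;> exact this
      · rcases x with ⟨i, _ | _⟩
        · simpa using ((hu i).2.2 (k + 1) (by simp)).2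
        · simpa using ((hu i).2.2 (k + 1) (by simp)).1
    induction L generalizing x with
    | nil =>
      intro _
      refine ⟨0, [], ⟨by simp, ?_⟩, by simp⟩
      intro p hp
      obtain rfl := List.mem_singleton.1 hp
      exact hmem x 0
    | cons y L ih =>
      intro h
      have h' := List.isChain_cons_cons.1 h
      obtain ⟨k, l, hl, hprod⟩ := ih y h'.2
      rw [List.map_cons, List.prod_cons, hprod]
      by_cases hxy : x.1 = y.1
      · obtain rfl : x = y := Prod.ext hxy (h'.1 hxy)
        refine ⟨k + 1, l, ⟨?_, ?_⟩, by rw [pow_succ' _ (k + 1), mul_assoc]⟩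
        · exact List.isChain_cons.2 (List.isChain_cons.1 hl.1)
        · intro p hp
          rcases List.mem_cons.1 hp with rfl | hp
          · exact hmem x (k + 1)
          · exact hl.2 p (List.mem_cons_of_mem _ hp)
      · refine ⟨0, _ :: l, ⟨List.IsChain.cons_cons hxy hl.1, ?_⟩, by simp⟩
        intro p hp
        rcases List.mem_cons.1 hp with rfl | hp
        · exact hmem x 0
        · exact hl.2 p hp
  rw [hlift, ← FreeGroup.reduce.self, ← hlift]
  have hr : FreeGroup.IsReduced (FreeGroup.reduce L) := by
    rw [← FreeGroup.toWord_mk]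
    exact FreeGroup.isReduced_toWord
  have hone : FreeGroup.mk L = 1 ↔ FreeGroup.reduce L = [] := by
    rw [← FreeGroup.toWord_eq_nil_iff, FreeGroup.toWord_mk]
  rw [FreeGroup.reduce.self]
  generalize FreeGroup.reduce L = L' at hr hone
  rcases L' with _ | ⟨x, L'⟩
  · rw [if_pos (hone.2 rfl)]
    simpa using hφ
  · rw [if_neg (by rw [hone]; simp)]
    obtain ⟨k, l, hl, hprod⟩ := hred x L' hr
    rw [hprod]
    simpa using IsFreeFamily.map_prod hfree hl (by simp)

end Free

/-! ### Fixed points of words in random permutations -/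

/-- A uniform permutation takes `e` prescribed values with probability at most `(N - e)!/N!`, and
`2e ≤ N` turns this into `(2/N)^e`. -/
theorem card_perm_agree_le {N : ℕ} (E : Finset (Fin N × Fin N)) (hE : 2 * E.card ≤ N) :
    (Finset.univ.filter fun π : Equiv.Perm (Fin N) => ∀ e ∈ E, π e.1 = e.2).card * N ^ E.card ≤
      N.factorial * 2 ^ E.card := by
  set S := Finset.univ.filter fun π : Equiv.Perm (Fin N) => ∀ e ∈ E, π e.1 = e.2 with hS
  rcases S.eq_empty_or_nonempty with h0 | ⟨π₀, hπ₀⟩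
  · rw [h0]
    simp
  have hπ₀' : ∀ e ∈ E, π₀ e.1 = e.2 := by simpa [hS] using hπ₀
  set A := E.image Prod.fst with hA
  have hAcard : A.card = E.card := by
    refine Finset.card_image_of_injOn fun e he e' he' h => Prod.ext h ?_
    rw [← hπ₀' e he, ← hπ₀' e' he', h]
  have h1 : S.card ≤ (N - E.card).factorial := by
    -- Relative to one solution `π₀`, every other solution fixes `A` pointwise and is therefore a
    -- permutation of its complement.
    let F : S → {f : Equiv.Perm (Fin N) // ∀ a, ¬ (a ∉ A) → f a = a} := fun π =>
      ⟨π₀⁻¹ * π.1, fun a ha => by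
        obtain ⟨e, he, rfl⟩ := Finset.mem_image.1 (not_not.1 ha)
        have : π.1 e.1 = e.2 := (Finset.mem_filter.1 π.2).2 e he
        rw [Equiv.Perm.mul_apply, this, Equiv.Perm.inv_eq_iff_eq, hπ₀' e he]⟩
    have hF : Function.Injective F := by
      intro π π' h
      have := congrArg Subtype.val h
      exact Subtype.ext (mul_left_cancel this)
    have h2 := Fintype.card_le_of_injective F hF
    rw [Fintype.card_coe, ← Fintype.card_congr (Equiv.Perm.subtypeEquivSubtypePerm (· ∉ A)),
      Fintype.card_perm, Fintype.card_subtype_compl] at h2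
    simpa [hAcard] using h2
  have h3 : N ^ E.card ≤ 2 ^ E.card * N.descFactorial E.card := by
    calc N ^ E.card ≤ (2 * (N + 1 - E.card)) ^ E.card := Nat.pow_le_pow_left (by omega) _
      _ = 2 ^ E.card * (N + 1 - E.card) ^ E.card := mul_pow _ _ _
      _ ≤ _ := Nat.mul_le_mul_left _ (Nat.pow_sub_le_descFactorial _ _)
  calc S.card * N ^ E.card
      ≤ (N - E.card).factorial * (2 ^ E.card * N.descFactorial E.card) :=
        Nat.mul_le_mul h1 h3
    _ = ((N - E.card).factorial * N.descFactorial E.card) * 2 ^ E.card := by ring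
    _ = _ := by rw [Nat.factorial_mul_descFactorial (by omega)]

/-! ### Counting labelled closed paths and their constraints on permutations. -/

section Patterns

variable {K I : Type*}

/-- The permutation `π` if `b` is true, its inverse otherwise. -/
def permStep {N : ℕ} (π : Equiv.Perm (Fin N)) (b : Bool) : Equiv.Perm (Fin N) :=
  if b then π else π⁻¹

/-- The edge, labelled by an index, which the constraint at position `k` prescribes. -/
def patternEdge {N : ℕ} (next : Equiv.Perm K) (r : K → I) (b : K → Bool) (p : K → Fin N) (k : K) :
    I × (Fin N × Fin N) :=
  (r k, if b k then (p (next k), p k) else (p k, p (next k)))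

theorem permStep_eq_iff {N : ℕ} (next : Equiv.Perm K) (r : K → I) (b : K → Bool) (p : K → Fin N)
    (k : K) (σ : I → Equiv.Perm (Fin N)) : permStep (σ (r k)) (b k) (p (next k)) = p k ↔
      σ (patternEdge next r b p k).1 (patternEdge next r b p k).2.1 =
        (patternEdge next r b p k).2.2 := by
  rcases hb : b k with _ | _
  · simp only [permStep, patternEdge, hb, Bool.false_eq_true, if_false]
    rw [Equiv.Perm.inv_eq_iff_eq, eq_comm]
  · simp [permStep, patternEdge, hb]

/-- For a reduced pattern there are at least as many edges as vertices, as every vertex has two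
half-edges. -/
theorem card_image_le_card_edges [Fintype K] [DecidableEq I] {N : ℕ} (next : Equiv.Perm K) (r : K → I) (b : K → Bool)
    (hred : ∀ k, r k = r (next k) → b k = b (next k)) (p : K → Fin N) :
    (Finset.univ.image p).card ≤ (Finset.univ.image (patternEdge next r b p)).card := by
  set E := Finset.univ.image (patternEdge next r b p) with hE
  let half : (I × (Fin N × Fin N)) × Bool → Fin N × I × Bool := fun e =>
    (if e.2 then e.1.2.1 else e.1.2.2, e.1.1, e.2)
  set H := (E ×ˢ (Finset.univ : Finset Bool)).image half with hH
  have hH1 : H.card ≤ 2 * E.card := by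
    refine Finset.card_image_le.trans ?_
    rw [Finset.card_product, Finset.card_univ, Fintype.card_bool, mul_comm]
  have hmem1 : ∀ k, (p (next k), r k, b k) ∈ H := by
    intro k
    refine Finset.mem_image.2 ⟨(patternEdge next r b p k, b k), by simp [hE], ?_⟩
    rcases hb : b k with _ | _ <;> simp [half, patternEdge, hb]
  have hmem2 : ∀ k, (p k, r k, !b k) ∈ H := by
    intro k
    refine Finset.mem_image.2 ⟨(patternEdge next r b p k, !b k), by simp [hE], ?_⟩
    rcases hb : b k with _ | _ <;> simp [half, patternEdge, hb]
  have hex : ∀ v : (Finset.univ.image p), ∃ k, p (next k) = v := by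
    rintro ⟨v, hv⟩
    obtain ⟨k, _, rfl⟩ := Finset.mem_image.1 hv
    exact ⟨next.symm k, by simp⟩
  choose κ hκ using hex
  -- At a vertex visited after step `k`, one half-edge comes from step `k` and one from step `next
  -- k`. If they coincided, the two steps would have the same label and opposite exponents, contrary
  -- to `hred`.
  let F : (Finset.univ.image p) × Bool → H := fun x =>
    if x.2 then ⟨_, hmem1 (κ x.1)⟩ else ⟨_, hmem2 (next (κ x.1))⟩
  have hfst : ∀ x, (F x).1.1 = x.1.1 := by
    rintro ⟨v, _ | _⟩ <;> simp [F, hκ]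
  have hF : Function.Injective F := by
    rintro ⟨v, c⟩ ⟨v', c'⟩ h
    have hv : v = v' := Subtype.ext (by rw [← hfst (v, c), ← hfst (v', c'), h])
    subst hv
    have hne : F (v, true) ≠ F (v, false) := by
      intro h
      have h' := congrArg Subtype.val h
      simp only [F, if_true, Bool.false_eq_true, if_false, Prod.mk.injEq] at h'
      have := hred _ h'.2.1
      rw [this] at h'
      simp at h'
    rcases c with _ | _ <;> rcases c' with _ | _
    · rfl
    · exact absurd h.symm hne
    · exact absurd h hne
    · rfl
  have h2 := Fintype.card_le_of_injective F hF
  rw [Fintype.card_prod, Fintype.card_coe, Fintype.card_coe, Fintype.card_bool] at h2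
  omega

/-- The edges with label `i` constrain only `σ i`, so the count is a product over `i` of counts
bounded by `card_perm_agree_le`. -/
theorem card_perm_pattern_le [Fintype K] [Fintype I] [DecidableEq I] {N : ℕ} (hN : 2 * Fintype.card K ≤ N) (hN0 : 0 < N)
    (E : Finset (I × (Fin N × Fin N))) (hE : E.card ≤ Fintype.card K) :
    ((Finset.univ.filter fun σ : I → Equiv.Perm (Fin N) => ∀ e ∈ E, σ e.1 e.2.1 = e.2.2).card : ℝ) ≤
      (N.factorial : ℝ) ^ Fintype.card I * (2 / N) ^ E.card := by
  let Er : I → Finset (Fin N × Fin N) := fun i => (E.filter fun e => e.1 = i).image Prod.snd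
  have hEr : ∀ i, (Er i).card = (E.filter fun e => e.1 = i).card := fun i =>
    Finset.card_image_of_injOn fun e he e' he' h => by
      simp only [Finset.coe_filter, Set.mem_ofPred_eq] at he he'
      exact Prod.ext (he.2.trans he'.2.symm) h
  have hsum : ∑ i, (Er i).card = E.card := by
    simp only [hEr]
    exact (Finset.card_eq_sum_card_fiberwise fun e _ => Finset.mem_univ _).symm
  have hset : (Finset.univ.filter fun σ : I → Equiv.Perm (Fin N) =>
      ∀ e ∈ E, σ e.1 e.2.1 = e.2.2) = Fintype.piFinset fun i =>
        Finset.univ.filter fun π : Equiv.Perm (Fin N) => ∀ e ∈ Er i, π e.1 = e.2 := by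
    ext σ
    simp only [Finset.mem_filter, Finset.mem_univ, true_and, Fintype.mem_piFinset, Er,
      Finset.mem_image]
    constructor
    · rintro h i _ ⟨e, ⟨he, rfl⟩, rfl⟩
      exact h e he
    · exact fun h e he => h e.1 e.2 ⟨e, ⟨he, rfl⟩, rfl⟩
  rw [hset, Fintype.card_piFinset, Nat.cast_prod, ← hsum, ← Finset.prod_pow_eq_pow_sum,
    ← Finset.card_univ, ← Finset.prod_const, ← Finset.prod_mul_distrib]
  refine Finset.prod_le_prod (fun _ _ => Nat.cast_nonneg _) fun i _ => ?_
  have hle : (Er i).card ≤ E.card := by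
    rw [hEr]
    exact Finset.card_filter_le _ _
  have h := card_perm_agree_le (Er i) (by omega)
  rw [div_pow, mul_div_assoc', le_div_iff₀ (by positivity)]
  exact_mod_cast h

/-- The coincidences of `p` are encoded by a self-map `ρ` of `K` that selects one representative of
each fibre. Since `p` is determined on the range of `ρ`, at most `N ^ |range ρ|` functions share
this code, which cancels the powers of `N` in their weight. -/
theorem sum_pow_card_image_le [Fintype K] [DecidableEq K] {N : ℕ} (hN0 : 0 < N) :
    ∑ p : K → Fin N, ((2 : ℝ) / N) ^ (Finset.univ.image p).card ≤
      Fintype.card (K → K) * 2 ^ Fintype.card K := by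
  have hex : ∀ p : K → Fin N, ∃ π : K → K, p ∘ π = p ∧
      (Finset.univ.image π).card = (Finset.univ.image p).card := by
    intro p
    have h1 : ∀ v : Set.range p, ∃ k, p k = v := fun v => v.2
    choose t ht using h1
    refine ⟨fun k => t ⟨p k, k, rfl⟩, funext fun k => ht _, ?_⟩
    have h2 : Finset.univ.image p = (Finset.univ.image fun k => t ⟨p k, k, rfl⟩).image p := by
      rw [Finset.image_image]
      congr 1
      exact (funext fun k => ht ⟨p k, k, rfl⟩).symm
    rw [h2]
    refine (Finset.card_image_of_injOn ?_).symm
    intro a ha a' ha' h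
    obtain ⟨k, _, rfl⟩ := Finset.mem_image.1 ha
    obtain ⟨k', _, rfl⟩ := Finset.mem_image.1 ha'
    simp only [ht] at h
    simp only [h]
  choose π hπ1 hπ2 using hex
  have hcount : ∀ ρ : K → K, ((Finset.univ.filter fun p : K → Fin N => p ∘ ρ = p).card : ℝ) ≤
      (N : ℝ) ^ (Finset.univ.image ρ).card := by
    intro ρ
    have h1 := Finset.card_le_card_of_injOn
      (s := Finset.univ.filter fun p : K → Fin N => p ∘ ρ = p)
      (t := (Finset.univ : Finset ((Finset.univ.image ρ) → Fin N)))
      (fun p k => p k.1) (fun _ _ => Finset.mem_coe.2 (Finset.mem_univ _)) (by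
        intro p hp p' hp' h
        simp only [Finset.coe_filter, Finset.mem_univ, true_and, Set.mem_ofPred_eq] at hp hp'
        funext k
        rw [← hp, ← hp']
        exact congrFun h ⟨ρ k, by simp⟩)
    rw [Finset.card_univ, Fintype.card_fun, Fintype.card_coe, Fintype.card_fin] at h1
    exact_mod_cast h1
  calc ∑ p : K → Fin N, ((2 : ℝ) / N) ^ (Finset.univ.image p).card
      = ∑ ρ : K → K, ∑ p ∈ Finset.univ.filter (fun p : K → Fin N => π p = ρ),
          ((2 : ℝ) / N) ^ (Finset.univ.image p).card :=
        (Finset.sum_fiberwise _ _ _).symm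
    _ ≤ ∑ ρ : K → K, (2 : ℝ) ^ Fintype.card K := by
        refine Finset.sum_le_sum fun ρ _ => ?_
        have h1 : ∀ p ∈ Finset.univ.filter (fun p : K → Fin N => π p = ρ),
            ((2 : ℝ) / N) ^ (Finset.univ.image p).card =
              ((2 : ℝ) / N) ^ (Finset.univ.image ρ).card := by
          intro p hp
          rw [← (Finset.mem_filter.1 hp).2, hπ2]
        rw [Finset.sum_congr rfl h1, Finset.sum_const, nsmul_eq_mul]
        have h2 : ((Finset.univ.filter fun p : K → Fin N => π p = ρ).card : ℝ) ≤
            (N : ℝ) ^ (Finset.univ.image ρ).card := by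
          refine le_trans ?_ (hcount ρ)
          norm_cast
          refine Finset.card_le_card fun p hp => ?_
          simp only [Finset.mem_filter, Finset.mem_univ, true_and] at hp ⊢
          rw [← hp, hπ1]
        calc _ ≤ (N : ℝ) ^ (Finset.univ.image ρ).card *
              ((2 : ℝ) / N) ^ (Finset.univ.image ρ).card := by gcongr
          _ = 2 ^ (Finset.univ.image ρ).card := by
              rw [← mul_pow]
              congr 1
              field_simp
          _ ≤ 2 ^ Fintype.card K := pow_le_pow_right₀ (by norm_num) Finset.card_image_le
    _ = _ := by simp

/-- The number of solutions of a reduced pattern in random permutations has bounded mean. -/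
theorem sum_card_pattern_le [Fintype K] [DecidableEq K] [Fintype I] [DecidableEq I] {N : ℕ} (hN : 2 * Fintype.card K ≤ N) (hN0 : 2 ≤ N)
    (next : Equiv.Perm K) (r : K → I) (b : K → Bool)
    (hred : ∀ k, r k = r (next k) → b k = b (next k)) :
    ∑ σ : I → Equiv.Perm (Fin N), ((Finset.univ.filter fun p : K → Fin N =>
      ∀ k, permStep (σ (r k)) (b k) (p (next k)) = p k).card : ℝ) ≤
      (N.factorial : ℝ) ^ Fintype.card I * (Fintype.card (K → K) * 2 ^ Fintype.card K) := by
  have h2N : (2 : ℝ) / N ≤ 1 := by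
    rw [div_le_one (by positivity)]
    exact_mod_cast hN0
  have hswap : ∑ σ : I → Equiv.Perm (Fin N), ((Finset.univ.filter fun p : K → Fin N =>
      ∀ k, permStep (σ (r k)) (b k) (p (next k)) = p k).card : ℝ) =
      ∑ p : K → Fin N, ((Finset.univ.filter fun σ : I → Equiv.Perm (Fin N) =>
        ∀ k, permStep (σ (r k)) (b k) (p (next k)) = p k).card : ℝ) := by
    simp only [Finset.card_filter, Nat.cast_sum]
    exact Finset.sum_comm
  rw [hswap]
  calc _ ≤ ∑ p : K → Fin N, (N.factorial : ℝ) ^ Fintype.card I *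
        (2 / N) ^ (Finset.univ.image p).card := by
        refine Finset.sum_le_sum fun p _ => ?_
        have h1 := card_perm_pattern_le hN (by omega) (Finset.univ.image (patternEdge next r b p))
          Finset.card_image_le
        have h2 : (Finset.univ.filter fun σ : I → Equiv.Perm (Fin N) =>
            ∀ k, permStep (σ (r k)) (b k) (p (next k)) = p k) =
            Finset.univ.filter fun σ : I → Equiv.Perm (Fin N) =>
              ∀ e ∈ Finset.univ.image (patternEdge next r b p), σ e.1 e.2.1 = e.2.2 := by
          ext σ
          simp [permStep_eq_iff]
        rw [h2]
        refine h1.trans ?_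
        gcongr ?_ * ?_
        -- Passing from edges to vertices loses nothing: there are at least as many edges, and `2/N
        -- ≤ 1`.
        exact pow_le_pow_of_le_one (by positivity) h2N
          (card_image_le_card_edges next r b hred p)
    _ ≤ _ := by
        rw [← Finset.mul_sum]
        gcongr
        exact sum_pow_card_image_le (by omega)

end Patterns

/-- The number of fixed points of a permutation. -/
def fixCount {N : ℕ} (π : Equiv.Perm (Fin N)) : ℕ := (Finset.univ.filter fun i => π i = i).card

theorem fixCount_conj {N : ℕ} (π ρ : Equiv.Perm (Fin N)) :
    fixCount (ρ * π * ρ⁻¹) = fixCount π := by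
  refine Finset.card_equiv ρ⁻¹ fun i => ?_
  rw [Finset.mem_filter, Finset.mem_filter]
  simp only [Finset.mem_univ, true_and, Equiv.Perm.mul_apply]
  rw [Equiv.Perm.eq_inv_iff_eq]

theorem list_prod_permStep_drop {I : Type*} {N : ℕ} (σ : I → Equiv.Perm (Fin N))
    (L : List (I × Bool)) (k : ℕ) (hk : k < L.length) (i : Fin N) :
    permStep (σ L[k].1) L[k].2 (((L.drop (k + 1)).map fun x => permStep (σ x.1) x.2).prod i) =
      ((L.drop k).map fun x => permStep (σ x.1) x.2).prod i := by
  rw [List.drop_eq_getElem_cons hk, List.map_cons, List.prod_cons, Equiv.Perm.mul_apply]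

/-- A fixed point follows a closed path through the suffixes of the word, and the path at time `0`
recovers it. A pair of fixed points thus solves a pattern on two disjoint copies of the cyclic word,
and the first-moment bound for patterns becomes a second-moment bound. -/
theorem fixCount_sq_le {I : Type*} {N : ℕ} (σ : I → Equiv.Perm (Fin N)) (n : ℕ)
    (L : List (I × Bool)) (hn : L.length = n + 1) :
    fixCount (L.map fun x => permStep (σ x.1) x.2).prod ^ 2 ≤
      (Finset.univ.filter fun p : Fin (n + 1) ⊕ Fin (n + 1) → Fin N => ∀ k,
        permStep (σ (Sum.elim (fun k : Fin (n + 1) => L[k].1) (fun k : Fin (n + 1) => L[k].1) k))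
          (Sum.elim (fun k : Fin (n + 1) => L[k].2) (fun k : Fin (n + 1) => L[k].2) k)
          (p (Equiv.Perm.sumCongr (finRotate (n + 1)) (finRotate (n + 1)) k)) = p k).card := by
  set π := (L.map fun x => permStep (σ x.1) x.2).prod with hπ
  let path : Fin N → Fin (n + 1) → Fin N := fun i k =>
    ((L.drop k).map fun x => permStep (σ x.1) x.2).prod i
  have hpath : ∀ i, π i = i → ∀ k : Fin (n + 1),
      permStep (σ L[k].1) L[k].2 (path i (finRotate (n + 1) k)) = path i k := by
    intro i hi k
    have h1 := list_prod_permStep_drop σ L k (by omega) i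
    refine Eq.trans ?_ h1
    simp only [path, val_finRotate_apply, Fin.getElem_fin]
    congr 1
    split_ifs with hk
    · rw [hk, ← hn, List.drop_length, List.drop_zero]
      exact hi
    · rfl
  have h0 : ∀ i, π i = i → path i 0 = i := by
    intro i hi
    simpa [path] using hi
  rw [fixCount, sq, ← Finset.card_product]
  refine Finset.card_le_card_of_injOn (fun x => Sum.elim (path x.1) (path x.2)) ?_ ?_
  · rintro ⟨i, i'⟩ hx
    simp only [Finset.coe_product, Finset.coe_filter, Finset.mem_univ, true_and, Set.mem_prod,
      Set.mem_ofPred_eq] at hx ⊢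
    rintro (k | k)
    · simpa using hpath i hx.1 k
    · simpa using hpath i' hx.2 k
  · rintro ⟨i, i'⟩ hx ⟨j, j'⟩ hy h
    simp only [Finset.coe_product, Finset.coe_filter, Finset.mem_univ, true_and, Set.mem_prod,
      Set.mem_ofPred_eq] at hx hy h
    have e1 := congrFun h (Sum.inl 0)
    have e2 := congrFun h (Sum.inr 0)
    simp only [Sum.elim_inl, Sum.elim_inr, h0 _ hx.1, h0 _ hx.2, h0 _ hy.1, h0 _ hy.2] at e1 e2
    rw [e1, e2]

/-- The number of fixed points of a non-trivial word in independent uniform random permutations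
has bounded second moment. -/
theorem exists_sum_fixCount_sq_le {I : Type*} [Fintype I] [DecidableEq I] {w : FreeGroup I}
    (hw : w ≠ 1) : ∃ C : ℝ, ∃ N₀ : ℕ, ∀ N ≥ N₀,
      ∑ σ : I → Equiv.Perm (Fin N), (fixCount (FreeGroup.lift σ w) : ℝ) ^ 2 ≤
        (N.factorial : ℝ) ^ Fintype.card I * C := by
  classical
  set L := FreeGroup.reduceCyclically w.toWord with hL
  set c := FreeGroup.mk (FreeGroup.reduceCyclically.conjugator w.toWord) with hc
  have hconj : w = c * FreeGroup.mk L * c⁻¹ := by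
    rw [hc, hL, FreeGroup.inv_mk, FreeGroup.mul_mk, FreeGroup.mul_mk,
      FreeGroup.reduceCyclically.conj_conjugator_reduceCyclically, FreeGroup.mk_toWord]
  have hne : L ≠ [] := by
    intro h
    apply hw
    rw [hconj, h]
    change c * 1 * c⁻¹ = 1
    simp
  have hcyc : FreeGroup.IsCyclicallyReduced L :=
    FreeGroup.reduceCyclically.isCyclicallyReduced FreeGroup.isReduced_toWord
  obtain ⟨n, hn⟩ : ∃ n, L.length = n + 1 :=
    ⟨L.length - 1, by have := List.length_pos_iff.2 hne; omega⟩
  let K := Fin (n + 1) ⊕ Fin (n + 1)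
  refine ⟨Fintype.card (K → K) * 2 ^ Fintype.card K, 2 * Fintype.card K + 2, fun N hN => ?_⟩
  have hred : ∀ k : Fin (n + 1), L[k].1 = L[finRotate (n + 1) k].1 →
      L[k].2 = L[finRotate (n + 1) k].2 := by
    intro k
    by_cases hk : (k : ℕ) = n
    · have h1 := hcyc.2 L[k] (by
        rw [List.getLast?_eq_getElem?]
        simp [hk, hn]) L[finRotate (n + 1) k] (by
        have h2 : ((finRotate (n + 1) k : Fin (n + 1)) : ℕ) = 0 := by
          rw [val_finRotate_apply, if_pos hk]
        simp only [List.head?_eq_getElem?, Fin.getElem_fin, h2]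
        simp [hn])
      exact h1
    · have h1 := List.isChain_iff_getElem.1 hcyc.1 k (by omega)
      have h2 : L[finRotate (n + 1) k] = L[(k : ℕ) + 1] := by
        simp only [Fin.getElem_fin]
        congr 1
        rw [val_finRotate_apply, if_neg hk]
      rw [h2]
      exact h1
  refine le_trans ?_ (sum_card_pattern_le (K := K) (N := N) (by omega) (by omega)
    (Equiv.Perm.sumCongr (finRotate (n + 1)) (finRotate (n + 1)))
    (Sum.elim (fun k : Fin (n + 1) => L[k].1) (fun k : Fin (n + 1) => L[k].1))
    (Sum.elim (fun k : Fin (n + 1) => L[k].2) (fun k : Fin (n + 1) => L[k].2))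
    (by rintro (k | k) <;> exact hred k))
  refine Finset.sum_le_sum fun σ _ => ?_
  have h1 : fixCount (FreeGroup.lift σ w) =
      fixCount (L.map fun x => permStep (σ x.1) x.2).prod := by
    rw [hconj, map_mul, map_mul, map_inv, fixCount_conj, FreeGroup.lift_mk]
    congr 3
    funext x
    rcases x with ⟨i, _ | _⟩ <;> simp [permStep]
  rw [h1]
  exact_mod_cast fixCount_sq_le σ n L hn

/-! ### Gaussian integration by parts -/

open scoped ENNReal NNReal in
/-- Functions with finite moments of all orders. -/
def HasAllMoments {Ω : Type*} [MeasurableSpace Ω] (P : Measure Ω) (f : Ω → ℂ) : Prop :=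
  ∀ r : ℝ≥0∞, r ≠ ∞ → MemLp f r P

section Moments

variable {Ω : Type*} [MeasurableSpace Ω] {P : Measure Ω}

theorem HasAllMoments.mul {f g : Ω → ℂ} (hf : HasAllMoments P f) (hg : HasAllMoments P g) :
    HasAllMoments P fun ω => f ω * g ω := by
  intro r hr
  have : ENNReal.HolderTriple (2 * r) (2 * r) r := ⟨by
    rw [ENNReal.mul_inv (Or.inl two_ne_zero) (Or.inl ENNReal.ofNat_ne_top), ← add_mul,
      ENNReal.inv_two_add_inv_two, one_mul]⟩
  have h2 : 2 * r ≠ ⊤ := ENNReal.mul_ne_top ENNReal.ofNat_ne_top hr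
  exact MemLp.mul' (hg _ h2) (hf _ h2)

theorem HasAllMoments.add {f g : Ω → ℂ} (hf : HasAllMoments P f) (hg : HasAllMoments P g) :
    HasAllMoments P fun ω => f ω + g ω := fun r hr => (hf r hr).add (hg r hr)

theorem hasAllMoments_const [IsFiniteMeasure P] (c : ℂ) : HasAllMoments P fun _ => c :=
  fun _ _ => memLp_const c

theorem HasAllMoments.integrable {f : Ω → ℂ} (hf : HasAllMoments P f) : Integrable f P :=
  memLp_one_iff_integrable.1 (hf 1 ENNReal.one_ne_top)

theorem HasAllMoments.sum {ι : Type*} (s : Finset ι) {f : ι → Ω → ℂ}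
    (hf : ∀ i ∈ s, HasAllMoments P (f i)) : HasAllMoments P fun ω => ∑ i ∈ s, f i ω :=
  fun r hr => memLp_finsetSum s fun i hi => hf i hi r hr

end Moments

/-- The moments of the centered Gaussian law of variance `1 / 2`. -/
noncomputable def gaussMoment (k : ℕ) : ℝ := ∫ x, x ^ k ∂gaussianReal 0 (1 / 2)

theorem gaussianPDFReal_half : gaussianPDFReal 0 (1 / 2) =
    fun x => (Real.sqrt Real.pi)⁻¹ * Real.exp (-1 * x ^ 2) := by
  funext x
  have h : (((1 / 2 : NNReal)) : ℝ) = 1 / 2 := by simp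
  have h1 : 2 * Real.pi * (((1 / 2 : NNReal)) : ℝ) = Real.pi := by rw [h]; ring
  have h2 : -(x - 0) ^ 2 / (2 * (((1 / 2 : NNReal)) : ℝ)) = -1 * x ^ 2 := by rw [h]; ring
  rw [gaussianPDFReal, h1, h2]

theorem integrable_pow_mul_gaussianPDFReal (k : ℕ) :
    Integrable fun x : ℝ => x ^ k * gaussianPDFReal 0 (1 / 2) x := by
  have h := integrable_rpow_mul_exp_neg_mul_sq (b := 1) one_pos (s := k)
    (by have : (0 : ℝ) ≤ k := Nat.cast_nonneg k; linarith)
  rw [gaussianPDFReal_half]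
  refine (h.const_mul (Real.sqrt Real.pi)⁻¹).congr (ae_of_all _ fun x => ?_)
  simp only [Real.rpow_natCast]
  ring

theorem gaussMoment_eq (k : ℕ) : gaussMoment k = ∫ x, x ^ k * gaussianPDFReal 0 (1 / 2) x := by
  rw [gaussMoment, integral_gaussianReal_eq_integral_smul (by norm_num)]
  simp [mul_comm]

/-- Integration by parts: the density of variance `1/2` has derivative `-2x` times itself. For `k =
0` the truncated `k - 1` is harmless because its coefficient vanishes. -/
theorem gaussMoment_succ (k : ℕ) : gaussMoment (k + 1) = k / 2 * gaussMoment (k - 1) := by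
  have hderiv : ∀ x : ℝ, HasDerivAt (gaussianPDFReal 0 (1 / 2))
      (-2 * x * gaussianPDFReal 0 (1 / 2) x) x := by
    intro x
    rw [gaussianPDFReal_half]
    have h1 : HasDerivAt (fun x : ℝ => -1 * x ^ 2) (-1 * (2 * x)) x := by
      simpa using (hasDerivAt_pow 2 x).const_mul (-1)
    have h2 := (h1.exp).const_mul (Real.sqrt Real.pi)⁻¹
    convert! h2 using 1
    ring
  have h := integral_mul_deriv_eq_deriv_mul_of_integrable (A := ℝ)
    (u := fun x : ℝ => x ^ k) (u' := fun x => k * x ^ (k - 1)) (v := gaussianPDFReal 0 (1 / 2))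
    (v' := fun x => -2 * x * gaussianPDFReal 0 (1 / 2) x)
    (fun x _ => hasDerivAt_pow k x) (fun x _ => hderiv x)
    (((integrable_pow_mul_gaussianPDFReal (k + 1)).const_mul (-2)).congr
      (ae_of_all _ fun x => by simp only [Pi.mul_apply]; ring))
    (((integrable_pow_mul_gaussianPDFReal (k - 1)).const_mul k).congr
      (ae_of_all _ fun x => by simp only [Pi.mul_apply]; ring))
    (integrable_pow_mul_gaussianPDFReal k)
  have h1 : ∀ x : ℝ, x ^ k * (-2 * x * gaussianPDFReal 0 (1 / 2) x) =
      -2 * (x ^ (k + 1) * gaussianPDFReal 0 (1 / 2) x) := fun x => by ring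
  have h2 : ∀ x : ℝ, k * x ^ (k - 1) * gaussianPDFReal 0 (1 / 2) x =
      k * (x ^ (k - 1) * gaussianPDFReal 0 (1 / 2) x) := fun x => by ring
  simp only [h1, h2, integral_const_mul, ← gaussMoment_eq] at h
  linarith

/-! ### Polynomials in independent real Gaussian variables. -/

section Polynomials

variable {Ω : Type*} [MeasurableSpace Ω] {P : Measure Ω} {ι : Type*} {Z : ι → Ω → ℝ}

/-- The value of a polynomial at the random point `Z`. -/
noncomputable def evalAt (Z : ι → Ω → ℝ) (ω : Ω) : MvPolynomial ι ℂ →ₐ[ℂ] ℂ :=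
  MvPolynomial.aeval fun i => (Z i ω : ℂ)

theorem hasAllMoments_evalAt [IsProbabilityMeasure P] (hm : ∀ i, Measurable (Z i))
    (hlaw : ∀ i, P.map (Z i) = gaussianReal 0 (1 / 2)) (p : MvPolynomial ι ℂ) :
    HasAllMoments P fun ω => evalAt Z ω p := by
  induction p using MvPolynomial.induction_on with
  | C a => simpa [evalAt] using hasAllMoments_const a
  | add p q hp hq => simpa using hp.add hq
  | mul_X p i hp =>
    have hZ : HasAllMoments P fun ω => (Z i ω : ℂ) := by
      intro r hr
      have h1 : MemLp id r (P.map (Z i)) := by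
        rw [hlaw]
        exact memLp_id_gaussianReal' r hr
      have h2 : MemLp (Z i) r P := (memLp_map_measure_iff h1.1 (hm i).aemeasurable).1 h1
      exact h2.ofReal
    have := hp.mul hZ
    simpa [evalAt] using this

/-- Independence factorizes the expectation. The index set `T` may exceed the support so that a
monomial and its derivative can be compared over one index set. -/
theorem integral_evalAt_monomial (hm : ∀ i, Measurable (Z i))
    (hlaw : ∀ i, P.map (Z i) = gaussianReal 0 (1 / 2)) (hind : iIndepFun Z P) (m : ι →₀ ℕ)
    (T : Finset ι) (hT : m.support ⊆ T) :
    ∫ ω, evalAt Z ω (MvPolynomial.monomial m 1) ∂P = ∏ i ∈ T, (gaussMoment (m i) : ℂ) := by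
  have h1 : ∀ ω, evalAt Z ω (MvPolynomial.monomial m 1) =
      ((∏ i : T, (Z i ω) ^ m i : ℝ) : ℂ) := by
    intro ω
    rw [evalAt, MvPolynomial.aeval_monomial, map_one, one_mul,
      Finsupp.prod_of_support_subset _ hT _ (fun _ _ => pow_zero _), ← Finset.prod_coe_sort]
    push_cast
    rfl
  simp only [h1]
  rw [integral_complex_ofReal,
    (hind.precomp (g := fun i : T => (i : ι)) Subtype.val_injective).integral_fun_prod_comp
      (f := fun (i : T) (x : ℝ) => x ^ m i) (fun i => (hm i).aemeasurable)
      (fun i => (by fun_prop : Measurable fun x : ℝ => x ^ m i).aestronglyMeasurable)]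
  push_cast
  rw [← Finset.prod_coe_sort T]
  refine Finset.prod_congr rfl fun i _ => ?_
  rw [gaussMoment, ← hlaw i, integral_map (hm i).aemeasurable
    (by fun_prop : Measurable fun x : ℝ => x ^ m i).aestronglyMeasurable]

/-- The expectation of polynomials in the random variables `Z`. -/
noncomputable def polyExp [IsProbabilityMeasure P] (hm : ∀ i, Measurable (Z i))
    (hlaw : ∀ i, P.map (Z i) = gaussianReal 0 (1 / 2)) : MvPolynomial ι ℂ →ₗ[ℂ] ℂ where
  toFun p := ∫ ω, evalAt Z ω p ∂P
  map_add' p q := by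
    simp only [map_add]
    exact integral_add (hasAllMoments_evalAt hm hlaw p).integrable
      (hasAllMoments_evalAt hm hlaw q).integrable
  map_smul' c p := by
    simp only [map_smul, RingHom.id_apply]
    exact integral_smul c _

/-- Integration by parts for polynomials in independent Gaussian variables. -/
theorem polyExp_X_mul [IsProbabilityMeasure P] (hm : ∀ i, Measurable (Z i))
    (hlaw : ∀ i, P.map (Z i) = gaussianReal 0 (1 / 2)) (hind : iIndepFun Z P) (i : ι)
    (p : MvPolynomial ι ℂ) : polyExp hm hlaw (MvPolynomial.X i * p) =
      1 / 2 * polyExp hm hlaw (MvPolynomial.pderiv i p) := by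
  classical
  induction p using MvPolynomial.induction_on' with
  | add p q hp hq => rw [mul_add, map_add, map_add, map_add, hp, hq, mul_add]
  | monomial m a =>
    have hmon : ∀ (m : ι →₀ ℕ) (a : ℂ), polyExp hm hlaw (MvPolynomial.monomial m a) =
        a * polyExp hm hlaw (MvPolynomial.monomial m 1) := by
      intro m a
      rw [← smul_eq_mul, ← map_smul, MvPolynomial.smul_monomial, smul_eq_mul, mul_one]
    have hval : ∀ (m : ι →₀ ℕ) (T : Finset ι), m.support ⊆ T →
        polyExp hm hlaw (MvPolynomial.monomial m 1) = ∏ i ∈ T, (gaussMoment (m i) : ℂ) :=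
      fun m T hT => integral_evalAt_monomial hm hlaw hind m T hT
    rw [MvPolynomial.pderiv_monomial, MvPolynomial.X, MvPolynomial.monomial_mul, one_mul, hmon,
      hmon _ (a * _)]
    set T := insert i m.support
    have hi : i ∈ T := Finset.mem_insert_self _ _
    have hsub1 : (Finsupp.single i 1 + m).support ⊆ T := by
      refine Finsupp.support_add.trans ?_
      exact Finset.union_subset_union Finsupp.support_single_subset subset_rfl
    have hsub2 : (m - Finsupp.single i 1).support ⊆ T :=
      Finsupp.support_tsub.trans (Finset.subset_insert _ _)
    rw [hval _ T hsub1, hval _ T hsub2, ← Finset.mul_prod_erase T _ hi,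
      ← Finset.mul_prod_erase T _ hi]
    have hrest : ∏ x ∈ T.erase i, (gaussMoment ((Finsupp.single i 1 + m : ι →₀ ℕ) x) : ℂ) =
        ∏ x ∈ T.erase i, (gaussMoment ((m - Finsupp.single i 1 : ι →₀ ℕ) x) : ℂ) := by
      refine Finset.prod_congr rfl fun x hx => ?_
      have hx' : i ≠ x := (Finset.ne_of_mem_erase hx).symm
      simp [hx']
    rw [hrest]
    have h1 : (Finsupp.single i 1 + m : ι →₀ ℕ) i = m i + 1 := by simp [add_comm]
    have h2 : (m - Finsupp.single i 1 : ι →₀ ℕ) i = m i - 1 := by simp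
    rw [h1, h2, gaussMoment_succ]
    push_cast
    ring

end Polynomials

/-! ### Complex Gaussian families and Wirtinger derivatives. -/

section ComplexGaussian

variable {Λ : Type*}

/-- The polynomial representing the complex variable with index `l`, or its conjugate. -/
noncomputable def zvar (ε : Bool) (l : Λ) : MvPolynomial (Λ ⊕ Λ) ℂ :=
  MvPolynomial.X (Sum.inl l) +
    (if ε then -Complex.I else Complex.I) • MvPolynomial.X (Sum.inr l)

/-- The Wirtinger derivative dual to `zvar (!ε) l`. -/
noncomputable def wirtinger (ε : Bool) (l : Λ) :
    Derivation ℂ (MvPolynomial (Λ ⊕ Λ) ℂ) (MvPolynomial (Λ ⊕ Λ) ℂ) :=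
  (1 / 2 : ℂ) • (MvPolynomial.pderiv (Sum.inl l) +
    (if ε then -Complex.I else Complex.I) • MvPolynomial.pderiv (Sum.inr l))

theorem wirtinger_zvar [DecidableEq Λ] (ε ε' : Bool) (l l' : Λ) :
    wirtinger ε l (zvar ε' l') = if l = l' ∧ ε ≠ ε' then 1 else 0 := by
  simp only [wirtinger, zvar, Derivation.smul_apply, Derivation.add_apply, map_add,
    Derivation.map_smul, MvPolynomial.pderiv_X]
  by_cases h : l = l'
  · subst h
    have h1 : Complex.I * ((2 : ℂ)⁻¹ * Complex.I) = -2⁻¹ := by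
      rw [mul_left_comm, Complex.I_mul_I]
      ring
    have h2 : (2 : ℂ)⁻¹ • (1 : MvPolynomial (Λ ⊕ Λ) ℂ) + (2 : ℂ)⁻¹ • 1 = 1 := by
      rw [← add_smul]
      norm_num
    cases ε <;> cases ε' <;> simp [smul_smul, h1, h2]
  · simp [h, Ne.symm h]

variable {Ω : Type*} {f : Λ → Ω → ℂ}

/-- The real and imaginary parts of a family of complex random variables. -/
def reIm (f : Λ → Ω → ℂ) : Λ ⊕ Λ → Ω → ℝ :=
  Sum.elim (fun l ω => (f l ω).re) (fun l ω => (f l ω).im)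

theorem evalAt_zvar (ω : Ω) (ε : Bool) (l : Λ) :
    evalAt (reIm f) ω (zvar ε l) = if ε then star (f l ω) else f l ω := by
  cases ε
  · simp [evalAt, zvar, reIm, mul_comm Complex.I, Complex.re_add_im]
  · apply Complex.ext <;> simp [evalAt, zvar, reIm]

variable [MeasurableSpace Ω] {P : Measure Ω}

theorem IsComplexGaussianFamily.measurable_reIm (hf : IsComplexGaussianFamily P f) :
    ∀ i, Measurable (reIm f i) := by
  rintro (l | l)
  · exact Complex.measurable_re.comp (hf.measurable l)
  · exact Complex.measurable_im.comp (hf.measurable l)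

theorem IsComplexGaussianFamily.law_reIm (hf : IsComplexGaussianFamily P f) :
    ∀ i, P.map (reIm f i) = gaussianReal 0 (1 / 2) := by
  rintro (l | l)
  · exact hf.law_re l
  · exact hf.law_im l

variable [IsProbabilityMeasure P]

/-- The expectation of polynomials in a complex Gaussian family. -/
noncomputable def gaussExp (hf : IsComplexGaussianFamily P f) :
    MvPolynomial (Λ ⊕ Λ) ℂ →ₗ[ℂ] ℂ := polyExp hf.measurable_reIm hf.law_reIm

/-- Integration by parts for polynomials in a complex Gaussian family. -/
theorem gaussExp_zvar_mul (hf : IsComplexGaussianFamily P f) (ε : Bool) (l : Λ)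
    (p : MvPolynomial (Λ ⊕ Λ) ℂ) :
    gaussExp hf (zvar ε l * p) = gaussExp hf (wirtinger ε l p) := by
  have h := polyExp_X_mul hf.measurable_reIm hf.law_reIm hf.indep
  simp only [gaussExp, zvar, wirtinger, add_mul, smul_mul_assoc, map_add, map_smul, h,
    Derivation.smul_apply, Derivation.add_apply, smul_eq_mul]
  ring

end ComplexGaussian

/-! ### Derivatives of trace polynomials -/

theorem sum_list_sum_comm {ι α R : Type*} [AddCommMonoid R] (s : Finset ι) (l : List α)
    (f : ι → α → R) : ∑ i ∈ s, (l.map (f i)).sum = (l.map fun a => ∑ i ∈ s, f i a).sum := by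
  induction l with
  | nil => simp
  | cons a l ih => simp [Finset.sum_add_distrib, ih]

theorem list_sum_apply {α R : Type*} [AddCommMonoid R] {m n : Type*} (l : List α)
    (g : α → Matrix m n R) (i : m) (j : n) :
    (l.map g).sum i j = (l.map fun a => g a i j).sum := by
  induction l with
  | nil => simp
  | cons a l ih => simp [ih]

theorem mul_list_sum {α R : Type*} [NonUnitalNonAssocSemiring R] {m n o : Type*} [Fintype n]
    (X : Matrix m n R) (l : List α) (g : α → Matrix n o R) :
    X * (l.map g).sum = (l.map fun a => X * g a).sum := by
  induction l with
  | nil => simp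
  | cons a l ih => simp [ih, Matrix.mul_add]

/-- All ways to take one element out of a list. -/
def picks {α : Type*} : List α → List (α × List α)
  | [] => []
  | a :: l => (a, l) :: (picks l).map fun p => (p.1, a :: p.2)

/-- The lists of words obtained by cutting one word of `L` at a letter selected by `m` and
inserting it into the word `A`. -/
def insertions {β : Type*} (m : β → Bool) (A : List β) (L : List (List β)) :
    List (List (List β)) :=
  (picks L).flatMap fun p => (splits m p.1).map fun q => (A ++ (q.2 ++ q.1)) :: p.2

theorem sum_insertions {β M : Type*} [AddCommMonoid M] (m : β → Bool) (A : List β)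
    (L : List (List β)) (F : List (List β) → M) : ((insertions m A L).map F).sum =
      ((picks L).map fun p => ((splits m p.1).map fun q =>
        F ((A ++ (q.2 ++ q.1)) :: p.2)).sum).sum := by
  rw [insertions]
  induction picks L with
  | nil => simp
  | cons p l ih =>
    rw [List.flatMap_cons, List.map_append, List.sum_append, ih, List.map_map]
    rfl

section TraceWords

variable {R : Type*} [CommRing R] {β : Type*} {N : ℕ}

/-- The value of a word in matrices. -/
def wordMat (y : β → Matrix (Fin N) (Fin N) R) (A : List β) : Matrix (Fin N) (Fin N) R :=
  (A.map y).prod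

theorem wordMat_append (y : β → Matrix (Fin N) (Fin N) R) (A B : List β) :
    wordMat y (A ++ B) = wordMat y A * wordMat y B := by simp [wordMat]

theorem wordMat_cons (y : β → Matrix (Fin N) (Fin N) R) (x : β) (A : List β) :
    wordMat y (x :: A) = y x * wordMat y A := by simp [wordMat]

variable [Algebra ℂ R]

/-- The normalized trace. -/
noncomputable def nTr (X : Matrix (Fin N) (Fin N) R) : R := (1 / (N : ℂ)) • X.trace

/-- The product of the normalized traces of the words in `L`. -/
noncomputable def trProd (y : β → Matrix (Fin N) (Fin N) R) (L : List (List β)) : R :=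
  (L.map fun A => nTr (wordMat y A)).prod

theorem trProd_cons (y : β → Matrix (Fin N) (Fin N) R) (A : List β) (L : List (List β)) :
    trProd y (A :: L) = nTr (wordMat y A) * trProd y L := by simp [trProd]

variable (D : Derivation ℂ R R)

theorem map_derivation_mul {l m n : Type*} [Fintype m] (X : Matrix l m R) (Y : Matrix m n R) :
    (X * Y).map D = X.map D * Y + X * Y.map D := by
  ext i j
  simp only [Matrix.map_apply, Matrix.mul_apply, Matrix.add_apply, map_sum, Derivation.leibniz,
    smul_eq_mul, ← Finset.sum_add_distrib]
  exact Finset.sum_congr rfl fun k _ => by ring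

/-- By the Leibniz rule, each cut at a selected letter replaces that letter by the common derivative
`E`. -/
theorem map_derivation_wordMat (y : β → Matrix (Fin N) (Fin N) R) (m : β → Bool)
    (E : Matrix (Fin N) (Fin N) R) (hy : ∀ x, (y x).map D = if m x then E else 0)
    (A : List β) : (wordMat y A).map D =
      ((splits m A).map fun p => wordMat y p.1 * E * wordMat y p.2).sum := by
  induction A with
  | nil =>
    ext i j
    by_cases h : i = j <;> simp [wordMat, splits, h]
  | cons x A ih =>
    rw [wordMat_cons, map_derivation_mul, ih, hy, splits, List.map_append, List.sum_append,
      ← List.sum_map_mul_left, List.map_map]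
    congr 1
    · by_cases hx : m x <;> simp [hx, wordMat]
    · congr 1
      simp [Function.comp_def, wordMat_cons, Matrix.mul_assoc]

theorem derivation_trProd (y : β → Matrix (Fin N) (Fin N) R) (L : List (List β)) :
    D (trProd y L) = ((picks L).map fun p => D (nTr (wordMat y p.1)) * trProd y p.2).sum := by
  induction L with
  | nil => simp [trProd, picks]
  | cons A L ih =>
    rw [trProd_cons, Derivation.leibniz, ih, picks, List.map_cons, List.sum_cons, List.map_map,
      smul_eq_mul, smul_eq_mul, ← List.sum_map_mul_left, add_comm, mul_comm]
    congr 2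
    simp only [Function.comp_def, trProd_cons]
    congr 1
    funext p
    ring

theorem derivation_nTr (X : Matrix (Fin N) (Fin N) R) : D (nTr X) = nTr (X.map D) := by
  simp [nTr, Matrix.trace]

theorem mul_single_mul_apply {R : Type*} [CommRing R] {l m n o : Type*} [Fintype m] [Fintype n] [DecidableEq m]
    [DecidableEq n] (X : Matrix l m R) (Y : Matrix n o R) (a : m) (b : n) (i : l) (j : o) :
    (X * Matrix.single a b (1 : R) * Y) i j = X i a * Y b j := by
  simp [Matrix.mul_apply, Matrix.single_apply, Finset.sum_ite_eq, ite_and]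

theorem nTr_list_sum {α : Type*} (l : List α) (g : α → Matrix (Fin N) (Fin N) R) :
    nTr (l.map g).sum = (l.map fun a => nTr (g a)).sum := by
  induction l with
  | nil => simp [nTr]
  | cons a l ih =>
    rw [List.map_cons, List.sum_cons, List.map_cons, List.sum_cons, ← ih]
    simp only [nTr, Matrix.trace_add, smul_add]

/-- Contraction of a matrix with the gradient of a product of traces. -/
theorem sum_mul_derivation_trProd {a : Type*} [Fintype a] [DecidableEq a]
    (y : β → Matrix (Fin N) (Fin N) R) (m : β → Bool) (D : a → Fin N → Derivation ℂ R R)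
    (Q : Matrix (Fin N) a R)
    (hy : ∀ k i x, (y x).map (D k i) = if m x then Q * Matrix.single k i (1 : R) else 0)
    (X : Matrix a (Fin N) R) (L : List (List β)) :
    ∑ k, ∑ i, X k i * D k i (trProd y L) = (1 / (N : ℂ)) • ((picks L).map fun p =>
      ((splits m p.1).map fun q =>
        (X * wordMat y q.2 * wordMat y q.1 * Q).trace * trProd y p.2).sum).sum := by
  have h1 : ∀ k i, X k i * D k i (trProd y L) = ((picks L).map fun p =>
      ((splits m p.1).map fun q => (1 / (N : ℂ)) •
        (X k i * (wordMat y q.2 * wordMat y q.1 * Q) i k * trProd y p.2)).sum).sum := by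
    intro k i
    rw [derivation_trProd, ← List.sum_map_mul_left]
    congr 2
    funext p
    rw [derivation_nTr, map_derivation_wordMat (D k i) y m _ (hy k i), nTr_list_sum,
      ← List.sum_map_mul_right, ← List.sum_map_mul_left]
    congr 2
    funext q
    -- Cyclicity and the matrix unit reduce the trace to one entry, which the sum over `k` and `i`
    -- contracts with `X` into a new trace.
    have h2 : (wordMat y q.1 * (Q * Matrix.single k i (1 : R)) * wordMat y q.2).trace =
        (wordMat y q.2 * wordMat y q.1 * Q) i k := by
      rw [Matrix.trace_mul_comm, ← Matrix.mul_assoc, ← Matrix.mul_assoc, Matrix.trace_mul_single]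
      simp
    rw [nTr, h2, smul_mul_assoc, mul_smul_comm, mul_assoc]
  simp only [h1, sum_list_sum_comm]
  rw [List.smul_sum, List.map_map]
  congr 2
  funext p
  simp only [Function.comp_apply]
  rw [List.smul_sum, List.map_map]
  congr 2
  funext q
  simp only [Function.comp_apply, ← Finset.smul_sum, ← Finset.sum_mul]
  congr 2
  have h2 : X * wordMat y q.2 * wordMat y q.1 * Q = X * (wordMat y q.2 * wordMat y q.1 * Q) := by
    simp only [Matrix.mul_assoc]
  rw [h2, Matrix.trace]
  exact Finset.sum_congr rfl fun k _ => (Matrix.mul_apply (M := X)).symm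

/-- A matrix unit `E_{ki}` inserted in the word separates the `(k, i)` entry into a `(k, k)` and an
`(i, i)` entry, so the double sum splits into a product of two traces. -/
theorem sum_derivation_mul_wordMat {a : Type*} [Fintype a] [DecidableEq a]
    (y : β → Matrix (Fin N) (Fin N) R) (m : β → Bool) (D : a → Fin N → Derivation ℂ R R)
    (Q : Matrix (Fin N) a R)
    (hy : ∀ k i x, (y x).map (D k i) = if m x then Q * Matrix.single k i (1 : R) else 0)
    (V : Matrix a (Fin N) R) (A : List β) :
    ∑ k, ∑ i, D k i ((V * wordMat y A) k i) = ∑ k, ∑ i, (V.map (D k i) * wordMat y A) k i +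
      ((splits m A).map fun p => (V * wordMat y p.1 * Q).trace * (wordMat y p.2).trace).sum := by
  have h1 : ∀ k i, D k i ((V * wordMat y A) k i) = (V.map (D k i) * wordMat y A) k i +
      ((splits m A).map fun p => (V * wordMat y p.1 * Q) k k * (wordMat y p.2) i i).sum := by
    intro k i
    have h2 := congrFun (congrFun (map_derivation_mul (D k i) V (wordMat y A)) k) i
    rw [Matrix.map_apply] at h2
    rw [h2, map_derivation_wordMat (D k i) y m _ (hy k i), mul_list_sum, Matrix.add_apply,
      list_sum_apply]
    congr 3
    funext p
    rw [← mul_single_mul_apply]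
    simp only [Matrix.mul_assoc]
  simp only [h1, Finset.sum_add_distrib, sum_list_sum_comm]
  congr 3
  funext p
  simp only [Matrix.trace, Matrix.diag_apply, Finset.sum_mul_sum]

/-- The Schwinger–Dyson equation for trace polynomials. -/
theorem schwingerDyson_trProd {a : Type*} [Fintype a] [DecidableEq a] (𝔼 : R →ₗ[ℂ] ℂ)
    (y : β → Matrix (Fin N) (Fin N) R) (m : β → Bool) (D : a → Fin N → Derivation ℂ R R)
    (Q : Matrix (Fin N) a R)
    (hy : ∀ k i x, (y x).map (D k i) = if m x then Q * Matrix.single k i (1 : R) else 0)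
    (V : Matrix a (Fin N) R) (z : a → Fin N → R) (hz : ∀ k i p, 𝔼 (z k i * p) = 𝔼 (D k i p))
    (x : β) (κ θ : ℂ)
    (hx : ∀ X : Matrix (Fin N) (Fin N) R, (y x * X).trace = κ • ∑ k, ∑ i, z k i * (V * X) k i)
    (hV : ∀ X : Matrix (Fin N) (Fin N) R,
      ∑ k, ∑ i, (V.map (D k i) * X) k i = θ • X.trace)
    (pre : List β)
    (hQ : ∀ X : Matrix (Fin N) (Fin N) R, κ • (V * X * Q).trace = nTr (wordMat y pre * X))
    (A : List β) (L : List (List β)) :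
    𝔼 (trProd y ((x :: A) :: L)) = κ * θ * 𝔼 (trProd y (A :: L)) +
      ((splits m A).map fun p => 𝔼 (trProd y ((pre ++ p.1) :: p.2 :: L))).sum +
      1 / (N : ℂ) ^ 2 * ((insertions m (pre ++ A) L).map fun K => 𝔼 (trProd y K)).sum := by
  -- The first letter is written as `κ` times its Gaussian entries `z` contracted with `V`.
  -- Integration by parts then differentiates `V` (giving `θ`), the rest of the word (two traces) or
  -- the other traces (one merged trace). The normalization carries one factor `1/N` for each trace,
  -- so only the merging term keeps `N⁻²`; `hQ` rewrites the word closed up by `V` and `Q` with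
  -- prefix `pre`.
  have h1 : trProd y ((x :: A) :: L) = (1 / (N : ℂ)) • κ • ∑ k, ∑ i,
      z k i * ((V * wordMat y A) k i * trProd y L) := by
    rw [trProd_cons, wordMat_cons, nTr, hx, smul_mul_assoc, smul_mul_assoc]
    simp only [Finset.sum_mul, mul_assoc]
  have h2 : 𝔼 (trProd y ((x :: A) :: L)) = 𝔼 ((1 / (N : ℂ)) • κ • ∑ k, ∑ i,
      D k i ((V * wordMat y A) k i * trProd y L)) := by
    rw [h1]
    simp only [map_smul, map_sum, hz]
  have h3 : ∑ k, ∑ i, D k i ((V * wordMat y A) k i * trProd y L) =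
      (∑ k, ∑ i, D k i ((V * wordMat y A) k i)) * trProd y L +
        ∑ k, ∑ i, (V * wordMat y A) k i * D k i (trProd y L) := by
    simp only [Finset.sum_mul, ← Finset.sum_add_distrib, Derivation.leibniz, smul_eq_mul]
    exact Finset.sum_congr rfl fun k _ => Finset.sum_congr rfl fun i _ => by ring
  have h4 : (1 / (N : ℂ)) • κ • ∑ k, ∑ i, D k i ((V * wordMat y A) k i * trProd y L) =
      (κ * θ) • trProd y (A :: L) +
      ((splits m A).map fun p => trProd y ((pre ++ p.1) :: p.2 :: L)).sum +
      (1 / (N : ℂ) ^ 2) • ((insertions m (pre ++ A) L).map fun K => trProd y K).sum := by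
    rw [h3, sum_derivation_mul_wordMat y m D Q hy, sum_mul_derivation_trProd y m D Q hy, hV,
      smul_add, smul_add, add_mul, smul_add, smul_add]
    congr 1
    · congr 1
      · rw [trProd_cons, nTr]
        simp only [smul_mul_assoc, smul_smul]
        congr 1
        ring
      · rw [← List.sum_map_mul_right, List.smul_sum, List.map_map, List.smul_sum, List.map_map]
        congr 2
        funext p
        simp only [Function.comp_apply, trProd_cons, wordMat_append, ← hQ]
        rw [nTr]
        simp only [smul_mul_assoc, mul_smul_comm, smul_smul]
        rw [mul_assoc]
    · simp only [sum_insertions, trProd_cons, wordMat_append, Matrix.mul_assoc (wordMat y pre),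
        ← hQ]
      rw [smul_smul, smul_smul, List.smul_sum, List.map_map, List.smul_sum, List.map_map]
      congr 2
      funext p
      simp only [Function.comp_apply]
      rw [List.smul_sum, List.map_map, List.smul_sum, List.map_map]
      congr 2
      funext q
      simp only [Function.comp_apply, smul_mul_assoc, smul_smul, Matrix.mul_assoc]
      congr 1
      ring
  rw [h2, h4]
  simp only [map_add, map_smul, smul_eq_mul, map_list_sum, List.map_map, Function.comp_def]

end TraceWords

/-! ### Random matrices as matrices of polynomials -/

section Letters

variable {s N : ℕ}

/-- The ring of polynomials in the real and imaginary parts of the Gaussian variables. -/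
abbrev GaussRing (s : ℕ) : Type := MvPolynomial ((Fin s × ℕ × ℕ) ⊕ (Fin s × ℕ × ℕ)) ℂ

/-- The matrix of a permutation, or its adjoint, with polynomial entries. -/
noncomputable def permLetter (σ : Fin s → Equiv.Perm (Fin N)) (r : Fin s) (ε : Bool) :
    Matrix (Fin N) (Fin N) (GaussRing s) :=
  (if ε then star (permMat (σ r)) else permMat (σ r)).map (algebraMap ℂ (GaussRing s))

/-- The letters of a monomial in permutation matrices and square Gaussian matrices. -/
noncomputable def gaussLetter (σ : Fin s → Equiv.Perm (Fin N)) :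
    (Fin s ⊕ Fin s) × Bool → Matrix (Fin N) (Fin N) (GaussRing s)
  | (Sum.inl r, ε) => permLetter σ r ε
  | (Sum.inr r, ε) => Matrix.of fun i j => (1 / (Real.sqrt N : ℂ)) •
      zvar ε (if ε then (r, (j : ℕ), (i : ℕ)) else (r, (i : ℕ), (j : ℕ)))

/-- The rectangular Gaussian matrix with polynomial entries. -/
noncomputable def rectMat (M N : ℕ) (r : Fin s) : Matrix (Fin M) (Fin N) (GaussRing s) :=
  Matrix.of fun k i => zvar false (r, (k : ℕ), (i : ℕ))

/-- The adjoint of the rectangular Gaussian matrix with polynomial entries. -/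
noncomputable def rectMatStar (M N : ℕ) (r : Fin s) : Matrix (Fin N) (Fin M) (GaussRing s) :=
  Matrix.of fun i k => zvar true (r, (k : ℕ), (i : ℕ))

/-- The letters of a monomial in permutation matrices and Wishart matrices. -/
noncomputable def wishartLetter (M : ℕ) (σ : Fin s → Equiv.Perm (Fin N)) :
    (Fin s ⊕ Fin s) × Bool → Matrix (Fin N) (Fin N) (GaussRing s)
  | (Sum.inl r, ε) => permLetter σ r ε
  | (Sum.inr r, _) => (1 / (N : ℂ)) • (rectMatStar M N r * rectMat M N r)

theorem permLetter_map_derivation (D : Derivation ℂ (GaussRing s) (GaussRing s))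
    (σ : Fin s → Equiv.Perm (Fin N)) (r : Fin s) (ε : Bool) : (permLetter σ r ε).map D = 0 := by
  ext i j
  simp only [permLetter, Matrix.map_apply, Derivation.map_algebraMap, Matrix.zero_apply]

variable {Ω : Type*} [MeasurableSpace Ω] {P : Measure Ω} [IsProbabilityMeasure P]
  {f : Fin s × ℕ × ℕ → Ω → ℂ}

theorem one_div_sqrt_mul_self (N : ℕ) :
    (1 / (Real.sqrt N : ℂ)) * (1 / (Real.sqrt N : ℂ)) = 1 / (N : ℂ) := by
  rw [div_mul_div_comm, ← Complex.ofReal_mul, Real.mul_self_sqrt (Nat.cast_nonneg N)]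
  simp

theorem schwingerDyson_gaussLetter (hf : IsComplexGaussianFamily P f)
    (σ : Fin s → Equiv.Perm (Fin N)) (r : Fin s) (ε : Bool) (A : List ((Fin s ⊕ Fin s) × Bool))
    (L : List (List ((Fin s ⊕ Fin s) × Bool))) :
    gaussExp hf (trProd (gaussLetter σ) (((Sum.inr r, ε) :: A) :: L)) =
      ((splits (fun x => decide (x = (Sum.inr r, !ε))) A).map fun p =>
        gaussExp hf (trProd (gaussLetter σ) (p.1 :: p.2 :: L))).sum +
      1 / (N : ℂ) ^ 2 * ((insertions (fun x => decide (x = (Sum.inr r, !ε))) A L).map fun K =>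
        gaussExp hf (trProd (gaussLetter σ) K)).sum := by
  -- The trace pairs the `(i, k)` entry of the letter with the `(k, i)` entry of the rest, so the
  -- Gaussian indices are transposed for the letter itself and not for its adjoint. The two factors
  -- `N^{-1/2}` in `Q` and `κ` combine to `1/N`.
  have h := schwingerDyson_trProd (a := Fin N) (gaussExp hf) (gaussLetter σ)
    (fun x => decide (x = (Sum.inr r, !ε)))
    (fun k i => wirtinger ε (if ε then (r, (k : ℕ), (i : ℕ)) else (r, (i : ℕ), (k : ℕ))))
    ((1 / (Real.sqrt N : ℂ)) • 1) ?_ 1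
    (fun k i => zvar ε (if ε then (r, (k : ℕ), (i : ℕ)) else (r, (i : ℕ), (k : ℕ))))
    (fun k i p => gaussExp_zvar_mul hf _ _ p) (Sum.inr r, ε) (1 / (Real.sqrt N : ℂ)) 0 ?_ ?_ [] ?_
    A L
  · simpa using h
  · rintro k i ⟨r' | r', ε'⟩
    · refine (permLetter_map_derivation _ σ r' ε').trans (if_neg ?_).symm
      simp
    · ext p q : 1
      simp only [gaussLetter, Matrix.map_apply, Matrix.of_apply, Derivation.map_smul,
        wirtinger_zvar]
      by_cases hr : r' = r
      · subst hr
        cases ε <;> cases ε' <;>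
          simp [Matrix.smul_apply, Matrix.single_apply, Fin.ext_iff, eq_comm, and_comm]
      · cases ε <;> cases ε' <;> simp [hr, Ne.symm hr]
  · intro X
    simp only [gaussLetter, Matrix.trace, Matrix.diag_apply, Matrix.mul_apply, Matrix.of_apply,
      smul_mul_assoc, ← Finset.smul_sum]
    congr 1
    rw [Finset.sum_comm]
    refine Finset.sum_congr rfl fun k _ => Finset.sum_congr rfl fun i _ => ?_
    congr 1
    simp [Matrix.one_apply]
  · intro X
    rw [zero_smul]
    refine Finset.sum_eq_zero fun k _ => Finset.sum_eq_zero fun i _ => ?_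
    have : ∀ D : Derivation ℂ (GaussRing s) (GaussRing s),
        (1 : Matrix (Fin N) (Fin N) (GaussRing s)).map D = 0 := by
      intro D
      ext i j
      by_cases h : i = j <;> simp [h]
    rw [this, Matrix.zero_mul, Matrix.zero_apply]
  · intro X
    simp only [wordMat, List.map_nil, List.prod_nil, one_mul, nTr, Matrix.mul_smul, mul_one,
      Matrix.trace_smul, smul_smul, one_div_sqrt_mul_self]

theorem schwingerDyson_wishartLetter (hf : IsComplexGaussianFamily P f) (M : ℕ)
    (σ : Fin s → Equiv.Perm (Fin N)) (r : Fin s) (ε : Bool) (A : List ((Fin s ⊕ Fin s) × Bool))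
    (L : List (List ((Fin s ⊕ Fin s) × Bool))) :
    gaussExp hf (trProd (wishartLetter M σ) (((Sum.inr r, ε) :: A) :: L)) =
      (M : ℂ) / N * gaussExp hf (trProd (wishartLetter M σ) (A :: L)) +
      ((splits (fun x => decide (x.1 = Sum.inr r)) A).map fun p =>
        gaussExp hf (trProd (wishartLetter M σ) (((Sum.inr r, ε) :: p.1) :: p.2 :: L))).sum +
      1 / (N : ℂ) ^ 2 * ((insertions (fun x => decide (x.1 = Sum.inr r))
        ((Sum.inr r, ε) :: A) L).map fun K => gaussExp hf (trProd (wishartLetter M σ) K)).sum := by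
  have hF : ∀ (k : Fin M) (i : Fin N) (r' : Fin s), (rectMat M N r').map
      (wirtinger true (r, (k : ℕ), (i : ℕ))) = if r' = r then Matrix.single k i 1 else 0 := by
    intro k i r'
    ext p q : 1
    simp only [rectMat, Matrix.map_apply, Matrix.of_apply, wirtinger_zvar]
    by_cases hr : r' = r
    · subst hr
      simp [Matrix.single_apply, Fin.ext_iff]
    · simp [hr, Ne.symm hr]
  have hFs : ∀ (k : Fin M) (i : Fin N) (r' : Fin s), (rectMatStar M N r').map
      (wirtinger true (r, (k : ℕ), (i : ℕ))) = 0 := by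
    intro k i r'
    ext p q : 1
    simp [rectMatStar, Matrix.map_apply, Matrix.of_apply, wirtinger_zvar]
  -- Only the conjugate entries of the first `F*F/N` are integrated by parts. The dual derivative
  -- kills every `F*`, so a Wishart letter has derivative `N⁻¹ F* E_{ki}`. The remaining `V = F` has
  -- derivative `E_{ki}`, and the sum over the `M` rows gives `θ = M`, hence the coefficient `M/N`.
  -- The leftover `F` and `Q` close up to a Wishart letter, the prefix `pre`.
  have h := schwingerDyson_trProd (a := Fin M) (gaussExp hf) (wishartLetter M σ)
    (fun x => decide (x.1 = Sum.inr r))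
    (fun k i => wirtinger true (r, (k : ℕ), (i : ℕ)))
    ((1 / (N : ℂ)) • rectMatStar M N r) ?_ (rectMat M N r)
    (fun k i => zvar true (r, (k : ℕ), (i : ℕ)))
    (fun k i p => gaussExp_zvar_mul hf _ _ p) (Sum.inr r, ε) (1 / (N : ℂ)) M ?_ ?_ [(Sum.inr r, ε)]
    ?_ A L
  · rw [h]
    congr 3
    ring
  · rintro k i ⟨r' | r', ε'⟩
    · rw [if_neg (by simp)]
      exact permLetter_map_derivation _ σ r' ε'
    · have h1 : (wishartLetter M σ (Sum.inr r', ε')).map (wirtinger true (r, (k : ℕ), (i : ℕ))) =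
          (1 / (N : ℂ)) • (rectMatStar M N r' * rectMat M N r').map
            (wirtinger true (r, (k : ℕ), (i : ℕ))) := by
        ext p q : 1
        simp only [wishartLetter, Matrix.map_apply, Matrix.smul_apply, Derivation.map_smul]
      rw [h1, map_derivation_mul, hF, hFs, Matrix.zero_mul, zero_add]
      by_cases hr : r' = r
      · subst hr
        simp
      · simp [hr]
  · intro X
    simp only [wishartLetter, Matrix.smul_mul, Matrix.trace_smul, Matrix.mul_assoc]
    congr 1
    simp only [Matrix.trace, Matrix.diag_apply, Matrix.mul_apply (M := rectMatStar M N r)]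
    exact Finset.sum_comm
  · intro X
    simp only [hF, if_true]
    have : ∀ (k : Fin M) (i : Fin N), (Matrix.single k i (1 : GaussRing s) * X) k i = X i i := by
      intro k i
      simp
    simp only [this, Finset.sum_const, Finset.card_univ, Fintype.card_fin, Matrix.trace,
      Matrix.diag_apply, ← Nat.cast_smul_eq_nsmul ℂ]
  · intro X
    simp only [wordMat, List.map_cons, List.map_nil, List.prod_cons, List.prod_nil, mul_one, nTr,
      wishartLetter, Matrix.mul_smul, Matrix.smul_mul, Matrix.trace_smul]
    congr 2
    rw [Matrix.trace_mul_comm, Matrix.mul_assoc]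

end Letters

/-! ### Permutation matrices -/

section PermMat

variable {N : ℕ}

theorem permMat_mul (σ τ : Equiv.Perm (Fin N)) : permMat (σ * τ) = permMat σ * permMat τ := by
  ext i j
  by_cases h : σ (τ j) = i <;> simp [permMat, Matrix.mul_apply, h]

theorem permMat_one : permMat (1 : Equiv.Perm (Fin N)) = 1 := by
  ext i j
  simp [permMat, Matrix.one_apply, eq_comm]

theorem star_permMat (σ : Equiv.Perm (Fin N)) : star (permMat σ) = permMat σ⁻¹ := by
  ext i j
  simp only [permMat, Matrix.star_apply, Matrix.of_apply, Equiv.Perm.inv_eq_iff_eq, eq_comm (a := j)]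
  split_ifs <;> simp

theorem permMat_injective : Function.Injective (permMat : Equiv.Perm (Fin N) → _) := by
  intro σ τ h
  ext j : 1
  have h1 := congrFun (congrFun h (σ j)) j
  simp only [permMat, Matrix.of_apply, if_true] at h1
  by_contra hne
  rw [if_neg (Ne.symm hne)] at h1
  exact one_ne_zero h1

theorem trace_permMat (σ : Equiv.Perm (Fin N)) : (permMat σ).trace = fixCount σ := by
  simp [Matrix.trace, permMat, fixCount]

/-- The flag `true` marks a generator in a free-group word but an adjoint in a monomial, hence the
negation. -/
theorem permMat_lift_mk {I : Type*} (σ : I → Equiv.Perm (Fin N)) (B : List (I × Bool)) :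
    permMat (FreeGroup.lift σ (FreeGroup.mk B)) =
      (B.map fun p => if !p.2 then star (permMat (σ p.1)) else permMat (σ p.1)).prod := by
  rw [FreeGroup.lift_mk]
  induction B with
  | nil => simp [permMat_one]
  | cons p B ih =>
    rw [List.map_cons, List.prod_cons, permMat_mul, ih, List.map_cons, List.prod_cons]
    congr 1
    cases p.2 <;> simp [star_permMat]

end PermMat

/-! ### Averaging over permutations -/

section PermExp

variable {s N : ℕ} {Ω : Type*} [MeasurableSpace Ω] {P : Measure Ω} [IsProbabilityMeasure P]
  {f : Fin s × ℕ × ℕ → Ω → ℂ}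

/-- The expectation of a product of traces of words in uniformly distributed permutation matrices
and matrices of polynomials in Gaussian variables. -/
noncomputable def permExp (hf : IsComplexGaussianFamily P f)
    (y : (Fin s → Equiv.Perm (Fin N)) → (Fin s ⊕ Fin s) × Bool →
      Matrix (Fin N) (Fin N) (GaussRing s)) (L : List (List ((Fin s ⊕ Fin s) × Bool))) : ℂ :=
  ((N.factorial : ℂ) ^ s)⁻¹ * ∑ σ, gaussExp hf (trProd (y σ) L)

variable (hf : IsComplexGaussianFamily P f)
  {y : (Fin s → Equiv.Perm (Fin N)) → (Fin s ⊕ Fin s) × Bool →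
    Matrix (Fin N) (Fin N) (GaussRing s)}

theorem permExp_perm {L L' : List (List ((Fin s ⊕ Fin s) × Bool))} (h : L.Perm L') :
    permExp hf y L = permExp hf y L' := by
  have : ∀ σ, trProd (y σ) L = trProd (y σ) L' := fun σ => (h.map _).prod_eq
  simp only [permExp, this]

theorem permExp_append_comm (A B : List ((Fin s ⊕ Fin s) × Bool))
    (L : List (List ((Fin s ⊕ Fin s) × Bool))) :
    permExp hf y ((A ++ B) :: L) = permExp hf y ((B ++ A) :: L) := by
  have : ∀ σ, trProd (y σ) ((A ++ B) :: L) = trProd (y σ) ((B ++ A) :: L) := by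
    intro σ
    rw [trProd_cons, trProd_cons, wordMat_append, wordMat_append, nTr, nTr, Matrix.trace_mul_comm]
  simp only [permExp, this]

theorem gaussExp_algebraMap (z : ℂ) : gaussExp hf (algebraMap ℂ (GaussRing s) z) = z := by
  change ∫ ω, evalAt (reIm f) ω (algebraMap ℂ (GaussRing s) z) ∂P = z
  simp

/-- The fraction of fixed points of a word in permutations. -/
noncomputable def fixFraction (σ : Fin s → Equiv.Perm (Fin N)) (B : List (Fin s × Bool)) : ℝ :=
  (1 / (N : ℝ)) * fixCount (FreeGroup.lift σ (FreeGroup.mk B))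

/-- A word in the generators of the free group as a monomial. -/
def permWord (B : List (Fin s × Bool)) : List ((Fin s ⊕ Fin s) × Bool) :=
  B.map fun p => (Sum.inl p.1, !p.2)

theorem wordMat_permWord {σ : Fin s → Equiv.Perm (Fin N)}
    (hy : ∀ r ε, y σ (Sum.inl r, ε) = permLetter σ r ε) (B : List (Fin s × Bool)) :
    wordMat (y σ) (permWord B) =
      (permMat (FreeGroup.lift σ (FreeGroup.mk B))).map (algebraMap ℂ (GaussRing s)) := by
  have h : (permMat (FreeGroup.lift σ (FreeGroup.mk B))).map (algebraMap ℂ (GaussRing s)) =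
    (algebraMap ℂ (GaussRing s)).mapMatrix (permMat (FreeGroup.lift σ (FreeGroup.mk B))) := rfl
  rw [h, permMat_lift_mk, map_list_prod, wordMat, permWord, List.map_map, List.map_map]
  congr 2
  funext p
  simp only [Function.comp_apply, hy, permLetter]
  rfl

/-- Without Gaussian letters the trace polynomials are constants, so only the average over
permutations remains. -/
theorem permExp_permWord (hy : ∀ σ r ε, y σ (Sum.inl r, ε) = permLetter σ r ε)
    (L : List (List (Fin s × Bool))) : permExp hf y (L.map permWord) =
      ((((N.factorial : ℝ) ^ s)⁻¹ * ∑ σ : Fin s → Equiv.Perm (Fin N),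
        (L.map (fixFraction σ)).prod : ℝ) : ℂ) := by
  have h1 : ∀ (σ : Fin s → Equiv.Perm (Fin N)) (B : List (Fin s × Bool)),
      nTr (wordMat (y σ) (permWord B)) = algebraMap ℂ (GaussRing s) (fixFraction σ B : ℂ) := by
    intro σ B
    rw [wordMat_permWord (hy σ), nTr, ← AddMonoidHom.map_trace,
      trace_permMat, Algebra.smul_def, ← map_mul]
    simp [fixFraction]
  have h2 : ∀ σ : Fin s → Equiv.Perm (Fin N), trProd (y σ) (L.map permWord) =
      algebraMap ℂ (GaussRing s) (((L.map (fixFraction σ)).prod : ℝ) : ℂ) := by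
    intro σ
    rw [trProd, List.map_map]
    simp only [Function.comp_def, h1]
    induction L with
    | nil => simp
    | cons B L ih =>
      rw [List.map_cons, List.prod_cons, ih, ← map_mul, List.map_cons, List.prod_cons,
        Complex.ofReal_mul]
  simp only [permExp, h2, gaussExp_algebraMap]
  push_cast
  rfl

end PermExp

/-! ### Evaluation of the matrices of polynomials -/

section Evaluation

variable {s N : ℕ} {Ω : Type*} {f : Fin s × ℕ × ℕ → Ω → ℂ}

/-- The matrices of polynomials `y σ` evaluate to the permutation matrices given by `σ` and the
random matrices `V`. -/
def Represents (f : Fin s × ℕ × ℕ → Ω → ℂ)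
    (y : (Fin s → Equiv.Perm (Fin N)) → (Fin s ⊕ Fin s) × Bool →
      Matrix (Fin N) (Fin N) (GaussRing s))
    (V : Fin s → Ω → Matrix (Fin N) (Fin N) ℂ) : Prop :=
  ∀ σ ω x, (y σ x).map (evalAt (reIm f) ω) =
    if x.2 then star (Sum.elim (fun r => permMat (σ r)) (fun r => V r ω) x.1)
    else Sum.elim (fun r => permMat (σ r)) (fun r => V r ω) x.1

theorem permLetter_map_evalAt (σ : Fin s → Equiv.Perm (Fin N)) (ω : Ω) (r : Fin s) (ε : Bool) :
    (permLetter σ r ε).map (evalAt (reIm f) ω) =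
      if ε then star (permMat (σ r)) else permMat (σ r) := by
  ext i j
  simp [permLetter, Matrix.map_apply]

theorem represents_gaussLetter : Represents f (gaussLetter (N := N)) (gaussSquare f N) := by
  rintro σ ω ⟨r | r, ε⟩
  · exact permLetter_map_evalAt σ ω r ε
  · ext i j
    cases ε <;>
      simp [gaussLetter, gaussSquare, gaussRect, evalAt_zvar, Matrix.star_apply]

theorem represents_wishartLetter (M : ℕ) :
    Represents f (wishartLetter (N := N) M) (wishart f M N) := by
  have h1 : ∀ r ω, ((1 / (N : ℂ)) • (rectMatStar M N r * rectMat M N r)).map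
      (evalAt (reIm f) ω) = wishart f M N r ω := by
    intro r ω
    ext i j
    simp [wishart, gaussRect, rectMatStar, rectMat, Matrix.mul_apply, evalAt_zvar]
  have h2 : ∀ r ω, star (wishart f M N r ω) = wishart f M N r ω := by
    intro r ω
    simp [wishart, Matrix.star_eq_conjTranspose, Matrix.conjTranspose_mul]
  rintro σ ω ⟨r | r, ε⟩
  · exact permLetter_map_evalAt σ ω r ε
  · cases ε
    · exact h1 r ω
    · exact (h1 r ω).trans (h2 r ω).symm

theorem Represents.evalAt_trProd
    {y : (Fin s → Equiv.Perm (Fin N)) → (Fin s ⊕ Fin s) × Bool →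
      Matrix (Fin N) (Fin N) (GaussRing s)}
    {V : Fin s → Ω → Matrix (Fin N) (Fin N) ℂ} (hy : Represents f y V)
    (σ : Fin s → Equiv.Perm (Fin N)) (ω : Ω) (L : List (List ((Fin s ⊕ Fin s) × Bool))) :
    evalAt (reIm f) ω (trProd (y σ) L) = (L.map fun A => ntr (evalMonomial
      (Sum.elim (fun r => permMat (σ r)) (fun r => V r ω)) A)).prod := by
  have h1 : ∀ A, evalAt (reIm f) ω (nTr (wordMat (y σ) A)) = ntr (evalMonomial
      (Sum.elim (fun r => permMat (σ r)) (fun r => V r ω)) A) := by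
    intro A
    rw [nTr, map_smul, smul_eq_mul, ntr, evalMonomial]
    congr 1
    rw [AddMonoidHom.map_trace (evalAt (reIm f) ω), wordMat]
    congr 1
    have h2 := map_list_prod (RingHom.mapMatrix (m := Fin N) (evalAt (reIm f) ω).toRingHom)
      (A.map (y σ))
    refine h2.trans ?_
    rw [List.map_map]
    congr 2
    funext x
    exact hy σ ω x
  rw [trProd, map_list_prod, List.map_map]
  congr 2
  funext A
  exact h1 A

end Evaluation

/-! ### Conditioning on the permutations -/

theorem indepFun_of_iIndepFun_elim {Ω β ι κ : Type*} [Fintype ι] [Fintype κ] [MeasurableSpace Ω]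
    [MeasurableSpace β] {P : Measure Ω} {U : ι → Ω → β} {V : κ → Ω → β} (hU : ∀ r, Measurable (U r))
    (hV : ∀ r, Measurable (V r)) (h : iIndepFun (Sum.elim U V) P) :
    IndepFun (fun ω r => U r ω) (fun ω r => V r ω) P := by
  have hm : ∀ i, Measurable (Sum.elim U V i) := by
    rintro (r | r)
    · exact hU r
    · exact hV r
  have h1 := h.indepFun_finset (Finset.univ.map Function.Embedding.inl)
    (Finset.univ.map Function.Embedding.inr) (by
      rw [Finset.disjoint_left]
      simp) hm
  exact h1.comp
    (φ := fun g r => g ⟨Sum.inl r, by simp⟩) (ψ := fun g r => g ⟨Sum.inr r, by simp⟩)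
    (measurable_pi_lambda _ fun r => measurable_pi_apply _)
    (measurable_pi_lambda _ fun r => measurable_pi_apply _)

instance {m n : Type*} [Countable m] [Countable n] : MeasurableSingletonClass (Matrix m n ℂ) :=
  inferInstanceAs (MeasurableSingletonClass (m → n → ℂ))

section Conditioning

variable {s N : ℕ}

theorem measurable_matrix_entry {ι m n : Type*} (r : ι) (i : m) (j : n) :
    Measurable fun v : ι → Matrix m n ℂ => v r i j :=
  (measurable_pi_apply j).comp ((measurable_pi_apply i).comp (measurable_pi_apply r))

theorem measurable_evalMonomial_entry (u : Fin s → Matrix (Fin N) (Fin N) ℂ)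
    (A : List ((Fin s ⊕ Fin s) × Bool)) (i j : Fin N) :
    Measurable fun v : Fin s → Matrix (Fin N) (Fin N) ℂ => evalMonomial (Sum.elim u v) A i j := by
  induction A generalizing i with
  | nil => simp [evalMonomial]
  | cons x A ih =>
    have h : ∀ v : Fin s → Matrix (Fin N) (Fin N) ℂ, evalMonomial (Sum.elim u v) (x :: A) i j =
        ∑ k, (if x.2 then star (Sum.elim u v x.1) else Sum.elim u v x.1) i k *
          evalMonomial (Sum.elim u v) A k j := fun v => Matrix.mul_apply
    simp only [h]
    refine Finset.measurable_sum _ fun k _ => Measurable.mul ?_ (ih k)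
    obtain ⟨r | r, ε⟩ := x
    · exact measurable_const (a := (if ε then star (u r) else u r) i k)
    · cases ε
      · exact measurable_matrix_entry r i k
      · exact Complex.continuous_conj.measurable.comp (measurable_matrix_entry r k i)

theorem measurable_ntr_evalMonomial (u : Fin s → Matrix (Fin N) (Fin N) ℂ)
    (A : List ((Fin s ⊕ Fin s) × Bool)) :
    Measurable fun v : Fin s → Matrix (Fin N) (Fin N) ℂ => ntr (evalMonomial (Sum.elim u v) A) := by
  refine Measurable.const_mul ?_ _
  exact Finset.measurable_sum _ fun i _ => measurable_evalMonomial_entry u A i i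

/-- The product of the traces of the monomials in `L`. -/
noncomputable def monomialTraces {I : Type*} (x : I → Matrix (Fin N) (Fin N) ℂ)
    (L : List (List (I × Bool))) : ℂ := (L.map fun A => ntr (evalMonomial x A)).prod

theorem measurable_monomialTraces (u : Fin s → Matrix (Fin N) (Fin N) ℂ)
    (L : List (List ((Fin s ⊕ Fin s) × Bool))) :
    Measurable fun v : Fin s → Matrix (Fin N) (Fin N) ℂ => monomialTraces (Sum.elim u v) L := by
  induction L with
  | nil => simp [monomialTraces]
  | cons A L ih =>
    have h : ∀ v : Fin s → Matrix (Fin N) (Fin N) ℂ, monomialTraces (Sum.elim u v) (A :: L) =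
        ntr (evalMonomial (Sum.elim u v) A) * monomialTraces (Sum.elim u v) L := by
      intro v
      simp [monomialTraces]
    simp only [h]
    exact (measurable_ntr_evalMonomial u A).mul ih

variable {Ω : Type*} [MeasurableSpace Ω] {P : Measure Ω}
  {U V : Fin s → Ω → Matrix (Fin N) (Fin N) ℂ}

-- The permutation matrices take finitely many values, and exactly one indicator is nonzero at each
-- `ω`. On each event the permutations are frozen and the traces are polynomials in the Gaussians.
open Classical in
theorem monomialTraces_eq_sum (hU : ∀ r, IsUniformPermMatrix P (U r)) (ω : Ω)
    (L : List (List ((Fin s ⊕ Fin s) × Bool))) :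
    monomialTraces (fun i => Sum.elim U V i ω) L = ∑ σ : Fin s → Equiv.Perm (Fin N),
      ({fun r => permMat (σ r)} : Set (Fin s → Matrix (Fin N) (Fin N) ℂ)).indicator
        (fun _ => (1 : ℂ)) (fun r => U r ω) *
      monomialTraces (Sum.elim (fun r => permMat (σ r)) fun r => V r ω) L := by
  choose σ hσ using fun r => (hU r).isPerm ω
  rw [Finset.sum_eq_single σ]
  · have h1 : (fun r => U r ω) = fun r => permMat (σ r) := funext hσ
    have h2 : (fun i => Sum.elim U V i ω) =
        Sum.elim (fun r => permMat (σ r)) fun r => V r ω := by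
      funext i
      cases i with
      | inl r => exact hσ r
      | inr r => rfl
    rw [h1, h2, Set.indicator_of_mem (Set.mem_singleton _), one_mul]
  · intro τ _ hne
    rw [Set.indicator_of_notMem, zero_mul]
    rw [Set.mem_singleton_iff]
    intro h
    refine hne (funext fun r => permMat_injective ?_)
    rw [← hσ r]
    exact (congrFun h r).symm
  · intro h
    exact absurd (Finset.mem_univ _) h

theorem measurable_gaussSquare {f : Fin s × ℕ × ℕ → Ω → ℂ} (hf : IsComplexGaussianFamily P f) (N : ℕ) (r : Fin s) :
    Measurable (gaussSquare f N r) :=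
  measurable_pi_lambda _ fun _ => measurable_pi_lambda _ fun _ =>
    (hf.measurable _).const_mul (1 / (Real.sqrt N : ℂ))

theorem measurable_wishart {f : Fin s × ℕ × ℕ → Ω → ℂ} (hf : IsComplexGaussianFamily P f)
    (M N : ℕ) (r : Fin s) :
    Measurable (wishart f M N r) := by
  refine measurable_pi_lambda _ fun i => measurable_pi_lambda _ fun j => ?_
  have h : ∀ ω, wishart f M N r ω i j =
      1 / (N : ℂ) * ∑ k : Fin M, star (f (r, k, i) ω) * f (r, k, j) ω := fun ω => rfl
  simp only [h]
  exact (Finset.measurable_sum _ fun k _ =>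
    (Complex.continuous_conj.measurable.comp (hf.measurable _)).mul (hf.measurable _)).const_mul _

theorem integral_indicator_permMat (hU : ∀ r, IsUniformPermMatrix P (U r))
    (hind : iIndepFun (Sum.elim U V) P) (σ : Fin s → Equiv.Perm (Fin N)) :
    ∫ ω, ({fun r => permMat (σ r)} : Set (Fin s → Matrix (Fin N) (Fin N) ℂ)).indicator
        (fun _ => (1 : ℂ)) (fun r => U r ω) ∂P = ((N.factorial : ℂ) ^ s)⁻¹ := by
  have hind' : iIndepFun U P := hind.precomp (g := Sum.inl) Sum.inl_injective
  have h1 := hind'.measure_inter_preimage_eq_mul Finset.univ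
    (sets := fun r => {permMat (σ r)}) fun r _ => measurableSet_singleton _
  have h2 : (fun ω => ({fun r => permMat (σ r)} : Set (Fin s → Matrix (Fin N) (Fin N) ℂ)).indicator
        (fun _ => (1 : ℂ)) (fun r => U r ω)) =
      (⋂ r ∈ Finset.univ, U r ⁻¹' {permMat (σ r)}).indicator fun _ => (1 : ℂ) := by
    funext ω
    by_cases h : ∀ r, U r ω = permMat (σ r)
    · rw [Set.indicator_of_mem (by simpa using funext h), Set.indicator_of_mem (by simpa using h)]
    · rw [Set.indicator_of_notMem (by simpa [funext_iff] using h),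
        Set.indicator_of_notMem (by simpa using h)]
  have h3 : MeasurableSet (⋂ r ∈ Finset.univ, U r ⁻¹' {permMat (σ r)}) :=
    Finset.measurableSet_biInter _ fun r _ => (hU r).measurable (measurableSet_singleton _)
  rw [h2, integral_indicator_const _ h3, Measure.real, h1, ENNReal.toReal_prod]
  have h4 : ∀ r, (P (U r ⁻¹' {permMat (σ r)})).toReal = 1 / (N.factorial : ℝ) :=
    fun r => (hU r).uniform (σ r)
  simp [h4]

variable [IsProbabilityMeasure P]

variable {f : Fin s × ℕ × ℕ → Ω → ℂ} {y : (Fin s → Equiv.Perm (Fin N)) →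
  (Fin s ⊕ Fin s) × Bool → Matrix (Fin N) (Fin N) (GaussRing s)}

theorem hasAllMoments_monomialTraces (hf : IsComplexGaussianFamily P f)
    (hU : ∀ r, IsUniformPermMatrix P (U r)) (hy : Represents f y V)
    (L : List (List ((Fin s ⊕ Fin s) × Bool))) :
    HasAllMoments P fun ω => monomialTraces (fun i => Sum.elim U V i ω) L := by
  simp only [monomialTraces_eq_sum hU]
  refine HasAllMoments.sum _ fun σ _ => HasAllMoments.mul ?_ ?_
  · intro r hr
    refine MemLp.of_bound (C := 1) ?_ (ae_of_all _ fun ω => ?_)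
    · refine Measurable.aestronglyMeasurable ?_
      exact (measurable_const.indicator (measurableSet_singleton _)).comp
        (measurable_pi_lambda _ fun r => (hU r).measurable)
    · refine (norm_indicator_le_norm_self _ _).trans ?_
      simp
  · have h := hasAllMoments_evalAt hf.measurable_reIm hf.law_reIm (trProd (y σ) L)
    simp only [hy.evalAt_trProd] at h
    exact h

/-- Independence separates each indicator, of probability `(1/N!)^s`, from the Gaussian factor with
frozen permutations. -/
theorem integral_monomialTraces (hf : IsComplexGaussianFamily P f)
    (hU : ∀ r, IsUniformPermMatrix P (U r)) (hV : ∀ r, Measurable (V r))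
    (hind : iIndepFun (Sum.elim U V) P) (hy : Represents f y V)
    (L : List (List ((Fin s ⊕ Fin s) × Bool))) :
    ∫ ω, monomialTraces (fun i => Sum.elim U V i ω) L ∂P = permExp hf y L := by
  have hindep := indepFun_of_iIndepFun_elim (fun r => (hU r).measurable) hV hind
  have hUm : Measurable fun ω r => U r ω := measurable_pi_lambda _ fun r => (hU r).measurable
  have hVm : Measurable fun ω r => V r ω := measurable_pi_lambda _ hV
  have hmom : ∀ σ : Fin s → Equiv.Perm (Fin N), HasAllMoments P fun ω =>
      monomialTraces (Sum.elim (fun r => permMat (σ r)) fun r => V r ω) L := by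
    intro σ
    have h := hasAllMoments_evalAt hf.measurable_reIm hf.law_reIm (trProd (y σ) L)
    simp only [hy.evalAt_trProd] at h
    exact h
  have hI : ∀ σ : Fin s → Equiv.Perm (Fin N), Measurable
      (({fun r => permMat (σ r)} : Set (Fin s → Matrix (Fin N) (Fin N) ℂ)).indicator
        (fun _ => (1 : ℂ))) := fun σ => measurable_const.indicator (measurableSet_singleton _)
  simp only [monomialTraces_eq_sum hU]
  rw [integral_finsetSum _ fun σ _ => ?_]
  · rw [permExp, Finset.mul_sum]
    refine Finset.sum_congr rfl fun σ _ => ?_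
    rw [hindep.integral_fun_comp_mul_comp
      (g := fun v => monomialTraces (Sum.elim (fun r => permMat (σ r)) v) L)
      hUm.aemeasurable hVm.aemeasurable (hI σ).aestronglyMeasurable
      (measurable_monomialTraces _ L).aestronglyMeasurable,
      integral_indicator_permMat hU hind]
    congr 1
    change _ = ∫ ω, evalAt (reIm f) ω (trProd (y σ) L) ∂P
    simp only [hy.evalAt_trProd]
    rfl
  · refine Integrable.bdd_mul (c := 1) (hmom σ).integrable
      ((hI σ).comp hUm).aestronglyMeasurable (ae_of_all _ fun ω => ?_)
    refine (norm_indicator_le_norm_self _ _).trans ?_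
    simp

end Conditioning

/-! ### Asymptotics of solutions of Schwinger–Dyson equations -/

section TraceSystem

variable {β : Type*}

/-- The sum of the degrees of the words in `L`. -/
def totalDeg (deg : List β → ℕ) (L : List (List β)) : ℕ := (L.map deg).sum

theorem totalDeg_append (deg : List β → ℕ) (L L' : List (List β)) :
    totalDeg deg (L ++ L') = totalDeg deg L + totalDeg deg L' := by simp [totalDeg]

theorem totalDeg_cons (deg : List β → ℕ) (A : List β) (L : List (List β)) :
    totalDeg deg (A :: L) = deg A + totalDeg deg L := by simp [totalDeg]

theorem totalDeg_perm (deg : List β → ℕ) {L L' : List (List β)} (h : L.Perm L') :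
    totalDeg deg L = totalDeg deg L' := (h.map deg).sum_eq

theorem exists_perm_cons_of_totalDeg_pos {deg : List β → ℕ} {L : List (List β)}
    (h : 0 < totalDeg deg L) : ∃ A L', 0 < deg A ∧ L.Perm (A :: L') := by
  classical
  by_contra! hL
  have h0 : ∀ A ∈ L, deg A = 0 := by
    intro A hA
    by_contra hne
    exact hL A (L.erase A) (Nat.pos_of_ne_zero hne) (List.perm_cons_erase hA)
  have : totalDeg deg L = 0 := by
    refine List.sum_eq_zero fun x hx => ?_
    obtain ⟨A, hA, rfl⟩ := List.mem_map.1 hx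
    exact h0 A hA
  omega

theorem deg_eq_zero_of_totalDeg_eq_zero {deg : List β → ℕ} {L : List (List β)}
    (h : totalDeg deg L = 0) {A : List β} (hA : A ∈ L) : deg A = 0 := by
  have h1 := List.single_le_sum (l := L.map deg) (fun _ _ => Nat.zero_le _) _
    (List.mem_map_of_mem hA)
  rw [totalDeg] at h
  omega

/-- A sequence of functionals on lists of words that satisfies, up to an error of order `δ`,
recursive equations lowering the degree; `F` is the solution of the limiting equations. -/
structure TraceSystem (deg : List β → ℕ) (δ : ℕ → ℝ) (T : ℕ → List (List β) → ℂ)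
    (F : List β → ℂ) : Prop where
  perm : ∀ q L L', L.Perm L' → T q L = T q L'
  tendsto_zero : Tendsto δ atTop (𝓝 0)
  base_tendsto : ∀ L, (∀ A ∈ L, deg A = 0) →
    Tendsto (fun q => T q L) atTop (𝓝 (L.map F).prod)
  base_factor : ∀ L L', (∀ A ∈ L, deg A = 0) → (∀ A ∈ L', deg A = 0) →
    (fun q => T q (L ++ L') - T q L * T q L') =O[atTop] δ
  recursion : ∀ A, 0 < deg A → ∃ R : List ((ℕ → ℂ) × ℂ × List (List β)),
    (∀ t ∈ R, Tendsto t.1 atTop (𝓝 t.2.1) ∧ totalDeg deg t.2.2 < deg A) ∧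
    F A = (R.map fun t => t.2.1 * (t.2.2.map F).prod).sum ∧
    ∀ L, ∃ E : List (List (List β)), (∀ K ∈ E, totalDeg deg K < deg A + totalDeg deg L) ∧
      ∀ᶠ q in atTop, T q (A :: L) =
        (R.map fun t => t.1 q * T q (t.2.2 ++ L)).sum + δ q * (E.map fun K => T q K).sum

variable {deg : List β → ℕ} {δ : ℕ → ℝ} {T : ℕ → List (List β) → ℂ} {F : List β → ℂ}

/-- Strong induction on the total degree: the recursion lowers it in every term, and the error list
is multiplied by `δ → 0`. Its limit need not be identified, only shown to exist. -/
theorem TraceSystem.tendsto (h : TraceSystem deg δ T F) (L : List (List β)) :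
    Tendsto (fun q => T q L) atTop (𝓝 (L.map F).prod) := by
  induction hn : totalDeg deg L using Nat.strong_induction_on generalizing L with
  | _ n ih =>
    subst hn
    rcases Nat.eq_zero_or_pos (totalDeg deg L) with h0 | hpos
    · exact h.base_tendsto L fun A hA => deg_eq_zero_of_totalDeg_eq_zero h0 hA
    · obtain ⟨A, L', hA, hperm⟩ := exists_perm_cons_of_totalDeg_pos hpos
      obtain ⟨R, hR, hF, hrec⟩ := h.recursion A hA
      obtain ⟨E, hE, hT⟩ := hrec L'
      have hdeg := totalDeg_perm deg hperm
      rw [totalDeg_cons] at hdeg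
      simp only [fun q => h.perm q L _ hperm]
      rw [(hperm.map F).prod_eq]
      have h1 : Tendsto (fun q => (R.map fun t => t.1 q * T q (t.2.2 ++ L')).sum) atTop
          (𝓝 (R.map fun t => t.2.1 * ((t.2.2 ++ L').map F).prod).sum) := by
        refine tendsto_list_sum _ fun t ht => (hR t ht).1.mul (ih _ ?_ _ rfl)
        have := (hR t ht).2
        rw [totalDeg_append]
        omega
      have h2 : Tendsto (fun q => (E.map fun K => T q K).sum) atTop
          (𝓝 (E.map fun K => (K.map F).prod).sum) := by
        refine tendsto_list_sum _ fun K hK => ih _ ?_ _ rfl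
        have := hE K hK
        omega
      have h3 : Tendsto (fun q => (δ q : ℂ)) atTop (𝓝 0) := by
        simpa [Function.comp_def] using (Complex.continuous_ofReal.tendsto 0).comp h.tendsto_zero
      have h4 := h1.add (h3.mul h2)
      rw [zero_mul, add_zero] at h4
      have h5 : (R.map fun t => t.2.1 * ((t.2.2 ++ L').map F).prod).sum =
          ((A :: L').map F).prod := by
        rw [List.map_cons, List.prod_cons, hF, ← List.sum_map_mul_right]
        simp only [List.map_append, List.prod_append, mul_assoc]
      rw [h5] at h4
      exact h4.congr' (hT.mono fun q hq => hq.symm)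

theorem isBigO_list_sum {α : Type*} (l : List α) {g : α → ℕ → ℂ}
    (hg : ∀ a ∈ l, g a =O[atTop] δ) : (fun q => (l.map fun a => g a q).sum) =O[atTop] δ := by
  induction l with
  | nil => simpa using Asymptotics.isBigO_zero δ atTop
  | cons a l ih =>
    simp only [List.map_cons, List.sum_cons]
    exact (hg a (List.mem_cons_self ..)).add (ih fun b hb => hg b (List.mem_cons_of_mem _ hb))

/-- The coefficients `R` depend on the leading word only, not on its companions. Hence the
factorization defect satisfies the same recursion up to terms `δ` times bounded sequences, and
induction reduces it to words of degree zero. -/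
theorem TraceSystem.isBigO (h : TraceSystem deg δ T F) (L₁ L₂ : List (List β)) :
    (fun q => T q (L₁ ++ L₂) - T q L₁ * T q L₂) =O[atTop] δ := by
  have hbdd : ∀ L, (fun q => T q L) =O[atTop] (fun _ => (1 : ℝ)) :=
    fun L => (h.tendsto L).isBigO_one ℝ
  have hδ : ∀ L, (fun q => (δ q : ℂ) * T q L) =O[atTop] δ := by
    intro L
    have h1 : (fun q => (δ q : ℂ)) =O[atTop] δ :=
      Asymptotics.isBigO_of_le _ fun q => by simp
    simpa using h1.mul (hbdd L)
  induction hn : totalDeg deg L₁ + totalDeg deg L₂ using Nat.strong_induction_on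
    generalizing L₁ L₂ with
  | _ n ih =>
    subst hn
    -- The reduction acts on the first list; if that one has degree zero, the lists are exchanged.
    have step : ∀ K₁ K₂, totalDeg deg K₁ + totalDeg deg K₂ = totalDeg deg L₁ + totalDeg deg L₂ →
        0 < totalDeg deg K₁ → (fun q => T q (K₁ ++ K₂) - T q K₁ * T q K₂) =O[atTop] δ := by
      intro K₁ K₂ hsum hpos
      obtain ⟨A, L', hA, hperm⟩ := exists_perm_cons_of_totalDeg_pos hpos
      obtain ⟨R, hR, hF, hrec⟩ := h.recursion A hA
      obtain ⟨E₁, hE₁, hT₁⟩ := hrec (L' ++ K₂)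
      obtain ⟨E₂, hE₂, hT₂⟩ := hrec L'
      have hdeg := totalDeg_perm deg hperm
      rw [totalDeg_cons] at hdeg
      simp only [fun q => h.perm q K₁ _ hperm, fun q => h.perm q (K₁ ++ K₂) _ (hperm.append_right K₂),
        List.cons_append]
      have h1 : (fun q => (R.map fun t => t.1 q * (T q ((t.2.2 ++ L') ++ K₂) -
          T q (t.2.2 ++ L') * T q K₂)).sum) =O[atTop] δ := by
        refine isBigO_list_sum R fun t ht => ?_
        have h2 := ih _ (by
          have := (hR t ht).2
          rw [totalDeg_append]
          omega) (t.2.2 ++ L') K₂ rfl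
        simpa using ((hR t ht).1.isBigO_one ℝ).mul h2
      have h2 : (fun q => (E₁.map fun K => (δ q : ℂ) * T q K).sum) =O[atTop] δ :=
        isBigO_list_sum E₁ fun K _ => hδ K
      have h3 : (fun q => (E₂.map fun K => (δ q : ℂ) * T q K).sum * T q K₂) =O[atTop] δ := by
        simpa using (isBigO_list_sum E₂ fun K _ => hδ K).mul (hbdd K₂)
      refine ((h1.add h2).sub h3).congr' ?_ EventuallyEq.rfl
      filter_upwards [hT₁, hT₂] with q hq₁ hq₂
      rw [hq₁, hq₂, List.sum_map_mul_left, List.sum_map_mul_left, add_mul,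
        ← List.sum_map_mul_right]
      have h4 : (R.map fun t => t.1 q * (T q ((t.2.2 ++ L') ++ K₂) -
          T q (t.2.2 ++ L') * T q K₂)).sum = (R.map fun t => t.1 q * T q (t.2.2 ++ (L' ++ K₂))).sum -
            (R.map fun t => t.1 q * T q (t.2.2 ++ L') * T q K₂).sum := by
        rw [eq_sub_iff_add_eq, ← List.sum_map_add]
        simp only [mul_sub, List.append_assoc, mul_assoc, sub_add_cancel]
      rw [h4]
      ring
    rcases Nat.eq_zero_or_pos (totalDeg deg L₁) with h1 | h1
    · rcases Nat.eq_zero_or_pos (totalDeg deg L₂) with h2 | h2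
      · exact h.base_factor L₁ L₂ (fun A hA => deg_eq_zero_of_totalDeg_eq_zero h1 hA)
          (fun A hA => deg_eq_zero_of_totalDeg_eq_zero h2 hA)
      · have := step L₂ L₁ (add_comm _ _) h2
        simpa only [fun q => h.perm q (L₂ ++ L₁) _ List.perm_append_comm, mul_comm] using this
    · exact step L₁ L₂ rfl h1

end TraceSystem

/-! ### Words in permutations -/

section PermWords

variable {s N : ℕ}

/-- The number of letters of a monomial that are not permutation matrices. -/
def matDeg (A : List ((Fin s ⊕ Fin s) × Bool)) : ℕ := A.countP fun x => x.1.isRight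

theorem exists_permWord_of_matDeg_eq_zero {A : List ((Fin s ⊕ Fin s) × Bool)}
    (hA : matDeg A = 0) : ∃ B, permWord B = A := by
  induction A with
  | nil => exact ⟨[], rfl⟩
  | cons x A ih =>
    obtain ⟨r | r, ε⟩ := x
    · obtain ⟨B, hB⟩ := ih (by simpa [matDeg] using hA)
      exact ⟨(r, !ε) :: B, by simpa [permWord] using hB⟩
    · simp [matDeg] at hA

theorem exists_map_permWord_of_matDeg_eq_zero {L : List (List ((Fin s ⊕ Fin s) × Bool))}
    (hL : ∀ A ∈ L, matDeg A = 0) :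
    ∃ L' : List (List (Fin s × Bool)), L'.map permWord = L := by
  induction L with
  | nil => exact ⟨[], rfl⟩
  | cons A L ih =>
    obtain ⟨B, hB⟩ := exists_permWord_of_matDeg_eq_zero (hL A (List.mem_cons_self ..))
    obtain ⟨L', hL'⟩ := ih fun A hA => hL A (List.mem_cons_of_mem _ hA)
    exact ⟨B :: L', by simp [hB, hL']⟩

/-- The average of a function of independent uniformly distributed permutations. -/
noncomputable def permAvg (g : (Fin s → Equiv.Perm (Fin N)) → ℝ) : ℝ :=
  ((N.factorial : ℝ) ^ s)⁻¹ * ∑ σ, g σ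

theorem permAvg_mono {g h : (Fin s → Equiv.Perm (Fin N)) → ℝ} (hgh : ∀ σ, g σ ≤ h σ) :
    permAvg g ≤ permAvg h :=
  mul_le_mul_of_nonneg_left (Finset.sum_le_sum fun σ _ => hgh σ) (by positivity)

theorem permAvg_const (a : ℝ) : permAvg (fun _ : Fin s → Equiv.Perm (Fin N) => a) = a := by
  have h : ((N.factorial : ℝ) ^ s) ≠ 0 := by positivity
  simp [permAvg, Fintype.card_perm, h]

theorem permAvg_add (g h : (Fin s → Equiv.Perm (Fin N)) → ℝ) :
    permAvg (fun σ => g σ + h σ) = permAvg g + permAvg h := by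
  simp only [permAvg, Finset.sum_add_distrib, mul_add]

theorem permAvg_const_mul (a : ℝ) (g : (Fin s → Equiv.Perm (Fin N)) → ℝ) :
    permAvg (fun σ => a * g σ) = a * permAvg g := by
  simp only [permAvg, ← Finset.mul_sum]
  ring

/-- The variance of a function of independent uniformly distributed permutations. -/
noncomputable def permVar (g : (Fin s → Equiv.Perm (Fin N)) → ℝ) : ℝ :=
  permAvg (fun σ => g σ ^ 2) - permAvg g ^ 2

theorem permVar_nonneg (g : (Fin s → Equiv.Perm (Fin N)) → ℝ) : 0 ≤ permVar g := by
  have h1 : 0 ≤ permAvg fun σ => (g σ - permAvg g) ^ 2 := by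
    have := permAvg_mono (g := fun _ => 0) fun σ => sq_nonneg (g σ - permAvg g)
    rwa [permAvg_const] at this
  have h2 : (fun σ => (g σ - permAvg g) ^ 2) =
      fun σ => (g σ ^ 2 + (-2 * permAvg g) * g σ) + permAvg g ^ 2 := by
    funext σ
    ring
  rw [h2, permAvg_add, permAvg_add, permAvg_const_mul, permAvg_const] at h1
  rw [permVar]
  linarith

/-- Both `g + h` and `g - h` have nonnegative variance, which bounds the covariance from both sides.
-/
theorem abs_permAvg_mul_sub_le (g h : (Fin s → Equiv.Perm (Fin N)) → ℝ) :
    |permAvg (fun σ => g σ * h σ) - permAvg g * permAvg h| ≤ (permVar g + permVar h) / 2 := by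
  have key : ∀ a : ℝ, a ^ 2 = 1 → 0 ≤ permVar g + permVar h +
      2 * a * (permAvg (fun σ => g σ * h σ) - permAvg g * permAvg h) := by
    intro a ha
    have h1 := permVar_nonneg fun σ => g σ + a * h σ
    have h2 : (fun σ => (g σ + a * h σ) ^ 2) =
        fun σ => (g σ ^ 2 + (2 * a) * (g σ * h σ)) + h σ ^ 2 := by
      funext σ
      linear_combination h σ ^ 2 * ha
    rw [permVar, h2, permAvg_add, permAvg_add, permAvg_add, permAvg_const_mul,
      permAvg_const_mul] at h1
    simp only [permVar]
    linear_combination h1 - permAvg h ^ 2 * ha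
  have h1 := key 1 (by norm_num)
  have h2 := key (-1) (by norm_num)
  rw [abs_le]
  constructor <;> linarith

theorem fixFraction_nonneg (σ : Fin s → Equiv.Perm (Fin N)) (B : List (Fin s × Bool)) :
    0 ≤ fixFraction σ B := by
  rw [fixFraction]
  positivity

theorem fixFraction_le_one (σ : Fin s → Equiv.Perm (Fin N)) (B : List (Fin s × Bool)) :
    fixFraction σ B ≤ 1 := by
  have h : fixCount (FreeGroup.lift σ (FreeGroup.mk B)) ≤ N :=
    (Finset.card_le_univ _).trans_eq (Fintype.card_fin N)
  rw [fixFraction, one_div_mul_eq_div]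
  exact div_le_one_of_le₀ (by exact_mod_cast h) (Nat.cast_nonneg N)

theorem fixFraction_of_eq_one (hN : N ≠ 0) (σ : Fin s → Equiv.Perm (Fin N))
    {B : List (Fin s × Bool)} (hB : FreeGroup.mk B = 1) : fixFraction σ B = 1 := by
  simp [fixFraction, hB, fixCount, hN]

theorem prod_fixFraction_nonneg (σ : Fin s → Equiv.Perm (Fin N)) (L : List (List (Fin s × Bool))) :
    0 ≤ (L.map (fixFraction σ)).prod :=
  List.prod_nonneg fun x hx => by
    obtain ⟨B, _, rfl⟩ := List.mem_map.1 hx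
    exact fixFraction_nonneg σ B

theorem prod_fixFraction_le (σ : Fin s → Equiv.Perm (Fin N)) {L : List (List (Fin s × Bool))}
    {B : List (Fin s × Bool)} (hB : B ∈ L) : (L.map (fixFraction σ)).prod ≤ fixFraction σ B := by
  have h1 : ∀ L : List (List (Fin s × Bool)), (L.map (fixFraction σ)).prod ≤ 1 := by
    intro L
    induction L with
    | nil => simp
    | cons A L ih =>
      rw [List.map_cons, List.prod_cons]
      exact mul_le_one₀ (fixFraction_le_one σ A) (prod_fixFraction_nonneg σ L) ih
  induction L with
  | nil => simp at hB
  | cons A L ih =>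
    rw [List.map_cons, List.prod_cons]
    rcases List.mem_cons.1 hB with rfl | hB'
    · exact mul_le_of_le_one_right (fixFraction_nonneg σ B) (h1 L)
    · exact (mul_le_of_le_one_left (prod_fixFraction_nonneg σ L) (fixFraction_le_one σ A)).trans
        (ih hB')

theorem prod_fixFraction_eq_one (hN : N ≠ 0) (σ : Fin s → Equiv.Perm (Fin N))
    {L : List (List (Fin s × Bool))} (hL : ∀ B ∈ L, FreeGroup.mk B = 1) :
    (L.map (fixFraction σ)).prod = 1 :=
  List.prod_eq_one fun x hx => by
    obtain ⟨B, hB, rfl⟩ := List.mem_map.1 hx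
    exact fixFraction_of_eq_one hN σ (hL B hB)

/-- All factors lie in `[0, 1]`, so a single non-trivial word controls the whole product. -/
theorem exists_permAvg_sq_le {L : List (List (Fin s × Bool))} {B : List (Fin s × Bool)}
    (hB : B ∈ L) (hne : FreeGroup.mk B ≠ 1) : ∃ C : ℝ, ∃ N₀ : ℕ, ∀ N ≥ N₀,
      permAvg (fun σ : Fin s → Equiv.Perm (Fin N) => (L.map (fixFraction σ)).prod ^ 2) ≤
        C * (1 / (N : ℝ) ^ 2) := by
  obtain ⟨C, N₀, hC⟩ := exists_sum_fixCount_sq_le hne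
  refine ⟨C, N₀, fun N hN => ?_⟩
  have h1 : permAvg (fun σ : Fin s → Equiv.Perm (Fin N) => (L.map (fixFraction σ)).prod ^ 2) ≤
      permAvg fun σ : Fin s → Equiv.Perm (Fin N) => fixFraction σ B ^ 2 :=
    permAvg_mono fun σ => pow_le_pow_left₀ (prod_fixFraction_nonneg σ L) (prod_fixFraction_le σ hB) 2
  refine h1.trans ?_
  have h2 := hC N hN
  rw [Fintype.card_fin] at h2
  simp only [fixFraction, mul_pow]
  rw [permAvg_const_mul, permAvg]
  have h3 : (0 : ℝ) < (N.factorial : ℝ) ^ s := by positivity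
  calc (1 / (N : ℝ)) ^ 2 * (((N.factorial : ℝ) ^ s)⁻¹ * _)
      ≤ (1 / (N : ℝ)) ^ 2 * (((N.factorial : ℝ) ^ s)⁻¹ * ((N.factorial : ℝ) ^ s * C)) := by
        gcongr
    _ = C * (1 / (N : ℝ) ^ 2) := by
        rw [inv_mul_cancel_left₀ h3.ne']
        ring

/-- Either all words are trivial and the product is constant for `N ≥ 1`, or a non-trivial word
bounds already the second moment. -/
theorem exists_permVar_le (L : List (List (Fin s × Bool))) : ∃ C : ℝ, ∃ N₀ : ℕ, ∀ N ≥ N₀,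
    permVar (fun σ : Fin s → Equiv.Perm (Fin N) => (L.map (fixFraction σ)).prod) ≤
      C * (1 / (N : ℝ) ^ 2) := by
  by_cases hL : ∀ B ∈ L, FreeGroup.mk B = 1
  · refine ⟨0, 1, fun N hN => ?_⟩
    simp only [permVar, prod_fixFraction_eq_one (Nat.one_le_iff_ne_zero.1 hN) _ hL, permAvg_const]
    simp
  · push Not at hL
    obtain ⟨B, hB, hne⟩ := hL
    obtain ⟨C, N₀, hC⟩ := exists_permAvg_sq_le hB hne
    refine ⟨C, N₀, fun N hN => le_trans ?_ (hC N hN)⟩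
    rw [permVar]
    exact sub_le_self _ (sq_nonneg _)

end PermWords

/-! ### The Schwinger–Dyson equations for the random matrices -/

section Instances

variable {s : ℕ}

theorem matDeg_append (A B : List ((Fin s ⊕ Fin s) × Bool)) :
    matDeg (A ++ B) = matDeg A + matDeg B := by simp [matDeg]

theorem matDeg_inr_cons (r : Fin s) (ε : Bool) (A : List ((Fin s ⊕ Fin s) × Bool)) :
    matDeg ((Sum.inr r, ε) :: A) = matDeg A + 1 := List.countP_cons_of_pos rfl

theorem matDeg_of_mem_splits {m : (Fin s ⊕ Fin s) × Bool → Bool}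
    (hm : ∀ x, m x = true → x.1.isRight) {A : List ((Fin s ⊕ Fin s) × Bool)}
    {p : List ((Fin s ⊕ Fin s) × Bool) × List ((Fin s ⊕ Fin s) × Bool)} (hp : p ∈ splits m A) :
    matDeg p.1 + matDeg p.2 < matDeg A := by
  induction A generalizing p with
  | nil => simp [splits] at hp
  | cons x A ih =>
    rw [splits, List.mem_append] at hp
    rcases hp with hp | hp
    · by_cases hx : m x = true
      · rw [if_pos hx, List.mem_singleton] at hp
        subst hp
        simp [matDeg, hm x hx]
      · simp [hx] at hp
    · obtain ⟨p', hp', rfl⟩ := List.mem_map.1 hp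
      have := ih hp'
      simp only [matDeg, List.countP_cons] at this ⊢
      omega

theorem perm_of_mem_picks {α : Type*} {L : List α} {p : α × List α} (hp : p ∈ picks L) :
    L.Perm (p.1 :: p.2) := by
  induction L generalizing p with
  | nil => simp [picks] at hp
  | cons a L ih =>
    rw [picks, List.mem_cons] at hp
    rcases hp with rfl | hp
    · exact List.Perm.refl _
    · obtain ⟨p', hp', rfl⟩ := List.mem_map.1 hp
      exact ((ih hp').cons a).trans (List.Perm.swap _ _ _)

theorem totalDeg_of_mem_insertions {m : (Fin s ⊕ Fin s) × Bool → Bool}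
    (hm : ∀ x, m x = true → x.1.isRight) {A : List ((Fin s ⊕ Fin s) × Bool)}
    {L K : List (List ((Fin s ⊕ Fin s) × Bool))} (hK : K ∈ insertions m A L) :
    totalDeg matDeg K < matDeg A + totalDeg matDeg L := by
  obtain ⟨p, hp, hK⟩ := List.mem_flatMap.1 hK
  obtain ⟨q, hq, rfl⟩ := List.mem_map.1 hK
  have h1 := matDeg_of_mem_splits hm hq
  rw [totalDeg_perm matDeg (perm_of_mem_picks hp), totalDeg_cons, totalDeg_cons, matDeg_append,
    matDeg_append]
  omega

theorem exists_inr_of_matDeg_pos {A : List ((Fin s ⊕ Fin s) × Bool)} (hA : 0 < matDeg A) :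
    ∃ B C r ε, A = B ++ (Sum.inr r, ε) :: C := by
  obtain ⟨x, hx, hr⟩ := List.countP_pos_iff.1 hA
  obtain ⟨B, C, rfl⟩ := List.append_of_mem hx
  obtain ⟨r | r, ε⟩ := x
  · simp at hr
  · exact ⟨B, C, r, ε, rfl⟩

variable {Ω : Type*} [MeasurableSpace Ω] {P : Measure Ω} [IsProbabilityMeasure P]
  {f : Fin s × ℕ × ℕ → Ω → ℂ} (hf : IsComplexGaussianFamily P f)

theorem schwingerDyson_permExp_gauss (N : ℕ) (r : Fin s) (ε : Bool)
    (A : List ((Fin s ⊕ Fin s) × Bool)) (L : List (List ((Fin s ⊕ Fin s) × Bool))) :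
    permExp hf (gaussLetter (N := N)) (((Sum.inr r, ε) :: A) :: L) =
      ((splits (fun x => decide (x = (Sum.inr r, !ε))) A).map fun p =>
        permExp hf (gaussLetter (N := N)) (p.1 :: p.2 :: L)).sum +
      1 / (N : ℂ) ^ 2 * ((insertions (fun x => decide (x = (Sum.inr r, !ε))) A L).map fun K =>
        permExp hf (gaussLetter (N := N)) K).sum := by
  have h : ∀ σ : Fin s → Equiv.Perm (Fin N), _ :=
    fun σ => schwingerDyson_gaussLetter hf σ r ε A L
  simp only [permExp, h, Finset.sum_add_distrib, ← Finset.mul_sum,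
    sum_list_sum_comm, List.sum_map_mul_left]
  ring

theorem schwingerDyson_permExp_wishart (M N : ℕ) (r : Fin s) (ε : Bool)
    (A : List ((Fin s ⊕ Fin s) × Bool)) (L : List (List ((Fin s ⊕ Fin s) × Bool))) :
    permExp hf (wishartLetter (N := N) M) (((Sum.inr r, ε) :: A) :: L) =
      (M : ℂ) / N * permExp hf (wishartLetter (N := N) M) (A :: L) +
      ((splits (fun x => decide (x.1 = Sum.inr r)) A).map fun p =>
        permExp hf (wishartLetter (N := N) M) (((Sum.inr r, ε) :: p.1) :: p.2 :: L)).sum +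
      1 / (N : ℂ) ^ 2 * ((insertions (fun x => decide (x.1 = Sum.inr r))
        ((Sum.inr r, ε) :: A) L).map fun K => permExp hf (wishartLetter (N := N) M) K).sum := by
  have h : ∀ σ : Fin s → Equiv.Perm (Fin N), _ :=
    fun σ => schwingerDyson_wishartLetter hf M σ r ε A L
  simp only [permExp, h, Finset.sum_add_distrib, ← Finset.mul_sum,
    sum_list_sum_comm, List.sum_map_mul_left]
  ring

theorem map_evalMonomial_append_comm {𝒜 : Type*} [Ring 𝒜] [StarRing 𝒜] [Algebra ℂ 𝒜]
    {φ : 𝒜 →ₗ[ℂ] ℂ} (hφ : IsTracialState φ) {I : Type*} (x : I → 𝒜)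
    (A B : List (I × Bool)) :
    φ (evalMonomial x (A ++ B)) = φ (evalMonomial x (B ++ A)) := by
  simp only [evalMonomial, List.map_append, List.prod_append]
  exact hφ.tracial _ _

variable {𝒜 : Type*} [Ring 𝒜] [StarRing 𝒜] [Algebra ℂ 𝒜] [StarModule ℂ 𝒜] {φ : 𝒜 →ₗ[ℂ] ℂ}

theorem IsStarFree.comp {J I : Type*} {x : J → 𝒜} (hx : IsStarFree φ x) {g : I → J}
    (hg : Function.Injective g) : IsStarFree φ fun i => x (g i) :=
  fun n j A hj hA h0 => hx n (fun i => g (j i)) A (fun i h => hj i (hg h)) hA h0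

theorem map_evalMonomial_permWord (hφ : φ 1 = 1) {u z : Fin s → 𝒜}
    (hu : ∀ r, IsHaarUnitary φ (u r)) (hfree : IsStarFree φ (Sum.elim u z))
    (B : List (Fin s × Bool)) :
    φ (evalMonomial (Sum.elim u z) (permWord B)) = if FreeGroup.mk B = 1 then 1 else 0 := by
  have hfree' : IsStarFree φ u := hfree.comp (g := Sum.inl) Sum.inl_injective
  rw [← map_haar_word hφ hu hfree' B, evalMonomial, permWord, List.map_map]
  congr 3
  funext p
  cases h : p.2 <;> simp [h]

theorem prod_map_evalMonomial_permWord (hφ : φ 1 = 1) {u z : Fin s → 𝒜}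
    (hu : ∀ r, IsHaarUnitary φ (u r)) (hfree : IsStarFree φ (Sum.elim u z))
    (L : List (List (Fin s × Bool))) :
    ((L.map permWord).map fun A => φ (evalMonomial (Sum.elim u z) A)).prod =
      if ∀ B ∈ L, FreeGroup.mk B = 1 then 1 else 0 := by
  rw [List.map_map]
  split_ifs with h
  · refine List.prod_eq_one fun x hx => ?_
    obtain ⟨B, hB, rfl⟩ := List.mem_map.1 hx
    rw [Function.comp_apply, map_evalMonomial_permWord hφ hu hfree, if_pos (h B hB)]
  · push Not at h
    obtain ⟨B, hB, hne⟩ := h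
    refine List.prod_eq_zero (List.mem_map.2 ⟨B, hB, ?_⟩)
    rw [Function.comp_apply, map_evalMonomial_permWord hφ hu hfree, if_neg hne]

variable {N : ℕ → ℕ} {y : ∀ q, (Fin s → Equiv.Perm (Fin (N q))) → (Fin s ⊕ Fin s) × Bool →
  Matrix (Fin (N q)) (Fin (N q)) (GaussRing s)}

theorem tendsto_one_div_sq (hN : Tendsto N atTop atTop) :
    Tendsto (fun q => 1 / (N q : ℝ) ^ 2) atTop (𝓝 0) := by
  have h1 := tendsto_one_div_atTop_nhds_zero_nat (𝕜 := ℝ)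
  have h2 := (h1.comp hN).pow 2
  simpa [Function.comp_def] using h2

/-- The reduction of the asymptotics of the traces to the Schwinger–Dyson equations. -/
theorem traceSystem_permExp (hφ : φ 1 = 1) {u z : Fin s → 𝒜}
    (hu : ∀ r, IsHaarUnitary φ (u r)) (hfree : IsStarFree φ (Sum.elim u z))
    (hN : Tendsto N atTop atTop) (hy : ∀ q σ r ε, y q σ (Sum.inl r, ε) = permLetter σ r ε)
    (hrec : ∀ A, 0 < matDeg A → ∃ R : List ((ℕ → ℂ) × ℂ × List (List ((Fin s ⊕ Fin s) × Bool))),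
      (∀ t ∈ R, Tendsto t.1 atTop (𝓝 t.2.1) ∧ totalDeg matDeg t.2.2 < matDeg A) ∧
      φ (evalMonomial (Sum.elim u z) A) = (R.map fun t =>
        t.2.1 * (t.2.2.map fun A => φ (evalMonomial (Sum.elim u z) A)).prod).sum ∧
      ∀ L, ∃ E : List (List (List ((Fin s ⊕ Fin s) × Bool))),
        (∀ K ∈ E, totalDeg matDeg K < matDeg A + totalDeg matDeg L) ∧
        ∀ᶠ q in atTop, permExp hf (y q) (A :: L) =
          (R.map fun t => t.1 q * permExp hf (y q) (t.2.2 ++ L)).sum +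
            ((1 / (N q : ℝ) ^ 2 : ℝ) : ℂ) * (E.map fun K => permExp hf (y q) K).sum) :
    TraceSystem matDeg (fun q => 1 / (N q : ℝ) ^ 2) (fun q => permExp hf (y q))
      fun A => φ (evalMonomial (Sum.elim u z) A) where
  perm q L L' h := permExp_perm hf h
  tendsto_zero := tendsto_one_div_sq hN
  base_tendsto L hL := by
    obtain ⟨L, rfl⟩ := exists_map_permWord_of_matDeg_eq_zero hL
    rw [prod_map_evalMonomial_permWord hφ hu hfree]
    simp only [permExp_permWord hf (hy _)]
    split_ifs with h
    · refine tendsto_const_nhds.congr' ?_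
      filter_upwards [hN.eventually_ge_atTop 1] with q hq
      have h1 : ∀ σ : Fin s → Equiv.Perm (Fin (N q)), (L.map (fixFraction σ)).prod = 1 :=
        fun σ => prod_fixFraction_eq_one (Nat.one_le_iff_ne_zero.1 hq) σ h
      simp only [h1]
      have h2 := permAvg_const (s := s) (N := N q) 1
      rw [permAvg] at h2
      rw [h2, Complex.ofReal_one]
    · push Not at h
      obtain ⟨B, hB, hne⟩ := h
      obtain ⟨C, N₀, hC⟩ := exists_permAvg_sq_le hB hne
      rw [← Complex.ofReal_zero]
      refine (Complex.continuous_ofReal.tendsto 0).comp ?_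
      have h1 : Tendsto (fun q => C * (1 / (N q : ℝ) ^ 2)) atTop (𝓝 0) := by
        simpa using (tendsto_one_div_sq hN).const_mul C
      -- The square of the mean is at most the second moment, which is `O(N⁻²)`.
      have h2 : Tendsto (fun q => permAvg (fun σ : Fin s → Equiv.Perm (Fin (N q)) =>
          (L.map (fixFraction σ)).prod) ^ 2) atTop (𝓝 0) := by
        refine squeeze_zero' (Eventually.of_forall fun q => sq_nonneg _) ?_ h1
        filter_upwards [hN.eventually_ge_atTop N₀] with q hq
        have h3 := permVar_nonneg fun σ : Fin s → Equiv.Perm (Fin (N q)) =>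
          (L.map (fixFraction σ)).prod
        rw [permVar] at h3
        exact (sub_nonneg.1 h3).trans (hC _ hq)
      have h3 := h2.sqrt
      rw [Real.sqrt_zero] at h3
      simp only [Real.sqrt_sq_eq_abs] at h3
      exact (tendsto_zero_iff_abs_tendsto_zero _).2 h3
  base_factor L L' hL hL' := by
    obtain ⟨L, rfl⟩ := exists_map_permWord_of_matDeg_eq_zero hL
    obtain ⟨L', rfl⟩ := exists_map_permWord_of_matDeg_eq_zero hL'
    obtain ⟨C, N₀, hC⟩ := exists_permVar_le L
    obtain ⟨C', N₀', hC'⟩ := exists_permVar_le L'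
    refine Asymptotics.IsBigO.of_bound ((C + C') / 2) ?_
    filter_upwards [hN.eventually_ge_atTop N₀, hN.eventually_ge_atTop N₀'] with q hq hq'
    have h0 := permExp_permWord hf (hy q) (L ++ L')
    simp only [List.map_append, List.prod_append] at h0
    rw [h0, permExp_permWord hf (hy q), permExp_permWord hf (hy q), ← Complex.ofReal_mul, ← Complex.ofReal_sub, Complex.norm_real, Real.norm_eq_abs]
    refine (abs_permAvg_mul_sub_le (fun σ : Fin s → Equiv.Perm (Fin (N q)) =>
      (L.map (fixFraction σ)).prod) fun σ => (L'.map (fixFraction σ)).prod).trans ?_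
    have h1 := hC _ hq
    have h2 := hC' _ hq'
    rw [Real.norm_of_nonneg (by positivity)]
    linarith
  recursion := hrec

/-- Traciality on both sides allows a word to be rotated until a Gaussian letter comes first; the
two loop equations then have identical splitting terms. -/
theorem traceSystem_gauss (hφ : IsTracialState φ) {u g : Fin s → 𝒜}
    (hu : ∀ r, IsHaarUnitary φ (u r)) (hg : ∀ r, IsStandardCircular φ (g r))
    (hfree : IsStarFree φ (Sum.elim u g)) (hN : Tendsto N atTop atTop) :
    TraceSystem matDeg (fun q => 1 / (N q : ℝ) ^ 2)
      (fun q => permExp hf (gaussLetter (N := N q)))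
      fun A => φ (evalMonomial (Sum.elim u g) A) := by
  refine traceSystem_permExp hf hφ.map_one hu hfree hN (fun _ _ _ _ => rfl) fun A hA => ?_
  obtain ⟨B, C, r, ε, rfl⟩ := exists_inr_of_matDeg_pos hA
  have hm : ∀ x : (Fin s ⊕ Fin s) × Bool, decide (x = (Sum.inr r, !ε)) = true → x.1.isRight := by
    intro x hx
    rw [of_decide_eq_true hx]
    rfl
  have hdeg : matDeg (B ++ (Sum.inr r, ε) :: C) = matDeg (C ++ B) + 1 := by
    rw [matDeg_append, matDeg_inr_cons, matDeg_append]
    omega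
  refine ⟨(splits (fun x => decide (x = (Sum.inr r, !ε))) (C ++ B)).map fun p =>
    (fun _ => 1, 1, [p.1, p.2]), ?_, ?_, fun L =>
    ⟨insertions (fun x => decide (x = (Sum.inr r, !ε))) (C ++ B) L, ?_, ?_⟩⟩
  · intro t ht
    obtain ⟨p, hp, rfl⟩ := List.mem_map.1 ht
    refine ⟨tendsto_const_nhds, ?_⟩
    have := matDeg_of_mem_splits hm hp
    simp only [totalDeg, List.map_cons, List.map_nil, List.sum_cons, List.sum_nil]
    omega
  · have hSD := IsStandardCircular.schwingerDyson (j := Sum.inr r) hφ hfree (hg r) ε (C ++ B)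
    rw [map_evalMonomial_append_comm hφ, List.cons_append, hSD, List.map_map]
    simp [Function.comp_def]
  · intro K hK
    have := totalDeg_of_mem_insertions hm hK
    omega
  · refine Eventually.of_forall fun q => ?_
    rw [permExp_append_comm, List.cons_append, schwingerDyson_permExp_gauss, List.map_map]
    simp [Function.comp_def]

/-- Here one coefficient varies with `q`, namely `M/N → c`. The splitting terms keep the leading
Wishart letter, but the degree drops because the letter at the cut disappears. -/
theorem traceSystem_wishart {c : ℝ} (hφ : IsTracialState φ) {u w : Fin s → 𝒜}
    (hu : ∀ r, IsHaarUnitary φ (u r)) (hw : ∀ r, IsFreePoisson φ c (w r))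
    (hfree : IsStarFree φ (Sum.elim u w)) (hN : Tendsto N atTop atTop) {M : ℕ → ℕ}
    (hc : Tendsto (fun q => (M q : ℝ) / (N q : ℝ)) atTop (𝓝 c)) :
    TraceSystem matDeg (fun q => 1 / (N q : ℝ) ^ 2)
      (fun q => permExp hf (wishartLetter (N := N q) (M q)))
      fun A => φ (evalMonomial (Sum.elim u w) A) := by
  refine traceSystem_permExp hf hφ.map_one hu hfree hN (fun _ _ _ _ => rfl) fun A hA => ?_
  obtain ⟨B, C, r, ε, rfl⟩ := exists_inr_of_matDeg_pos hA
  have hm : ∀ x : (Fin s ⊕ Fin s) × Bool, decide (x.1 = Sum.inr r) = true → x.1.isRight := by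
    intro x hx
    rw [of_decide_eq_true hx]
    rfl
  have hdeg : matDeg (B ++ (Sum.inr r, ε) :: C) = matDeg (C ++ B) + 1 := by
    rw [matDeg_append, matDeg_inr_cons, matDeg_append]
    omega
  refine ⟨(fun q => (M q : ℂ) / N q, (c : ℂ), [C ++ B]) ::
    (splits (fun x => decide (x.1 = Sum.inr r)) (C ++ B)).map fun p =>
    (fun _ => 1, 1, [(Sum.inr r, ε) :: p.1, p.2]), ?_, ?_, fun L =>
    ⟨insertions (fun x => decide (x.1 = Sum.inr r)) ((Sum.inr r, ε) :: (C ++ B)) L, ?_, ?_⟩⟩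
  · intro t ht
    rcases List.mem_cons.1 ht with rfl | ht
    · refine ⟨?_, by simp [totalDeg, hdeg]⟩
      simpa [Function.comp_def] using (Complex.continuous_ofReal.tendsto c).comp hc
    · obtain ⟨p, hp, rfl⟩ := List.mem_map.1 ht
      refine ⟨tendsto_const_nhds, ?_⟩
      have := matDeg_of_mem_splits hm hp
      simp only [totalDeg, List.map_cons, List.map_nil, List.sum_cons, List.sum_nil,
        matDeg_inr_cons]
      omega
  · have hSD := IsFreePoisson.schwingerDyson (j := Sum.inr r) hφ hfree (hw r) ε (C ++ B)
    rw [map_evalMonomial_append_comm hφ, List.cons_append, hSD, List.map_cons, List.sum_cons,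
      List.map_map]
    simp [Function.comp_def]
  · intro K hK
    have := totalDeg_of_mem_insertions hm hK
    rw [matDeg_inr_cons] at this
    omega
  · refine Eventually.of_forall fun q => ?_
    rw [permExp_append_comm, List.cons_append, schwingerDyson_permExp_wishart, List.map_cons,
      List.sum_cons, List.map_map]
    simp [Function.comp_def]

end Instances

/-! ### Almost sure convergence -/

section AlmostSure

variable {Ω : Type*} [MeasurableSpace Ω] {P : Measure Ω}

/-- By Tonelli the sum of the `‖Y k‖²` has finite mean, so it is almost surely finite and its terms
tend to zero. -/
theorem ae_tendsto_zero_of_summable_integral_sq {Y : ℕ → Ω → ℂ} (hY : ∀ k, MemLp (Y k) 2 P)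
    {b : ℕ → ℝ} (hb : Summable b) (hYb : ∀ k, ∫ ω, ‖Y k ω‖ ^ 2 ∂P ≤ b k) :
    ∀ᵐ ω ∂P, Tendsto (fun k => Y k ω) atTop (𝓝 0) := by
  have hint : ∀ k, Integrable (fun ω => ‖Y k ω‖ ^ 2) P := fun k => (hY k).integrable_norm_pow two_ne_zero
  have h1 : ∀ k, ∫⁻ ω, ENNReal.ofReal (‖Y k ω‖ ^ 2) ∂P ≤ ENNReal.ofReal (b k) := by
    intro k
    rw [← ofReal_integral_eq_lintegral_ofReal (hint k) (ae_of_all _ fun ω => sq_nonneg _)]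
    exact ENNReal.ofReal_le_ofReal (hYb k)
  have hmeas : ∀ k, AEMeasurable (fun ω => ENNReal.ofReal (‖Y k ω‖ ^ 2)) P :=
    fun k => (hint k).aestronglyMeasurable.aemeasurable.ennreal_ofReal
  have h2 : ∫⁻ ω, ∑' k, ENNReal.ofReal (‖Y k ω‖ ^ 2) ∂P ≠ ⊤ := by
    rw [lintegral_tsum hmeas]
    exact ne_top_of_le_ne_top hb.tsum_ofReal_ne_top (ENNReal.tsum_le_tsum h1)
  filter_upwards [ae_lt_top' (AEMeasurable.tsum hmeas) h2] with ω hω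
  have h3 := ENNReal.tendsto_atTop_zero_of_tsum_ne_top hω.ne
  have h4 := (ENNReal.tendsto_toReal ENNReal.zero_ne_top).comp h3
  have h5 : Tendsto (fun k => ‖Y k ω‖ ^ 2) atTop (𝓝 0) := by
    refine h4.congr fun k => ?_
    rw [Function.comp_apply, ENNReal.toReal_ofReal (sq_nonneg _)]
  have h6 := h5.sqrt
  simp only [Real.sqrt_sq (norm_nonneg _), Real.sqrt_zero] at h6
  exact tendsto_zero_iff_norm_tendsto_zero.2 h6

/-- Almost sure convergence along monotone sequences of pairs of indices; the terms with equal
indices coincide, so that it suffices to sum the variances over the values of `M + N`. -/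
theorem ae_tendsto_zero_of_monotone {Z : ℕ → ℕ → Ω → ℂ} {M N : ℕ → ℕ} (hM : Monotone M)
    (hN : Monotone N) (hNt : Tendsto N atTop atTop) {C D : ℝ} (hC : 0 ≤ C) (hN1 : ∀ q, 1 ≤ N q)
    (hD : ∀ q, (M q : ℝ) + N q ≤ D * N q) (hZ : ∀ q, MemLp (Z (M q) (N q)) 2 P)
    (hvar : ∀ q, ∫ ω, ‖Z (M q) (N q) ω‖ ^ 2 ∂P ≤ C * (1 / (N q : ℝ) ^ 2)) :
    ∀ᵐ ω ∂P, Tendsto (fun q => Z (M q) (N q) ω) atTop (𝓝 0) := by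
  classical
  -- The sequence is reindexed by `k = M + N`, with zero at values that are not attained.
  -- Monotonicity of both sequences makes `k` determine the pair, so the choice is immaterial.
  let Y : ℕ → Ω → ℂ := fun k =>
    if h : ∃ q, M q + N q = k then Z (M h.choose) (N h.choose) else 0
  have hinj : ∀ q q', M q + N q = M q' + N q' → M q = M q' ∧ N q = N q' := by
    intro q q' h
    rcases le_total q q' with hq | hq
    · have h1 := hM hq
      have h2 := hN hq
      omega
    · have h1 := hM hq
      have h2 := hN hq
      omega
  have hY : ∀ q, Y (M q + N q) = Z (M q) (N q) := by
    intro q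
    have h : ∃ q', M q' + N q' = M q + N q := ⟨q, rfl⟩
    obtain ⟨h1, h2⟩ := hinj _ _ h.choose_spec
    simp only [Y]
    rw [dif_pos h, h1, h2]
  have hcases : ∀ k, Y k = 0 ∨ ∃ q, M q + N q = k ∧ Y k = Z (M q) (N q) := by
    intro k
    by_cases h : ∃ q, M q + N q = k
    · obtain ⟨q, rfl⟩ := h
      exact Or.inr ⟨q, rfl, hY q⟩
    · exact Or.inl (dif_neg h)
  have hmem : ∀ k, MemLp (Y k) 2 P := by
    intro k
    rcases hcases k with h | ⟨q, _, h⟩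
    · rw [h]
      exact MemLp.zero
    · rw [h]
      exact hZ q
  -- From `M + N ≤ D N` follows `1/N² ≤ D²/(M + N)²`, which is summable over distinct values of `M +
  -- N`.
  have hsum : Summable fun k : ℕ => C * D ^ 2 * (1 / (k : ℝ) ^ 2) :=
    (Real.summable_one_div_nat_pow.2 one_lt_two).mul_left _
  have hbound : ∀ k, ∫ ω, ‖Y k ω‖ ^ 2 ∂P ≤ C * D ^ 2 * (1 / (k : ℝ) ^ 2) := by
    intro k
    rcases hcases k with h | ⟨q, rfl, h⟩
    · rw [h]
      simp only [Pi.zero_apply, norm_zero, ne_eq, OfNat.ofNat_ne_zero, not_false_eq_true, zero_pow,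
        integral_zero]
      positivity
    · rw [h]
      refine (hvar q).trans ?_
      have hNq : (0 : ℝ) < N q := by exact_mod_cast hN1 q
      have hk : (0 : ℝ) < ((M q + N q : ℕ) : ℝ) := by
        push_cast
        positivity
      rw [mul_assoc]
      refine mul_le_mul_of_nonneg_left ?_ hC
      rw [mul_one_div, div_le_div_iff₀ (by positivity) (by positivity), one_mul, ← mul_pow]
      refine pow_le_pow_left₀ hk.le ?_ 2
      push_cast
      exact hD q
  have hk : Tendsto (fun q => M q + N q) atTop atTop :=
    tendsto_atTop_mono (fun q => Nat.le_add_left _ _) hNt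
  filter_upwards [ae_tendsto_zero_of_summable_integral_sq hmem hsum hbound] with ω hω
  have := hω.comp hk
  refine this.congr fun q => ?_
  rw [Function.comp_apply, hY]

variable [IsProbabilityMeasure P]

/-- The variance is left as a complex number so that it matches the factorization defect for a word
and its adjoint. -/
theorem integral_norm_sub_sq {X : Ω → ℂ} (hX : MemLp X 2 P) :
    ((∫ ω, ‖X ω - ∫ ω, X ω ∂P‖ ^ 2 ∂P : ℝ) : ℂ) =
      ∫ ω, X ω * star (X ω) ∂P - (∫ ω, X ω ∂P) * ∫ ω, star (X ω) ∂P := by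
  set m := ∫ ω, X ω ∂P with hm
  have h1 : Integrable X P := hX.integrable one_le_two
  have h2 : Integrable (fun ω => star (X ω)) P := hX.star.integrable one_le_two
  have h3 : Integrable (fun ω => X ω * star (X ω)) P := hX.integrable_mul hX.star
  have h4 : ∫ ω, star (X ω) ∂P = star m := integral_conj
  have h5 : ∀ ω, ((‖X ω - m‖ ^ 2 : ℝ) : ℂ) =
      X ω * star (X ω) - m * star (X ω) - star m * X ω + m * star m := by
    intro ω
    rw [Complex.ofReal_pow, ← Complex.mul_conj', map_sub]
    simp only [Complex.star_def]
    ring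
  rw [← integral_complex_ofReal]
  simp only [h5]
  have h6 : Integrable (fun ω => X ω * star (X ω) - m * star (X ω)) P := h3.sub (h2.const_mul m)
  have h7 : Integrable (fun ω => X ω * star (X ω) - m * star (X ω) - star m * X ω) P :=
    h6.sub (h1.const_mul _)
  rw [integral_add h7 (integrable_const _), integral_sub h6 (h1.const_mul _),
    integral_sub h3 (h2.const_mul m),
    integral_const_mul, integral_const_mul, integral_const, h4, ← hm]
  simp
  ring

/-- The adjoint of a monomial. -/
def starWord {I : Type*} (α : List (I × Bool)) : List (I × Bool) :=
  (α.map fun p => (p.1, !p.2)).reverse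

theorem evalMonomial_starWord {I B : Type*} [Monoid B] [StarMul B] (x : I → B)
    (α : List (I × Bool)) : evalMonomial x (starWord α) = star (evalMonomial x α) := by
  induction α with
  | nil => simp [evalMonomial, starWord]
  | cons p α ih =>
    have h : evalMonomial x (p :: α) =
        (if p.2 then star (x p.1) else x p.1) * evalMonomial x α := by simp [evalMonomial]
    have h' : evalMonomial x (starWord (p :: α)) = evalMonomial x (starWord α) *
        (if !p.2 then star (x p.1) else x p.1) := by simp [evalMonomial, starWord]
    rw [h, h', star_mul, ih]
    cases p.2 <;> simp

theorem ntr_star {N : ℕ} (A : Matrix (Fin N) (Fin N) ℂ) : ntr (star A) = star (ntr A) := by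
  simp [ntr, Matrix.star_eq_conjTranspose, Matrix.trace_conjTranspose]

theorem convergesStarDistrAS_of_traceSystem {s : ℕ} {f : Fin s × ℕ × ℕ → Ω → ℂ}
    (hf : IsComplexGaussianFamily P f) {c : ℝ}
    {𝒜 : Type*} [Ring 𝒜] [StarRing 𝒜] [Algebra ℂ 𝒜] {φ : 𝒜 →ₗ[ℂ] ℂ} {x : Fin s ⊕ Fin s → 𝒜}
    {U : (N : ℕ) → Fin s → Ω → Matrix (Fin N) (Fin N) ℂ}
    {V : (M N : ℕ) → Fin s → Ω → Matrix (Fin N) (Fin N) ℂ}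
    {y : ∀ _ N : ℕ, (Fin s → Equiv.Perm (Fin N)) → (Fin s ⊕ Fin s) × Bool →
      Matrix (Fin N) (Fin N) (GaussRing s)}
    (hU : ∀ N, 1 ≤ N → ∀ r, IsUniformPermMatrix P (U N r))
    (hV : ∀ M N r, Measurable (V M N r))
    (hind : ∀ M N, 1 ≤ M → 1 ≤ N → iIndepFun (Sum.elim (U N) (V M N)) P)
    (hy : ∀ M N, Represents f (y M N) (V M N))
    (hsys : ∀ M N : ℕ → ℕ, Tendsto N atTop atTop →
      Tendsto (fun q => (M q : ℝ) / (N q : ℝ)) atTop (𝓝 c) →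
      TraceSystem matDeg (fun q => 1 / (N q : ℝ) ^ 2) (fun q => permExp hf (y (M q) (N q)))
        fun A => φ (evalMonomial x A)) :
    ConvergesStarDistrAS P c φ (fun M N => Sum.elim (U N) (V M N)) x := by
  intro α M N hM hN hMt hNt hc
  have sys := hsys M N hNt hc
  have hlim := sys.tendsto [α]
  simp only [List.map_cons, List.map_nil, List.prod_cons, List.prod_nil, mul_one] at hlim
  obtain ⟨C, hC, hbound⟩ := (sys.isBigO [α] [starWord α]).exists_pos
  -- The variance bound is only eventual, and the assumptions on the matrices concern positive
  -- sizes, so the sequences are shifted by some `q₀`. Beyond it also `M/N ≤ c + 1`, which gives `M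
  -- + N ≤ (c + 2) N` and the value of `D`.
  have hev := (((hbound.bound.and (hNt.eventually_ge_atTop 1)).and
    (hMt.eventually_ge_atTop 1)).and (hc.eventually_le_const (lt_add_one c)))
  obtain ⟨q₀, hq₀⟩ := eventually_atTop.1 hev
  let X : ℕ → ℕ → Ω → ℂ := fun M N ω => ntr (evalMonomial (fun i => Sum.elim (U N) (V M N) i ω) α)
  have hmom : ∀ M N, 1 ≤ N → MemLp (X M N) 2 P := by
    intro M N hN1
    have h := hasAllMoments_monomialTraces hf (hU N hN1) (hy M N) [α] 2 (by simp)
    simpa [monomialTraces] using h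
  have hint : ∀ M N, 1 ≤ M → 1 ≤ N → ∫ ω, X M N ω ∂P = permExp hf (y M N) [α] := by
    intro M N hM1 hN1
    rw [← integral_monomialTraces hf (hU N hN1) (hV M N) (hind M N hM1 hN1) (hy M N)]
    simp [monomialTraces, X]
  have hstar : ∀ M N ω, star (X M N ω) =
      ntr (evalMonomial (fun i => Sum.elim (U N) (V M N) i ω) (starWord α)) := by
    intro M N ω
    rw [evalMonomial_starWord, ntr_star]
  -- The conjugate of the trace of `α` is the trace of `starWord α`, so the variance is the quantity
  -- bounded by `TraceSystem.isBigO`.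
  have hvar : ∀ M N, 1 ≤ M → 1 ≤ N →
      ((∫ ω, ‖X M N ω - permExp hf (y M N) [α]‖ ^ 2 ∂P : ℝ) : ℂ) =
        permExp hf (y M N) ([α] ++ [starWord α]) -
          permExp hf (y M N) [α] * permExp hf (y M N) [starWord α] := by
    intro M N hM1 hN1
    have h := integral_norm_sub_sq (hmom M N hN1)
    rw [hint M N hM1 hN1] at h
    rw [h, ← integral_monomialTraces hf (hU N hN1) (hV M N) (hind M N hM1 hN1) (hy M N)
      ([α] ++ [starWord α]),
      ← integral_monomialTraces hf (hU N hN1) (hV M N) (hind M N hM1 hN1) (hy M N) [starWord α]]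
    simp only [hstar]
    simp [monomialTraces, X]
  have hae := ae_tendsto_zero_of_monotone (P := P)
    (Z := fun M N ω => X M N ω - permExp hf (y M N) [α])
    (M := fun q => M (q + q₀)) (N := fun q => N (q + q₀))
    (fun a b hab => hM (Nat.add_le_add_right hab q₀))
    (fun a b hab => hN (Nat.add_le_add_right hab q₀)) ((tendsto_add_atTop_iff_nat q₀).2 hNt)
    (C := C) (D := c + 2) hC.le (fun q => (hq₀ _ (Nat.le_add_left q₀ q)).1.1.2) ?_ ?_ ?_
  · filter_upwards [hae] with ω hω
    have h1 := (tendsto_add_atTop_iff_nat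
      (f := fun q => X (M q) (N q) ω - permExp hf (y (M q) (N q)) [α]) q₀).1 hω
    have h2 := h1.add hlim
    simpa [X] using h2
  · intro q
    obtain ⟨⟨⟨_, h1⟩, _⟩, h2⟩ := hq₀ _ (Nat.le_add_left q₀ q)
    have h3 : (0 : ℝ) < N (q + q₀) := by exact_mod_cast h1
    rw [div_le_iff₀ h3] at h2
    linarith
  · intro q
    exact (hmom _ _ (hq₀ _ (Nat.le_add_left q₀ q)).1.1.2).sub (memLp_const _)
  · intro q
    obtain ⟨⟨⟨h1, h2⟩, h3⟩, _⟩ := hq₀ _ (Nat.le_add_left q₀ q)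
    rw [← hvar _ _ h3 h2, Complex.norm_real, Real.norm_of_nonneg
      (integral_nonneg fun ω => sq_nonneg _), Real.norm_of_nonneg (by positivity)] at h1
    exact h1

end AlmostSure

end RandPerm
theorem theorem2 {s : ℕ} {c : ℝ} (hc : 0 < c)
    -- the tracial `*`-probability space and the limit family
    {𝒜 : Type*} [Ring 𝒜] [StarRing 𝒜] [Algebra ℂ 𝒜] [StarModule ℂ 𝒜]
    (φ : 𝒜 →ₗ[ℂ] ℂ) (hφ : RandPerm.IsTracialState φ)
    (u g w : Fin s → 𝒜)
    (hu : ∀ r, RandPerm.IsHaarUnitary φ (u r))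
    (hg : ∀ r, RandPerm.IsStandardCircular φ (g r))
    (hw : ∀ r, RandPerm.IsFreePoisson φ c (w r))
    (hug : RandPerm.IsStarFree φ (Sum.elim u g))
    (huw : RandPerm.IsStarFree φ (Sum.elim u w))
    -- the random matrices
    {Ω : Type*} [MeasurableSpace Ω] (P : Measure Ω) [IsProbabilityMeasure P]
    (f : Fin s × ℕ × ℕ → Ω → ℂ) (hf : RandPerm.IsComplexGaussianFamily P f)
    (U : (N : ℕ) → Fin s → Ω → Matrix (Fin N) (Fin N) ℂ)
    (hU : ∀ N, 1 ≤ N → ∀ r, RandPerm.IsUniformPermMatrix P (U N r))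
    (hUG : ∀ N, 1 ≤ N → iIndepFun (Sum.elim (U N) (RandPerm.gaussSquare f N)) P)
    (hUW : ∀ M N, 1 ≤ M → 1 ≤ N →
      iIndepFun (Sum.elim (U N) (RandPerm.wishart f M N)) P) :
    RandPerm.ConvergesStarDistrAS P c φ
        (fun _ N => Sum.elim (U N) (RandPerm.gaussSquare f N)) (Sum.elim u g) ∧
      RandPerm.ConvergesStarDistrAS P c φ
        (fun M N => Sum.elim (U N) (RandPerm.wishart f M N)) (Sum.elim u w) := by

  refine ⟨RandPerm.convergesStarDistrAS_of_traceSystem hf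
      (V := fun _ N => RandPerm.gaussSquare f N) (y := fun _ _ => RandPerm.gaussLetter) hU
      (fun _ N r => RandPerm.measurable_gaussSquare hf N r) (fun _ N _ hN => hUG N hN)
      (fun _ _ => RandPerm.represents_gaussLetter)
      fun _ _ hN _ => RandPerm.traceSystem_gauss hf hφ hu hg hug hN,
    RandPerm.convergesStarDistrAS_of_traceSystem hf
      (V := fun M N => RandPerm.wishart f M N) (y := fun M _ => RandPerm.wishartLetter M) hU
      (fun M N r => RandPerm.measurable_wishart hf M N r) hUW
      (fun M _ => RandPerm.represents_wishartLetter M)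
      fun _ _ hN hMN => RandPerm.traceSystem_wishart hf hφ hu hw huw hN hMN⟩
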